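/- \textbf{Setting.} Let $n\in\mathbb{N}$ and $\hbar>0$. For multi-indices $R,S\in\mathbb{N}^n$ write $\partial^{R}\bar\partial^{S}f=\frac{\partial^{|R|+|S|}f}{\partial z^R\partial\bar z^S}$. For smooth $f:\mathbb{C}^n\to\mathbb{C}$ put $$h_{0,0,R,S}(f)=\sum_{N\in\mathbb{N}^n}\frac{(2\hbar)^{|R|+|S|+|N|}}{N!}\bigl|\partial^{R}\bar\partial^{N+S}f(0)\bigr|^2\in[0,\infty],$$ and for $m\ge1$, $0\le\ell\le2^m-1$, recursively $$h_{m,\ell,R,S}(f)=\sum_{N}\frac1{N!}\Bigl(\sum_{I\le R}\sum_{J\le N+S}\binom RI\binom{N+S}{J}\,h'_{I,J}(f)\Bigr)^2,$$ where $h'_{I,J}=h_{m-1,\ell/2,I,J}$ if $\ell$ is even and $h'_{I,J}=h_{m-1,(\ell-1)/2,J,I}$ if $\ell$ is odd. Let $\|f\|_{m,\ell,R,S}=h_{m,\ell,R,S}(f)^{1/2^{m+1}}$, and let $\mathcal{A}_\hbar$ be the space of real-analytic $f:\mathbb{C}^n\to\mathbb{C}$ with $\|f\|_{m,\ell,R,S}<\infty$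 for all $m$, $0\le \ell\le 2^m-1$, $R$, $S$, with the locally convex topology of these seminorms. It is a Fréchet space, closed under complex conjugation and under the Wick product $f\star g=\sum_{N}\frac{(2\hbar)^{|N|}}{N!}\,\partial^Nf\;\bar\partial^Ng$ (pointwise convergent). Let $\delta_0(f)=f(0)$, let $\mathcal{J}_0=\{f\in\mathcal{A}_\hbar:\delta_0(\bar f\star f)=0\}$ be its Gel'fand ideal, and let $\mathfrak{D}_0=\mathcal{A}_\hbar/\mathcal{J}_0$ carry the quotient topology, the quotient seminorms $\|[f]\|_{m,\ell,R,S}=\inf_{g\in\mathcal{J}_0}\|f+g\|_{m,\ell,R,S}$, and the inner product $\langle[f],[g]\rangle=\delta_0(\bar f\star g)$. The Bargmann–Fock space $\mathfrak{H}_{BF}$ is the space of antiholomorphic functions on $\mathbb{C}^n$ that are square-integrable for $(2\pi\hbar)^{-n}e^{-|z|^2/2\hbar}$ times Lebesgue measure, with the $L^2$ inner product (conjugate-linear in the first argument). \textbf{Theorem.} \begin{enumerate} \item For $f\in\mathcal{A}_\hbar$ the series $\Psi_f(z)=\sum_{I}\frac1{I!}\bar\partial^{I}f(0)\,\bar z^I$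 converges for every $z$, and $\Psi:f\mapsto\Psi_f$ is a continuous linear map $\mathcal{A}_\hbar\to\mathcal{A}_\hbar$ with $\Psi^2=\Psi$ and $\ker\Psi=\mathcal{J}_0$. Moreover $\|\Psi_f\|_{m,\ell,R,S}\le\|f\|_{m,\ell,R,S}$ for all $m,\ell,R,S$, and equality holds for all $m,\ell,R,S$ simultaneously if and only if $f$ is antiholomorphic. \item $\mathfrak{D}_0$ and $\mathfrak{D}=\operatorname{im}\Psi\subseteq\mathcal{A}_\hbar$ are Fréchet spaces, $[f]\mapsto\Psi_f$ is a well-defined linear homeomorphism $\mathfrak{D}_0\to\mathfrak{D}$, and $\|[f]\|_{m,\ell,R,S}=\|\Psi_f\|_{m,\ell,R,S}$. \item $\mathfrak{D}$ is a dense subspace of $\mathfrak{H}_{BF}$; the map $[f]\mapsto\Psi_f$ is isometric, $\langle\Psi_f,\Psi_g\rangle_{BF}=\langle[f],[g]\rangle$; and the Fréchet topology of $\mathfrak{D}$ is finer than (or equal to) the topology induced from $\mathfrak{H}_{BF}$. \item The GNS representation $\rho(f)[g]=[f\star g]$ of $\mathcal{A}_\hbar$ on $\mathfrak{D}_0$ is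 well defined, and the representation $\pi$ on $\mathfrak{D}$ that corresponds to it under $[f]\mapsto\Psi_f$ (the Bargmann–Fock representation) is given, for $f,g\in\mathcal{A}_\hbar$, by $$\pi(f)\Psi_g=\sum_{I}\frac{(2\hbar)^{|I|}}{I!}\Bigl(\sum_{J}\frac1{J!}\,\partial^{I}\bar\partial^{J}f(0)\;\bar z^J\Bigr)\,\bar\partial^{I}\Psi_g,$$ where for each $I$ the inner series over $J$ and then the outer series over $I$ converge unconditionally in the topology of $\mathfrak{D}$. \item The bilinear map $\mathcal{A}_\hbar\times\mathfrak{D}\to\mathfrak{D}$, $(f,\Psi_g)\mapsto\pi(f)\Psi_g$, is (jointly) continuous. \end{enumerate} -/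

import Mathlib

open MeasureTheory Complex Topology Filter
open scoped ENNReal ContDiff

namespace WickGNS

/-! ### Multi-indices -/

/-- Multi-indices in `ℕⁿ`, with the componentwise order and addition. -/
abbrev MI (n : ℕ) : Type := Fin n → ℕ

/-- `|R| = r₁ + ⋯ + rₙ`. -/
def MI.deg {n : ℕ} (R : MI n) : ℕ := ∑ k, R k

/-- `R! = r₁! ⋯ rₙ!`. -/
def MI.fact {n : ℕ} (R : MI n) : ℕ := ∏ k, (R k).factorial

/-- The multi-index binomial coefficient. -/
def MI.binom {n : ℕ} (R I : MI n) : ℕ := ∏ k, (R k).choose (I k)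

/-- The antiholomorphic monomial `z̄^I`. -/
noncomputable def zbarPow {n : ℕ} (I : MI n) (z : Fin n → ℂ) : ℂ :=
  ∏ k, (starRingEnd ℂ) (z k) ^ I k

/-! ### Wirtinger derivatives -/

/-- `∂f/∂z^k = (1/2)(∂_x - i ∂_y) f`. -/
noncomputable def dz {n : ℕ} (k : Fin n) (f : (Fin n → ℂ) → ℂ) (x : Fin n → ℂ) : ℂ :=
  (1 / 2 : ℂ) * (fderiv ℝ f x (Pi.single k 1) - I * fderiv ℝ f x (Pi.single k I))

/-- `∂f/∂z̄^k = (1/2)(∂_x + i ∂_y) f`. -/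
noncomputable def dzbar {n : ℕ} (k : Fin n) (f : (Fin n → ℂ) → ℂ) (x : Fin n → ℂ) : ℂ :=
  (1 / 2 : ℂ) * (fderiv ℝ f x (Pi.single k 1) + I * fderiv ℝ f x (Pi.single k I))

/-- Apply `D k` exactly `R k` times, for every `k` (on smooth functions the order of the
partial derivatives is irrelevant). -/
def iterD {n : ℕ} (D : Fin n → ((Fin n → ℂ) → ℂ) → ((Fin n → ℂ) → ℂ)) (R : MI n)
    (f : (Fin n → ℂ) → ℂ) : (Fin n → ℂ) → ℂ :=
  (List.finRange n).foldr (fun k g => (D k)^[R k] g) f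

/-- `∂^{|R|+|S|} f / ∂z^R ∂z̄^S`. -/
noncomputable def mixedD {n : ℕ} (R S : MI n) (f : (Fin n → ℂ) → ℂ) : (Fin n → ℂ) → ℂ :=
  iterD dz R (iterD dzbar S f)

/-! ### The seminorms -/

/-- The recursively defined quantities `h_{m,ℓ,R,S}(f) ∈ [0,∞]` at the point `p`; the relevant
range is `0 ≤ ℓ ≤ 2^m - 1`. For odd `ℓ`, `ℓ / 2` is `(ℓ - 1) / 2`. -/
noncomputable def hWick {n : ℕ} (ħ : ℝ) (p : Fin n → ℂ) (f : (Fin n → ℂ) → ℂ) :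
    ℕ → ℕ → MI n → MI n → ℝ≥0∞
  | 0, _, R, S =>
      ∑' N : MI n, ENNReal.ofReal (2 * ħ) ^ (R.deg + S.deg + N.deg) / (N.fact : ℝ≥0∞) *
        ‖mixedD R (N + S) f p‖ₑ ^ 2
  | m + 1, l, R, S =>
      ∑' N : MI n, (N.fact : ℝ≥0∞)⁻¹ *
        (∑ I ∈ Finset.Icc 0 R, ∑ J ∈ Finset.Icc 0 (N + S),
          (R.binom I : ℝ≥0∞) * ((N + S).binom J : ℝ≥0∞) *
            (if Even l then hWick ħ p f m (l / 2) I J else hWick ħ p f m (l / 2) J I)) ^ 2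

/-- `‖f‖_{m,ℓ,R,S}`, the `2^{m+1}`-st root of `h_{m,ℓ,R,S}(f)`. -/
noncomputable def eNormWick {n : ℕ} (ħ : ℝ) (p : Fin n → ℂ) (m l : ℕ) (R S : MI n)
    (f : (Fin n → ℂ) → ℂ) : ℝ≥0∞ :=
  hWick ħ p f m l R S ^ (1 / (2 : ℝ) ^ (m + 1))

/-! ### Facts needed to see that these are seminorms -/

/-- Operators that preserve smoothness and are linear on smooth functions. -/
def SmoothLinear {n : ℕ} (T : ((Fin n → ℂ) → ℂ) → ((Fin n → ℂ) → ℂ)) : Prop :=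
  (∀ f, ContDiff ℝ ∞ f → ContDiff ℝ ∞ (T f)) ∧
  (∀ f g, ContDiff ℝ ∞ f → ContDiff ℝ ∞ g → T (f + g) = T f + T g) ∧
  (∀ (c : ℂ) f, ContDiff ℝ ∞ f → T (c • f) = c • T f)

theorem SmoothLinear.comp {n : ℕ} {T U : ((Fin n → ℂ) → ℂ) → ((Fin n → ℂ) → ℂ)}
    (hT : SmoothLinear T) (hU : SmoothLinear U) : SmoothLinear (fun f => T (U f)) := by
  refine ⟨fun f hf => hT.1 _ (hU.1 f hf), fun f g hf hg => ?_, fun c f hf => ?_⟩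
  · simp only [hU.2.1 f g hf hg, hT.2.1 _ _ (hU.1 f hf) (hU.1 g hg)]
  · simp only [hU.2.2 c f hf, hT.2.2 c _ (hU.1 f hf)]

theorem SmoothLinear.iter {n : ℕ} {T : ((Fin n → ℂ) → ℂ) → ((Fin n → ℂ) → ℂ)}
    (hT : SmoothLinear T) (r : ℕ) : SmoothLinear (T^[r]) := by
  induction r with
  | zero => exact ⟨fun f hf => hf, fun f g _ _ => rfl, fun c f _ => rfl⟩
  | succ r ih =>
    rw [Function.iterate_succ']
    exact hT.comp ih

theorem smoothLinear_wirtinger {n : ℕ} (k : Fin n) (s : ℂ) :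
    SmoothLinear (fun (f : (Fin n → ℂ) → ℂ) (x : Fin n → ℂ) =>
      (1 / 2 : ℂ) * (fderiv ℝ f x (Pi.single k 1) + s * fderiv ℝ f x (Pi.single k I))) := by
  refine ⟨fun f hf => ?_, fun f g hf hg => ?_, fun c f hf => ?_⟩
  · have h1 : ContDiff ℝ ∞ (fderiv ℝ f) := hf.fderiv_right (by simp)
    exact contDiff_const.mul ((h1.clm_apply contDiff_const).add
      (contDiff_const.mul (h1.clm_apply contDiff_const)))
  · funext x
    have hf' := (hf.differentiable (by simp)) x
    have hg' := (hg.differentiable (by simp)) x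
    simp only [Pi.add_apply, fderiv_add hf' hg', add_apply]
    ring
  · funext x
    have hf' := (hf.differentiable (by simp)) x
    simp only [Pi.smul_apply, fderiv_const_smul hf', smul_apply, smul_eq_mul]
    ring

theorem smoothLinear_dz {n : ℕ} (k : Fin n) : SmoothLinear (dz k) := by
  have h := smoothLinear_wirtinger k (-I)
  have e : dz k = (fun (f : (Fin n → ℂ) → ℂ) (x : Fin n → ℂ) =>
      (1 / 2 : ℂ) * (fderiv ℝ f x (Pi.single k 1) + (-I) * fderiv ℝ f x (Pi.single k I))) := by
    funext f x
    simp only [dz]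
    ring
  rw [e]
  exact h

theorem smoothLinear_dzbar {n : ℕ} (k : Fin n) : SmoothLinear (dzbar k) :=
  smoothLinear_wirtinger k I

theorem smoothLinear_iterD {n : ℕ} {D : Fin n → ((Fin n → ℂ) → ℂ) → ((Fin n → ℂ) → ℂ)}
    (hD : ∀ k, SmoothLinear (D k)) (R : MI n) : SmoothLinear (iterD D R) := by
  unfold iterD
  induction List.finRange n with
  | nil => exact ⟨fun f hf => hf, fun f g _ _ => rfl, fun c f _ => rfl⟩
  | cons k t ih => exact ((hD k).iter (R k)).comp ih

theorem smoothLinear_mixedD {n : ℕ} (R S : MI n) : SmoothLinear (mixedD R S) :=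
  (smoothLinear_iterD smoothLinear_dz R).comp (smoothLinear_iterD smoothLinear_dzbar S)

theorem tsum_Lp_add_le {ι : Type*} (w x y : ι → ℝ≥0∞) {p : ℝ} (hp : 1 ≤ p) :
    (∑' i, w i * (x i + y i) ^ p) ^ (1 / p) ≤
      (∑' i, w i * x i ^ p) ^ (1 / p) + (∑' i, w i * y i ^ p) ^ (1 / p) := by
  have hp0 : 0 < p := by linarith
  have key : ∀ (a b : ℝ≥0∞), a * b ^ p = (a ^ (1 / p) * b) ^ p := fun a b => by
    rw [ENNReal.mul_rpow_of_nonneg _ _ hp0.le, ← ENNReal.rpow_mul, one_div,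
      inv_mul_cancel₀ hp0.ne', ENNReal.rpow_one]
  let _ : MeasurableSpace ι := ⊤
  have h := ENNReal.lintegral_Lp_add_le (μ := (Measure.count : Measure ι))
    (f := fun i => w i ^ (1 / p) * x i) (g := fun i => w i ^ (1 / p) * y i)
    (measurable_from_top.aemeasurable) (measurable_from_top.aemeasurable) hp
  simp only [lintegral_count, Pi.add_apply, ← mul_add, ← key] at h
  exact h

theorem sum_Lp_add_le {ι : Type*} (s : Finset ι) (w x y : ι → ℝ≥0∞) {p : ℝ} (hp : 1 ≤ p) :
    (∑ i ∈ s, w i * (x i + y i) ^ p) ^ (1 / p) ≤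
      (∑ i ∈ s, w i * x i ^ p) ^ (1 / p) + (∑ i ∈ s, w i * y i ^ p) ^ (1 / p) := by
  have h := tsum_Lp_add_le (fun i : s => w i) (fun i : s => x i) (fun i : s => y i) hp
  simp only [tsum_fintype] at h
  rw [← Finset.sum_coe_sort s, ← Finset.sum_coe_sort s, ← Finset.sum_coe_sort s]
  exact h

theorem one_le_two_pow_real (m : ℕ) : (1 : ℝ) ≤ 2 ^ m := one_le_pow₀ (by norm_num)

theorem hWick_eq_rpow {n : ℕ} (ħ : ℝ) (p : Fin n → ℂ) (m l : ℕ) (R S : MI n)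
    (f : (Fin n → ℂ) → ℂ) :
    hWick ħ p f m l R S = eNormWick ħ p m l R S f ^ ((2 : ℝ) ^ (m + 1)) := by
  rw [eNormWick, ← ENNReal.rpow_mul, one_div, inv_mul_cancel₀ (by positivity), ENNReal.rpow_one]

theorem eNormWick_add_le {n : ℕ} (ħ : ℝ) (p : Fin n → ℂ) (m l : ℕ) (R S : MI n)
    {f g : (Fin n → ℂ) → ℂ} (hf : ContDiff ℝ ∞ f) (hg : ContDiff ℝ ∞ g) :
    eNormWick ħ p m l R S (f + g) ≤ eNormWick ħ p m l R S f + eNormWick ħ p m l R S g := by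
  induction m generalizing l R S with
  | zero =>
    have h := tsum_Lp_add_le
      (fun N : MI n => ENNReal.ofReal (2 * ħ) ^ (R.deg + S.deg + N.deg) / (N.fact : ℝ≥0∞))
      (fun N => ‖mixedD R (N + S) f p‖ₑ) (fun N => ‖mixedD R (N + S) g p‖ₑ)
      (p := 2) (by norm_num)
    simp only [eNormWick, hWick, zero_add, pow_one]
    simp only [ENNReal.rpow_two] at h
    refine le_trans (ENNReal.rpow_le_rpow (ENNReal.tsum_le_tsum fun N => ?_) (by norm_num)) h
    rw [(smoothLinear_mixedD R (N + S)).2.1 f g hf hg]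
    gcongr
    exact enorm_add_le _ _
  | succ m ih =>
    have hq : (1 : ℝ) ≤ 2 ^ (m + 1) := one_le_two_pow_real _
    have hq0 : (0 : ℝ) < 2 ^ (m + 1) := by positivity
    have hq2 : (1 : ℝ) ≤ 2 ^ (m + 1 + 1) := one_le_two_pow_real _
    set E : ((Fin n → ℂ) → ℂ) → MI n × MI n → ℝ≥0∞ := fun u P =>
      if Even l then eNormWick ħ p m (l / 2) P.1 P.2 u
      else eNormWick ħ p m (l / 2) P.2 P.1 u with hE
    set c : MI n → MI n × MI n → ℝ≥0∞ := fun N P =>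
      (R.binom P.1 : ℝ≥0∞) * ((N + S).binom P.2 : ℝ≥0∞) with hc
    set X : ((Fin n → ℂ) → ℂ) → MI n → ℝ≥0∞ := fun u N =>
      (∑ P ∈ Finset.Icc 0 R ×ˢ Finset.Icc 0 (N + S), c N P * E u P ^ ((2 : ℝ) ^ (m + 1))) ^
        (1 / (2 : ℝ) ^ (m + 1)) with hX
    have expand : ∀ u, hWick ħ p u (m + 1) l R S =
        ∑' N : MI n, (N.fact : ℝ≥0∞)⁻¹ * X u N ^ ((2 : ℝ) ^ (m + 1 + 1)) := by
      intro u
      rw [hWick]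
      refine tsum_congr fun N => ?_
      congr 1
      have e1 : ((2 : ℝ) ^ (m + 1 + 1)) = 2 ^ (m + 1) * 2 := pow_succ _ _
      rw [hX, e1]
      simp only
      rw [← ENNReal.rpow_mul, ← mul_assoc, one_div, inv_mul_cancel₀ hq0.ne', one_mul,
        ENNReal.rpow_two, Finset.sum_product]
      congr 1
      refine Finset.sum_congr rfl fun I _ => Finset.sum_congr rfl fun J _ => ?_
      simp only [hE, hc]
      congr 1
      split_ifs <;> exact hWick_eq_rpow _ _ _ _ _ _ _
    have hXadd : ∀ N, X (f + g) N ≤ X f N + X g N := by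
      intro N
      refine le_trans ?_ (sum_Lp_add_le _ (c N) (E f) (E g) hq)
      simp only [hX]
      gcongr with P hP
      simp only [hE]
      split_ifs
      · exact ih _ _ _
      · exact ih _ _ _
    simp only [eNormWick, expand]
    refine le_trans ?_ (tsum_Lp_add_le (fun N : MI n => (N.fact : ℝ≥0∞)⁻¹) (X f) (X g) hq2)
    gcongr with N
    exact hXadd N

theorem hWick_smul {n : ℕ} (ħ : ℝ) (p : Fin n → ℂ) (m l : ℕ) (R S : MI n) (a : ℂ)
    {f : (Fin n → ℂ) → ℂ} (hf : ContDiff ℝ ∞ f) :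
    hWick ħ p (a • f) m l R S = ‖a‖ₑ ^ 2 ^ (m + 1) * hWick ħ p f m l R S := by
  induction m generalizing l R S with
  | zero =>
    simp only [hWick]
    rw [← ENNReal.tsum_mul_left]
    refine tsum_congr fun N => ?_
    rw [(smoothLinear_mixedD R (N + S)).2.2 a f hf, Pi.smul_apply, enorm_smul]
    ring
  | succ m ih =>
    simp only [hWick]
    rw [← ENNReal.tsum_mul_left]
    refine tsum_congr fun N => ?_
    simp only [ih]
    have e : ∀ I J : MI n, (R.binom I : ℝ≥0∞) * ((N + S).binom J : ℝ≥0∞) *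
        (if Even l then ‖a‖ₑ ^ 2 ^ (m + 1) * hWick ħ p f m (l / 2) I J
          else ‖a‖ₑ ^ 2 ^ (m + 1) * hWick ħ p f m (l / 2) J I) =
        ‖a‖ₑ ^ 2 ^ (m + 1) * ((R.binom I : ℝ≥0∞) * ((N + S).binom J : ℝ≥0∞) *
          (if Even l then hWick ħ p f m (l / 2) I J else hWick ħ p f m (l / 2) J I)) := by
      intro I J
      split_ifs <;> ring
    simp only [e, ← Finset.mul_sum]
    ring

theorem eNormWick_smul {n : ℕ} (ħ : ℝ) (p : Fin n → ℂ) (m l : ℕ) (R S : MI n) (a : ℂ)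
    {f : (Fin n → ℂ) → ℂ} (hf : ContDiff ℝ ∞ f) :
    eNormWick ħ p m l R S (a • f) = ‖a‖ₑ * eNormWick ħ p m l R S f := by
  have h0 : (0 : ℝ) < 2 ^ (m + 1) := by positivity
  rw [eNormWick, hWick_smul ħ p m l R S a hf, ENNReal.mul_rpow_of_nonneg _ _ (by positivity),
    ← ENNReal.rpow_natCast, ← ENNReal.rpow_mul, eNormWick]
  push_cast
  rw [one_div, mul_inv_cancel₀ h0.ne', ENNReal.rpow_one]

/-! ### The Fréchet space `A_ħ` -/

/-- The index set of the seminorms: `m ∈ ℕ`, `ℓ ∈ {0, …, 2^m - 1}`, `R, S ∈ ℕⁿ`. -/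
abbrev SIdx (n : ℕ) : Type := Σ m : ℕ, Fin (2 ^ m) × MI n × MI n

/-- The real-analytic functions on `ℂⁿ` all of whose seminorms at `p` are finite. -/
noncomputable def wickSubmodule (n : ℕ) (ħ : ℝ) (p : Fin n → ℂ) :
    Submodule ℂ ((Fin n → ℂ) → ℂ) where
  carrier := {f | AnalyticOnNhd ℝ f Set.univ ∧
    ∀ (m : ℕ) (l : Fin (2 ^ m)) (R S : MI n), eNormWick ħ p m l R S f < ⊤}
  add_mem' {f g} hf hg := ⟨hf.1.add hg.1, fun m l R S =>
    (eNormWick_add_le ħ p m l R S hf.1.contDiff hg.1.contDiff).trans_lt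
      (ENNReal.add_lt_top.2 ⟨hf.2 m l R S, hg.2 m l R S⟩)⟩
  zero_mem' := by
    refine ⟨analyticOnNhd_const, fun m l R S => ?_⟩
    have h := eNormWick_smul ħ p m l R S 0 (f := (0 : (Fin n → ℂ) → ℂ)) contDiff_const
    rw [zero_smul, enorm_zero, zero_mul] at h
    rw [h]
    exact ENNReal.zero_lt_top
  smul_mem' a f hf := by
    have ha : AnalyticOnNhd ℝ (fun _ : Fin n → ℂ => a) Set.univ := analyticOnNhd_const
    refine ⟨ha.smul hf.1, fun m l R S => ?_⟩
    rw [eNormWick_smul ħ p m l R S a hf.1.contDiff]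
    exact ENNReal.mul_lt_top enorm_lt_top (hf.2 m l R S)

/-- The space `A_ħ`, realized at the point `p = 0`. It is a type of its own so that it does not
inherit the topology of pointwise convergence. -/
def WickAlg (n : ℕ) (ħ : ℝ) : Type := ↥(wickSubmodule n ħ 0)

variable {n : ℕ} {ħ : ℝ}

noncomputable instance : AddCommGroup (WickAlg n ħ) :=
  inferInstanceAs (AddCommGroup ↥(wickSubmodule n ħ 0))

noncomputable instance : Module ℂ (WickAlg n ħ) :=
  inferInstanceAs (Module ℂ ↥(wickSubmodule n ħ 0))

/-- Elements of `A_ħ` are functions on `ℂⁿ`. -/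
instance : CoeFun (WickAlg n ħ) (fun _ => (Fin n → ℂ) → ℂ) := ⟨fun f => f.1⟩

theorem WickAlg.analytic (f : WickAlg n ħ) : AnalyticOnNhd ℝ (f : (Fin n → ℂ) → ℂ) Set.univ :=
  (Subtype.property (p := fun u => u ∈ wickSubmodule n ħ 0) f).1

theorem WickAlg.finite (f : WickAlg n ħ) (m : ℕ) (l : Fin (2 ^ m)) (R S : MI n) :
    eNormWick ħ 0 m l R S (f : (Fin n → ℂ) → ℂ) < ⊤ :=
  (Subtype.property (p := fun u => u ∈ wickSubmodule n ħ 0) f).2 m l R S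

theorem WickAlg.contDiff (f : WickAlg n ħ) : ContDiff ℝ ∞ (f : (Fin n → ℂ) → ℂ) :=
  f.analytic.contDiff

/-- The seminorms `‖·‖_{m,ℓ,R,S}` (at `p = 0`) on `A_ħ`. -/
noncomputable def wickSeminorm (n : ℕ) (ħ : ℝ) : SeminormFamily ℂ (WickAlg n ħ) (SIdx n) :=
  fun q => Seminorm.of (fun f => (eNormWick ħ 0 q.1 q.2.1 q.2.2.1 q.2.2.2 f.1).toReal)
    (fun f g => by
      rw [← ENNReal.toReal_add (f.finite _ _ _ _).ne (g.finite _ _ _ _).ne]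
      exact ENNReal.toReal_mono
        (ENNReal.add_lt_top.2 ⟨f.finite _ _ _ _, g.finite _ _ _ _⟩).ne
        (eNormWick_add_le ħ 0 _ _ _ _ f.contDiff g.contDiff))
    (fun a f => by
      have h := eNormWick_smul ħ 0 q.1 q.2.1 q.2.2.1 q.2.2.2 a f.contDiff
      change (eNormWick ħ 0 _ _ _ _ (a • f.1)).toReal = _
      rw [h, ENNReal.toReal_mul, toReal_enorm])

/-- The locally convex topology defined by all the seminorms. -/
noncomputable instance : TopologicalSpace (WickAlg n ħ) :=
  (wickSeminorm n ħ).moduleFilterBasis.topology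

/-- A topological vector space is a Fréchet space if its topology is Hausdorff, defined by a
sequence of seminorms, and complete (every Cauchy sequence converges). -/
def IsFrechet (E : Type*) [AddCommGroup E] [Module ℂ E] [TopologicalSpace E] : Prop :=
  ∃ P : SeminormFamily ℂ E ℕ, WithSeminorms P ∧ (∀ x, (∀ i, P i x = 0) → x = 0) ∧
    ∀ u : ℕ → E, (∀ i, ∀ ε > (0 : ℝ), ∃ N, ∀ a ≥ N, ∀ b ≥ N, P i (u a - u b) < ε) →
      ∃ x, Tendsto u atTop (𝓝 x)

/-! ### The Wick product, the Gel'fand ideal and the GNS pre-Hilbert space -/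

/-- Pointwise complex conjugation. -/
noncomputable def conjFun (f : (Fin n → ℂ) → ℂ) : (Fin n → ℂ) → ℂ :=
  fun z => (starRingEnd ℂ) (f z)

/-- The `N`-th term of the Wick star product `f ⋆ g` at `z`. -/
noncomputable def wickTerm (ħ : ℝ) (f g : (Fin n → ℂ) → ℂ) (z : Fin n → ℂ) (N : MI n) : ℂ :=
  (2 * (ħ : ℂ)) ^ N.deg / (N.fact : ℂ) * mixedD N 0 f z * mixedD 0 N g z

/-- The Wick star product. -/
noncomputable def wickStar (ħ : ℝ) (f g : (Fin n → ℂ) → ℂ) : (Fin n → ℂ) → ℂ :=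
  fun z => ∑' N : MI n, wickTerm ħ f g z N

theorem dz_conj (k : Fin n) (f : (Fin n → ℂ) → ℂ) :
    dz k (conjFun f) = conjFun (dzbar k f) := by
  funext x
  have h : fderiv ℝ (conjFun f) x =
      (conjCLE : ℂ →L[ℝ] ℂ).comp (fderiv ℝ f x) :=
    conjCLE.comp_fderiv
  have h2 : (starRingEnd ℂ) 2 = 2 := map_ofNat _ 2
  simp [dz, dzbar, conjFun, h, h2, sub_eq_add_neg]

theorem iterD_dz_conj (R : MI n) (f : (Fin n → ℂ) → ℂ) :
    iterD dz R (conjFun f) = conjFun (iterD dzbar R f) := by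
  unfold iterD
  induction List.finRange n with
  | nil => rfl
  | cons k t ih =>
    simp only [List.foldr_cons, ih]
    generalize List.foldr (fun k g => (dzbar k)^[R k] g) f t = u
    induction R k with
    | zero => rfl
    | succ r ihr => rw [Function.iterate_succ_apply', ihr, dz_conj, Function.iterate_succ_apply']

theorem iterD_zero (D : Fin n → ((Fin n → ℂ) → ℂ) → ((Fin n → ℂ) → ℂ))
    (f : (Fin n → ℂ) → ℂ) : iterD D 0 f = f := by
  unfold iterD
  induction List.finRange n with
  | nil => rfl
  | cons k t ih => exact ih

theorem wickTerm_conj (ħ : ℝ) (f g : (Fin n → ℂ) → ℂ) (z : Fin n → ℂ) (N : MI n) :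
    wickTerm ħ (conjFun f) g z N = (2 * (ħ : ℂ)) ^ N.deg / (N.fact : ℂ) *
      (starRingEnd ℂ) (mixedD 0 N f z) * mixedD 0 N g z := by
  simp only [wickTerm, mixedD, iterD_zero, iterD_dz_conj]
  rfl

theorem MI.fact_pos (N : MI n) : 0 < N.fact :=
  Finset.prod_pos fun _ _ => Nat.factorial_pos _

/-- `δ₀(f̄ ⋆ f) = 0` exactly if all `z̄`-derivatives of `f` vanish at `0`. -/
theorem wickStar_conj_self_eq_zero_iff (hħ : 0 < ħ) (f : WickAlg n ħ) :
    wickStar ħ (conjFun f) f 0 = 0 ↔ ∀ N : MI n, mixedD 0 N f 0 = 0 := by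
  set a : MI n → ℝ := fun N => (2 * ħ) ^ N.deg / (N.fact : ℝ) * ‖mixedD 0 N f 0‖ ^ 2 with ha
  have ha0 : ∀ N, 0 ≤ a N := fun N => by positivity
  have hterm : ∀ N, wickTerm ħ (conjFun f) f 0 N = ((a N : ℝ) : ℂ) := by
    intro N
    rw [wickTerm_conj, mul_assoc, Complex.conj_mul', ha]
    push_cast
    rfl
  have hsum : Summable a := by
    have h := f.finite 0 0 0 0
    have h2 : hWick ħ 0 (f : (Fin n → ℂ) → ℂ) 0 0 0 0 ≠ ⊤ := by
      intro h3
      simp only [eNormWick, Fin.val_zero, h3] at h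
      rw [ENNReal.top_rpow_of_pos (by positivity)] at h
      exact lt_irrefl _ h
    simp only [hWick] at h2
    have h4 := ENNReal.summable_toReal h2
    refine h4.congr fun N => ?_
    have hd : MI.deg (0 : MI n) = 0 := by simp [MI.deg]
    simp only [ENNReal.toReal_mul, ENNReal.toReal_div, ENNReal.toReal_pow, toReal_enorm,
      ENNReal.toReal_natCast, hd, zero_add, add_zero, ha]
    rw [ENNReal.toReal_ofReal (by positivity)]
  have hstar : wickStar ħ (conjFun f) f 0 = ((∑' N, a N : ℝ) : ℂ) := by
    rw [wickStar, Complex.ofReal_tsum]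
    exact tsum_congr hterm
  rw [hstar, Complex.ofReal_eq_zero]
  constructor
  · intro h N
    have h5 := (hasSum_zero_iff_of_nonneg ha0).1 (h ▸ hsum.hasSum)
    have h6 : a N = 0 := congrFun h5 N
    have h7 : 0 < (2 * ħ) ^ N.deg / (N.fact : ℝ) := by
      have := N.fact_pos
      positivity
    simpa [ha, h7.ne'] using h6
  · intro h
    have : a = fun _ => 0 := by
      funext N
      simp [ha, h N]
    rw [this, tsum_zero]

/-- The Gel'fand ideal `J₀ = {f ∈ A_ħ | δ₀(f̄ ⋆ f) = 0}` of the evaluation functional `δ₀`. -/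
noncomputable def gelfandIdeal (n : ℕ) (ħ : ℝ) (hħ : 0 < ħ) : Submodule ℂ (WickAlg n ħ) where
  carrier := {f | wickStar ħ (conjFun f) f 0 = 0}
  add_mem' {f g} hf hg := by
    rw [Set.mem_ofPred_eq, wickStar_conj_self_eq_zero_iff hħ] at *
    intro N
    change mixedD 0 N (f.1 + g.1) 0 = 0
    rw [(smoothLinear_mixedD 0 N).2.1 _ _ f.contDiff g.contDiff, Pi.add_apply, hf N, hg N,
      add_zero]
  zero_mem' := by
    rw [Set.mem_ofPred_eq, wickStar_conj_self_eq_zero_iff hħ]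
    intro N
    have h := (smoothLinear_mixedD (n := n) 0 N).2.2 0 0 contDiff_const
    rw [zero_smul, zero_smul] at h
    exact congrFun h 0
  smul_mem' a f hf := by
    rw [Set.mem_ofPred_eq, wickStar_conj_self_eq_zero_iff hħ] at *
    intro N
    change mixedD 0 N (a • f.1) 0 = 0
    rw [(smoothLinear_mixedD 0 N).2.2 _ _ f.contDiff, Pi.smul_apply, hf N, smul_zero]

theorem mem_gelfandIdeal_iff (hħ : 0 < ħ) (f : WickAlg n ħ) :
    f ∈ gelfandIdeal n ħ hħ ↔ ∀ N : MI n, mixedD 0 N f 0 = 0 :=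
  wickStar_conj_self_eq_zero_iff hħ f

/-- The GNS space `D₀ = A_ħ / J₀`, with the quotient topology. -/
abbrev GNSSpace (n : ℕ) (ħ : ℝ) (hħ : 0 < ħ) : Type := WickAlg n ħ ⧸ gelfandIdeal n ħ hħ

/-- The class `[f] ∈ D₀`. -/
noncomputable abbrev gnsClass (hħ : 0 < ħ) (f : WickAlg n ħ) : GNSSpace n ħ hħ :=
  (gelfandIdeal n ħ hħ).mkQ f

/-- The quotient seminorm `‖[f]‖ = inf {‖f + g‖ | g ∈ J₀}`, written as an infimum over all
representatives. -/
noncomputable def gnsSeminorm (hħ : 0 < ħ) (q : SIdx n) (x : GNSSpace n ħ hħ) : ℝ :=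
  sInf (wickSeminorm n ħ q '' {f | gnsClass hħ f = x})

theorem mixedD_eq_of_gnsClass_eq (hħ : 0 < ħ) {f g : WickAlg n ħ}
    (h : gnsClass hħ f = gnsClass hħ g) (N : MI n) : mixedD 0 N f 0 = mixedD 0 N g 0 := by
  have h1 : f - g ∈ gelfandIdeal n ħ hħ := (Submodule.Quotient.eq _).1 h
  have h2 := (mem_gelfandIdeal_iff hħ _).1 h1 N
  have h3 : (f : (Fin n → ℂ) → ℂ) = (f - g : WickAlg n ħ).1 + g.1 := by
    change f.1 = (f.1 - g.1) + g.1
    simp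
  have h4 := (smoothLinear_mixedD 0 N).2.1 _ _ (f - g).contDiff g.contDiff
  rw [h3, h4, Pi.add_apply, h2, zero_add]

/-- The GNS inner product `⟨[f], [g]⟩ = δ₀(f̄ ⋆ g)` on `D₀`. -/
noncomputable def gnsInner (hħ : 0 < ħ) (x y : GNSSpace n ħ hħ) : ℂ :=
  Quotient.liftOn₂' x y (fun f g : WickAlg n ħ => wickStar ħ (conjFun f) g 0)
    (fun f g f' g' hf hg => by
      have hf' : gnsClass hħ f = gnsClass hħ f' := Quotient.sound' hf
      have hg' : gnsClass hħ g = gnsClass hħ g' := Quotient.sound' hg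
      simp only [wickStar, wickTerm_conj, mixedD_eq_of_gnsClass_eq hħ hf',
        mixedD_eq_of_gnsClass_eq hħ hg'])

theorem gnsInner_mk (hħ : 0 < ħ) (f g : WickAlg n ħ) :
    gnsInner hħ (gnsClass hħ f) (gnsClass hħ g) = wickStar ħ (conjFun f) g 0 := rfl

/-! ### The `z̄`-Taylor expansion and the Bargmann–Fock space -/

/-- A function on `ℂⁿ` is antiholomorphic if its complex conjugate is holomorphic. -/
def IsAntiholomorphic (f : (Fin n → ℂ) → ℂ) : Prop := Differentiable ℂ (conjFun f)

/-- The Gaussian measure `(2πħ)^{-n} exp(-z̄z/(2ħ)) dz dz̄` on `ℂⁿ`. -/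
noncomputable def bfMeasure (n : ℕ) (ħ : ℝ) : Measure (Fin n → ℂ) :=
  (volume : Measure (Fin n → ℂ)).withDensity fun z =>
    ENNReal.ofReal (1 / (2 * Real.pi * ħ) ^ n * Real.exp (-(∑ k, ‖z k‖ ^ 2) / (2 * ħ)))

/-- The Bargmann–Fock space: the (classes of) antiholomorphic functions that are
square-integrable for the Gaussian measure, with the `L²` inner product. -/
noncomputable def bargmannFock (n : ℕ) (ħ : ℝ) : Submodule ℂ (Lp ℂ 2 (bfMeasure n ħ)) where
  carrier := {ψ | ∃ F : (Fin n → ℂ) → ℂ, IsAntiholomorphic F ∧ ψ =ᵐ[bfMeasure n ħ] F}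
  add_mem' := by
    rintro ψ φ ⟨F, hF, hψ⟩ ⟨G, hG, hφ⟩
    refine ⟨F + G, ?_, (Lp.coeFn_add ψ φ).trans (hψ.add hφ)⟩
    have e : conjFun (F + G) = conjFun F + conjFun G := by
      funext z
      simp [conjFun]
    rw [IsAntiholomorphic, e]
    exact Differentiable.add hF hG
  zero_mem' := by
    refine ⟨0, ?_, Lp.coeFn_zero _ _ _⟩
    have e : conjFun (0 : (Fin n → ℂ) → ℂ) = fun _ => 0 := by
      funext z
      simp [conjFun]
    rw [IsAntiholomorphic, e]
    exact differentiable_const 0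
  smul_mem' := by
    rintro a ψ ⟨F, hF, hψ⟩
    refine ⟨a • F, ?_, (Lp.coeFn_smul a ψ).trans (hψ.const_smul a)⟩
    have e : conjFun (a • F) = (starRingEnd ℂ) a • conjFun F := by
      funext z
      simp [conjFun]
    rw [IsAntiholomorphic, e]
    exact Differentiable.const_smul hF _

end WickGNS

open WickGNS

/-! The whole theorem is transported to arrays a(R,S) of Taylor coefficients ∂^R ∂̄^S f(0). By
`hWick_eq_wickIter` the seminorms depend on f only through the absolute values of these
coefficients, and by `wickBase_mono` and `wickIter_mono` they increase with them. Hence deleting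
coefficients never increases a seminorm. Ψ is such a deletion, keeping exactly the coefficients with
R = 0, so contractivity, idempotence and the kernel can be read off from coefficients; the infimum
in the quotient seminorm is attained at Ψ_f.

Arrays and functions are interchangeable because finiteness of the seminorms forces ‖a(R,S)‖⁴ ≤ C
D^{|R|+|S|} R! S! (`WickArray.exists_bound`). The Taylor series therefore converges absolutely
everywhere, may be differentiated termwise and defines an analytic function with the given
coefficients, while the identity theorem `eq_zero_of_mixedD_eq_zero` gives uniqueness. Completeness
of A_ħ is a Fatou argument (`lowerSemicontinuous_wickIter_wickBase`) and convergence of parts of a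
Taylor series is dominated convergence (`WickAlg.tendsto_of_dominated`).

The product and the conjugation are controlled by the Cauchy–Schwarz inequality. An inequality x² ≤
y z between double sequences is inherited by every step of the recursion (`wickIter_sq_le`). Applied
to the Leibniz formula for f ⋆ g it bounds a seminorm of level m by a product of two seminorms of
level m + 1, one of f̄ and one of g (`wickIter_arrStar_sq_le`); this is why the recursion has its
particular form, and it yields joint continuity of ⋆.

The coefficients of f ⋆ g with R = 0 involve only the coefficients of g with R = 0. So J₀ is a left
ideal, and π(f)d = Ψ(f ⋆ d) on D, which is jointly continuous. Splitting f into its parts f_I with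
fixed z-exponent I gives a convergent series f = ∑ f_I, and π(f_I)d is precisely the I-th term of
the claimed expansion (`bfRep_fibre`, `hasSum_outerTerm`).

For the Bargmann–Fock space the point is the identity ∫|F|² = ∑ (2ħ)^{|I|}/I! |∂̄^I F(0)|² in [0,∞]
for every antiholomorphic F (`lintegral_taylorSum`): the Gaussian measure is invariant under the
torus, Parseval holds on every orbit, and the remaining integrals are Gaussian moments. Its
right-hand side is h_{0,0,0,0}. Isometry follows by polarization, and density by truncating the
Taylor series of a square-integrable antiholomorphic function. -/

namespace WickGNS

variable {n : ℕ} {ħ : ℝ}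

/-! ### Sums over multi-indices -/

theorem MI.deg_add (R S : MI n) : (R + S).deg = R.deg + S.deg := by
  simp [MI.deg, Finset.sum_add_distrib]

theorem MI.deg_zero : (0 : MI n).deg = 0 := by simp [MI.deg]

theorem MI.fact_zero : (0 : MI n).fact = 1 := by simp [MI.fact]

theorem MI.binom_self (R : MI n) : R.binom R = 1 := by simp [MI.binom]

theorem MI.fact_ne_zero (R : MI n) : R.fact ≠ 0 := R.fact_pos.ne'

theorem MI.binom_mul_fact_mul_fact {R I : MI n} (h : I ≤ R) :
    R.binom I * I.fact * (R - I).fact = R.fact := by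
  simp only [MI.binom, MI.fact, ← Finset.prod_mul_distrib]
  exact Finset.prod_congr rfl fun k _ => Nat.choose_mul_factorial_mul_factorial (h k)

theorem MI.binom_sub {R I : MI n} (h : I ≤ R) : R.binom (R - I) = R.binom I :=
  Finset.prod_congr rfl fun k _ => Nat.choose_symm (h k)

/-- Pascal's rule in each coordinate. It makes the binomial sums monotone under shifts of the
indices. -/
theorem MI.binom_le_add_add (R I K : MI n) : R.binom I ≤ (R + K).binom (I + K) := by
  refine Finset.prod_le_prod' fun k _ => ?_
  simp only [Pi.add_apply]
  induction K k with
  | zero => simp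
  | succ j ih =>
    refine ih.trans ?_
    rw [← add_assoc, ← add_assoc, Nat.choose_succ_succ]
    exact Nat.le_add_right _ _

theorem MI.prod_pow {α : Type*} [CommMonoid α] (D : α) (R : MI n) :
    ∏ k, D ^ R k = D ^ R.deg := by
  rw [MI.deg, Finset.prod_pow_eq_pow_sum]

theorem MI.Icc_zero_eq (R : MI n) :
    Finset.Icc 0 R = Fintype.piFinset fun k => Finset.range (R k + 1) := by
  ext I
  simp only [Finset.mem_Icc, zero_le, true_and, Fintype.mem_piFinset, Finset.mem_range, Pi.le_def,
    Nat.lt_succ_iff]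

/-- The binomial theorem in every coordinate. Binomial sums thus map geometric sequences to
geometric sequences, which keeps geometric bounds stable in the recursion. -/
theorem MI.sum_binom_mul_pow {α : Type*} [CommSemiring α] (D : α) (R : MI n) :
    ∑ I ∈ Finset.Icc 0 R, (R.binom I : α) * D ^ I.deg = (1 + D) ^ R.deg := by
  rw [MI.Icc_zero_eq, ← MI.prod_pow]
  have h : ∀ k, (1 + D) ^ R k = ∑ i ∈ Finset.range (R k + 1), ((R k).choose i : α) * D ^ i := by
    intro k
    rw [add_comm, add_pow]
    exact Finset.sum_congr rfl fun i _ => by rw [one_pow, mul_one, mul_comm]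
  simp only [h, Finset.prod_univ_sum]
  refine Finset.sum_congr rfl fun I _ => ?_
  rw [Finset.prod_mul_distrib, MI.prod_pow, MI.binom]
  push_cast
  rfl

theorem ENNReal_tsum_prod_apply (g : Fin n → ℕ → ℝ≥0∞) :
    ∑' N : MI n, ∏ k, g k (N k) = ∏ k, ∑' i, g k i := by
  induction n with
  | zero => simp
  | succ n ih =>
    rw [← (Fin.consEquiv (fun _ : Fin (n + 1) => ℕ)).tsum_eq, ENNReal.tsum_prod']
    simp only [Fin.consEquiv_apply, Fin.prod_univ_succ, Fin.cons_zero, Fin.cons_succ,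
      ENNReal.tsum_mul_left, ENNReal.tsum_mul_right]
    rw [ih (fun k => g k.succ)]

theorem ENNReal_tsum_pow_div_factorial_ne_top {D : ℝ≥0∞} (hD : D ≠ ⊤) :
    ∑' i : ℕ, D ^ i * ((i.factorial : ℕ) : ℝ≥0∞)⁻¹ ≠ ⊤ := by
  lift D to NNReal using hD
  have h : Summable fun i : ℕ => D ^ i * ((i.factorial : ℕ) : NNReal)⁻¹ := by
    rw [← NNReal.summable_coe]
    have := Real.summable_pow_div_factorial (D : ℝ)
    refine this.congr fun i => ?_
    push_cast
    rfl
  have h2 := ENNReal.tsum_coe_ne_top_iff_summable.2 h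
  refine ne_of_eq_of_ne (tsum_congr fun i => ?_) h2
  rw [ENNReal.coe_mul, ENNReal.coe_inv (by exact_mod_cast i.factorial_ne_zero)]
  push_cast
  rfl

theorem MI.tsum_pow_mul_fact_inv_ne_top {D : ℝ≥0∞} (hD : D ≠ ⊤) :
    ∑' N : MI n, (N.fact : ℝ≥0∞)⁻¹ * D ^ N.deg ≠ ⊤ := by
  have h : ∀ N : MI n, (N.fact : ℝ≥0∞)⁻¹ * D ^ N.deg =
      ∏ k, (D ^ N k * (((N k).factorial : ℕ) : ℝ≥0∞)⁻¹) := by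
    intro N
    rw [Finset.prod_mul_distrib, MI.prod_pow, mul_comm, MI.fact, Nat.cast_prod,
      ENNReal.prod_inv_distrib]
    intro i _ j _ _
    left
    exact_mod_cast Nat.factorial_ne_zero _
  simp only [h]
  rw [ENNReal_tsum_prod_apply (fun _ i => D ^ i * ((i.factorial : ℕ) : ℝ≥0∞)⁻¹)]
  exact ENNReal.prod_ne_top fun _ _ => ENNReal_tsum_pow_div_factorial_ne_top hD

/-! ### The Cauchy–Schwarz inequality for sums in `[0, ∞]` -/

/-- Cauchy–Schwarz for the counting measure. Hypothesis and conclusion have the same shape and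
contain no roots, so the inequality can be iterated through nested sums. -/
theorem ENNReal_tsum_sq_le {ι : Type*} {x y z : ι → ℝ≥0∞} (h : ∀ i, x i ^ 2 ≤ y i * z i) :
    (∑' i, x i) ^ 2 ≤ (∑' i, y i) * ∑' i, z i := by
  let _ : MeasurableSpace ι := ⊤
  have hc := ENNReal.lintegral_mul_le_Lp_mul_Lq (Measure.count : Measure ι)
    Real.HolderConjugate.two_two (f := fun i => y i ^ (1 / 2 : ℝ)) (g := fun i => z i ^ (1 / 2 : ℝ))
    (measurable_from_top.aemeasurable) (measurable_from_top.aemeasurable)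
  have e : ∀ a : ℝ≥0∞, (a ^ (1 / 2 : ℝ)) ^ (2 : ℝ) = a := fun a => by
    rw [← ENNReal.rpow_mul]
    norm_num
  simp only [lintegral_count, Pi.mul_apply, e] at hc
  have hx : ∀ i, x i ≤ y i ^ (1 / 2 : ℝ) * z i ^ (1 / 2 : ℝ) := fun i => by
    have h1 := ENNReal.rpow_le_rpow (h i) (show (0 : ℝ) ≤ 1 / 2 by norm_num)
    rwa [← ENNReal.rpow_two, ← ENNReal.rpow_mul, ENNReal.mul_rpow_of_nonneg _ _ (by norm_num),
      mul_one_div_cancel two_ne_zero, ENNReal.rpow_one] at h1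
  calc (∑' i, x i) ^ 2 ≤ ((∑' i, y i) ^ (1 / 2 : ℝ) * (∑' i, z i) ^ (1 / 2 : ℝ)) ^ 2 := by
        gcongr
        exact (ENNReal.tsum_le_tsum hx).trans hc
    _ = _ := by rw [mul_pow, ← ENNReal.rpow_two, ← ENNReal.rpow_two, e, e]

theorem ENNReal_sum_sq_le {ι : Type*} (s : Finset ι) {x y z : ι → ℝ≥0∞}
    (h : ∀ i ∈ s, x i ^ 2 ≤ y i * z i) :
    (∑ i ∈ s, x i) ^ 2 ≤ (∑ i ∈ s, y i) * ∑ i ∈ s, z i := by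
  have h' := ENNReal_tsum_sq_le (x := fun i : s => x i) (y := fun i : s => y i)
    (z := fun i : s => z i) (fun i => h i i.2)
  simp only [tsum_fintype] at h'
  rwa [← Finset.sum_coe_sort s, ← Finset.sum_coe_sort s, ← Finset.sum_coe_sort s]

/-! ### The recursion for the seminorms, on double sequences -/

/-- The binomial sum `∑_{I ≤ R} ∑_{J ≤ L} binom(R, I) binom(L, J) x(I, J)`. -/
noncomputable def binomSum (x : MI n → MI n → ℝ≥0∞) (R L : MI n) : ℝ≥0∞ :=
  ∑ I ∈ Finset.Icc 0 R, ∑ J ∈ Finset.Icc 0 L, (R.binom I : ℝ≥0∞) * (L.binom J : ℝ≥0∞) * x I J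

/-- One step of the recursion that defines `h_{m,ℓ,R,S}`. -/
noncomputable def wickStep (x : MI n → MI n → ℝ≥0∞) (R S : MI n) : ℝ≥0∞ :=
  ∑' N : MI n, (N.fact : ℝ≥0∞)⁻¹ * binomSum x R (N + S) ^ 2

/-- The recursion that defines `h_{m,ℓ,R,S}`, started at an arbitrary double sequence. -/
noncomputable def wickIter (x : MI n → MI n → ℝ≥0∞) : ℕ → ℕ → MI n → MI n → ℝ≥0∞
  | 0, _ => x
  | m + 1, l => wickStep (if Even l then wickIter x m (l / 2) else Function.swap (wickIter x m (l / 2)))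

/-- `h_{0,0,R,S}` in terms of the Taylor coefficients. -/
noncomputable def wickBase (ħ : ℝ) (a : MI n → MI n → ℂ) (R S : MI n) : ℝ≥0∞ :=
  ∑' N : MI n, ENNReal.ofReal (2 * ħ) ^ (R.deg + S.deg + N.deg) / (N.fact : ℝ≥0∞) *
    ‖a R (N + S)‖ₑ ^ 2

/-- The Taylor coefficients `∂^R ∂̄^S f(p)`. -/
noncomputable def taylorCoef (f : (Fin n → ℂ) → ℂ) (p : Fin n → ℂ) (R S : MI n) : ℂ :=
  mixedD R S f p

theorem hWick_eq_wickIter (p : Fin n → ℂ) (f : (Fin n → ℂ) → ℂ) (m l : ℕ) (R S : MI n) :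
    hWick ħ p f m l R S = wickIter (wickBase ħ (taylorCoef f p)) m l R S := by
  induction m generalizing l R S with
  | zero => rfl
  | succ m ih =>
    simp only [hWick, wickIter, wickStep, binomSum]
    refine tsum_congr fun N => ?_
    congr 2
    refine Finset.sum_congr rfl fun I _ => Finset.sum_congr rfl fun J _ => ?_
    simp only [ih]
    split_ifs <;> rfl

theorem binomSum_mono {x y : MI n → MI n → ℝ≥0∞} (h : ∀ R S, x R S ≤ y R S) (R L : MI n) :
    binomSum x R L ≤ binomSum y R L := by
  unfold binomSum
  gcongr
  exact h _ _

theorem wickStep_mono {x y : MI n → MI n → ℝ≥0∞} (h : ∀ R S, x R S ≤ y R S) (R S : MI n) :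
    wickStep x R S ≤ wickStep y R S := by
  unfold wickStep
  gcongr
  exact binomSum_mono h _ _

theorem wickIter_mono {x y : MI n → MI n → ℝ≥0∞} (h : ∀ R S, x R S ≤ y R S) (m l : ℕ)
    (R S : MI n) : wickIter x m l R S ≤ wickIter y m l R S := by
  induction m generalizing l R S with
  | zero => exact h R S
  | succ m ih =>
    refine wickStep_mono (fun I J => ?_) R S
    split_ifs
    · exact ih _ _ _
    · exact ih _ _ _

theorem binomSum_sq_le {x y z : MI n → MI n → ℝ≥0∞} (h : ∀ R S, x R S ^ 2 ≤ y R S * z R S)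
    (R L : MI n) : binomSum x R L ^ 2 ≤ binomSum y R L * binomSum z R L := by
  simp only [binomSum, ← Finset.sum_product']
  refine ENNReal_sum_sq_le _ fun P _ => ?_
  rw [mul_pow, sq (_ * _ : ℝ≥0∞), mul_mul_mul_comm _ (y _ _)]
  gcongr
  exact h _ _

theorem wickStep_sq_le {x y z : MI n → MI n → ℝ≥0∞} (h : ∀ R S, x R S ^ 2 ≤ y R S * z R S)
    (R S : MI n) : wickStep x R S ^ 2 ≤ wickStep y R S * wickStep z R S := by
  refine ENNReal_tsum_sq_le fun N => ?_
  rw [mul_pow, sq (_⁻¹ : ℝ≥0∞), mul_mul_mul_comm _ (binomSum y _ _ ^ 2), ← mul_pow]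
  gcongr
  exact binomSum_sq_le h _ _

/-- Every step of the recursion is a positive sum of squares of positive sums, so Cauchy–Schwarz
passes through all levels. A product estimate therefore has to be proved only for the starting
double sequence. -/
theorem wickIter_sq_le {x y z : MI n → MI n → ℝ≥0∞} (h : ∀ R S, x R S ^ 2 ≤ y R S * z R S)
    (m l : ℕ) (R S : MI n) :
    wickIter x m l R S ^ 2 ≤ wickIter y m l R S * wickIter z m l R S := by
  induction m generalizing l R S with
  | zero => exact h R S
  | succ m ih =>
    refine wickStep_sq_le (fun I J => ?_) R S
    split_ifs
    · exact ih _ _ _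
    · exact ih _ _ _

/-- The binary digits of ℓ decide about the swaps: the last step reads the lowest digit and the step
applied directly to `x` reads the digit of 2^m. Here that digit is 0. -/
theorem wickIter_succ_of_lt (x : MI n → MI n → ℝ≥0∞) {m l : ℕ} (hl : l < 2 ^ m) :
    wickIter x (m + 1) l = wickIter (wickStep x) m l := by
  induction m generalizing l with
  | zero =>
    obtain rfl : l = 0 := by simpa using hl
    simp [wickIter]
  | succ m ih =>
    have : l / 2 < 2 ^ m := by rw [pow_succ] at hl; omega
    rw [wickIter, ih this, wickIter]

/-- The same with top digit 1: the step applied directly to `x` swaps its indices. -/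
theorem wickIter_succ_add (x : MI n → MI n → ℝ≥0∞) {m l : ℕ} (hl : l < 2 ^ m) :
    wickIter x (m + 1) (l + 2 ^ m) = wickIter (wickStep (Function.swap x)) m l := by
  induction m generalizing l with
  | zero =>
    obtain rfl : l = 0 := by simpa using hl
    simp [wickIter]
  | succ m ih =>
    have h1 : l / 2 < 2 ^ m := by rw [pow_succ] at hl; omega
    have h2 : (l + 2 ^ (m + 1)) / 2 = l / 2 + 2 ^ m := by rw [pow_succ]; omega
    have h3 : Even (l + 2 ^ (m + 1)) ↔ Even l := by
      rw [Nat.even_add]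
      simp [Nat.even_pow]
    rw [wickIter, h2, ih h1, wickIter]
    simp only [h3]

/-- One summand of a sum of nonnegative terms, with binomial coefficients at least 1. This is how
single coefficients are recovered from the seminorms. -/
theorem le_wickStep (x : MI n → MI n → ℝ≥0∞) (N R S I J : MI n) (hI : I ≤ R) (hJ : J ≤ N + S) :
    (N.fact : ℝ≥0∞)⁻¹ * x I J ^ 2 ≤ wickStep x R S := by
  refine le_trans ?_ (ENNReal.le_tsum N)
  gcongr
  unfold binomSum
  rw [← Finset.sum_product']
  refine le_trans ?_ (Finset.single_le_sum (fun _ _ => zero_le) (Finset.mem_product.2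
    ⟨Finset.mem_Icc.2 ⟨zero_le, hI⟩, Finset.mem_Icc.2 ⟨zero_le, hJ⟩⟩ : (I, J) ∈ _))
  have h1 : (1 : ℝ≥0∞) ≤ R.binom I := by
    exact_mod_cast Finset.prod_pos fun k _ => Nat.choose_pos (hI k)
  have h2 : (1 : ℝ≥0∞) ≤ (N + S).binom J := by
    exact_mod_cast Finset.prod_pos fun k _ => Nat.choose_pos (hJ k)
  calc x I J = 1 * 1 * x I J := by simp
    _ ≤ _ := by gcongr

/-! ### Geometric bounds, shifts, dominated convergence, lower semicontinuity -/

/-- A step turns the ratio D into (1 + D)², and the factor 1/N! makes the sum over N converge, so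
geometric growth survives all levels. -/
theorem wickIter_ne_top_of_le_geometric {x : MI n → MI n → ℝ≥0∞} {C D : ℝ≥0∞} (hC : C ≠ ⊤)
    (hD : D ≠ ⊤) (h : ∀ R S, x R S ≤ C * D ^ (R.deg + S.deg)) (m l : ℕ) (R S : MI n) :
    wickIter x m l R S ≠ ⊤ := by
  suffices H : ∃ C' D' : ℝ≥0∞, C' ≠ ⊤ ∧ D' ≠ ⊤ ∧
      ∀ R S, wickIter x m l R S ≤ C' * D' ^ (R.deg + S.deg) by
    obtain ⟨C', D', hC', hD', hb⟩ := H
    exact ne_top_of_le_ne_top (ENNReal.mul_ne_top hC' (ENNReal.pow_ne_top hD')) (hb R S)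
  clear R S
  induction m generalizing l with
  | zero => exact ⟨C, D, hC, hD, h⟩
  | succ m ih =>
    obtain ⟨C', D', hC', hD', hb⟩ := ih (l / 2)
    have h1 : 1 + D' ≠ ⊤ := ENNReal.add_ne_top.2 ⟨ENNReal.one_ne_top, hD'⟩
    refine ⟨C' ^ 2 * ∑' N : MI n, (N.fact : ℝ≥0∞)⁻¹ * ((1 + D') ^ 2) ^ N.deg, (1 + D') ^ 2,
      ENNReal.mul_ne_top (ENNReal.pow_ne_top hC')
        (MI.tsum_pow_mul_fact_inv_ne_top (ENNReal.pow_ne_top h1)), ENNReal.pow_ne_top h1,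
      fun R S => ?_⟩
    have hstep := wickStep_mono (x := if Even l then wickIter x m (l / 2)
      else Function.swap (wickIter x m (l / 2))) (y := fun R S => C' * D' ^ (R.deg + S.deg))
      (fun I J => by
        split_ifs
        · exact hb _ _
        · rw [add_comm]
          exact hb _ _) R S
    refine hstep.trans (le_of_eq ?_)
    have hsum : ∀ R L : MI n, binomSum (fun R S => C' * D' ^ (R.deg + S.deg)) R L =
        C' * ((1 + D') ^ R.deg * (1 + D') ^ L.deg) := by
      intro R L
      rw [binomSum, ← MI.sum_binom_mul_pow, ← MI.sum_binom_mul_pow, Finset.sum_mul_sum,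
        Finset.mul_sum]
      refine Finset.sum_congr rfl fun I _ => ?_
      rw [Finset.mul_sum]
      refine Finset.sum_congr rfl fun J _ => ?_
      rw [pow_add]
      ring
    rw [wickStep, ← ENNReal.tsum_mul_left, ← ENNReal.tsum_mul_right]
    refine tsum_congr fun N => ?_
    rw [hsum, MI.deg_add]
    generalize 1 + D' = E
    ring

/-- The shifted terms are some of the terms of the larger sum, with smaller binomial coefficients.
-/
theorem binomSum_shift_le (x : MI n → MI n → ℝ≥0∞) (K M R L : MI n) :
    binomSum (fun R S => x (R + K) (S + M)) R L ≤ binomSum x (R + K) (L + M) := by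
  simp only [binomSum, ← Finset.sum_product']
  have hinj : Function.Injective fun P : MI n × MI n => (P.1 + K, P.2 + M) := by
    rintro ⟨a, b⟩ ⟨c, d⟩ h
    simpa using h
  calc _ ≤ ∑ P ∈ Finset.Icc 0 R ×ˢ Finset.Icc 0 L, ((R + K).binom (P.1 + K) : ℝ≥0∞) *
          ((L + M).binom (P.2 + M) : ℝ≥0∞) * x (P.1 + K) (P.2 + M) := by
        gcongr
        · exact MI.binom_le_add_add _ _ _
        · exact MI.binom_le_add_add _ _ _
    _ = ∑ P ∈ (Finset.Icc 0 R ×ˢ Finset.Icc 0 L).map ⟨_, hinj⟩, ((R + K).binom P.1 : ℝ≥0∞) *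
          ((L + M).binom P.2 : ℝ≥0∞) * x P.1 P.2 := by simp
    _ ≤ _ := by
        refine Finset.sum_le_sum_of_subset fun P hP => ?_
        simp only [Finset.mem_map, Finset.mem_product, Finset.mem_Icc, zero_le, true_and,
          Function.Embedding.coeFn_mk] at hP ⊢
        obtain ⟨Q, hQ, rfl⟩ := hP
        exact ⟨add_le_add_left hQ.1 K, add_le_add_left hQ.2 M⟩

theorem wickStep_shift_le (x : MI n → MI n → ℝ≥0∞) (K M R S : MI n) :
    wickStep (fun R S => x (R + K) (S + M)) R S ≤ wickStep x (R + K) (S + M) := by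
  unfold wickStep
  gcongr with N
  rw [← add_assoc]
  exact binomSum_shift_le _ _ _ _ _

/-- The resulting shift is (K, M) with its components interchanged once for every step that swaps.
-/
theorem wickIter_shift_le (x : MI n → MI n → ℝ≥0∞) (K M : MI n) (m l : ℕ) :
    ∃ K' M' : MI n, ∀ R S, wickIter (fun R S => x (R + K) (S + M)) m l R S ≤
      wickIter x m l (R + K') (S + M') := by
  induction m generalizing l with
  | zero => exact ⟨K, M, fun R S => le_rfl⟩
  | succ m ih =>
    obtain ⟨K', M', h⟩ := ih (l / 2)
    by_cases hl : Even l
    · refine ⟨K', M', fun R S => ?_⟩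
      simp only [wickIter, if_pos hl]
      exact (wickStep_mono h R S).trans (wickStep_shift_le _ _ _ _ _)
    · refine ⟨M', K', fun R S => ?_⟩
      simp only [wickIter, if_neg hl]
      exact (wickStep_mono (fun R S => h S R) R S).trans
        (wickStep_shift_le (Function.swap (wickIter x m (l / 2))) _ _ _ _)

theorem ENNReal_tendsto_tsum_zero {ι κ : Type*} [Countable κ] {F : Filter ι}
    [F.IsCountablyGenerated] {x : ι → κ → ℝ≥0∞} {y : κ → ℝ≥0∞} (hxy : ∀ i k, x i k ≤ y k)
    (hy : ∑' k, y k ≠ ⊤) (hx : ∀ k, Tendsto (fun i => x i k) F (𝓝 0)) :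
    Tendsto (fun i => ∑' k, x i k) F (𝓝 0) := by
  let _ : MeasurableSpace κ := ⊤
  have h := tendsto_lintegral_filter_of_dominated_convergence (μ := (Measure.count : Measure κ))
    (F := x) (f := fun _ => 0) (l := F) y
    (Eventually.of_forall fun i => measurable_from_top)
    (Eventually.of_forall fun i => Eventually.of_forall fun k => hxy i k)
    (by rwa [lintegral_count]) (Eventually.of_forall hx)
  simpa [lintegral_count] using h

/-- Dominated convergence for the sum over N at every level. The dominating series is the recursion
started at `y`, hence its finiteness is required at all levels. -/
theorem wickIter_tendsto_zero {ι : Type*} {F : Filter ι} [F.IsCountablyGenerated]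
    {x : ι → MI n → MI n → ℝ≥0∞} {y : MI n → MI n → ℝ≥0∞} (hxy : ∀ i R S, x i R S ≤ y R S)
    (hy : ∀ m l, l < 2 ^ m → ∀ R S, wickIter y m l R S ≠ ⊤)
    (hx : ∀ R S, Tendsto (fun i => x i R S) F (𝓝 0)) {m l : ℕ} (hl : l < 2 ^ m) (R S : MI n) :
    Tendsto (fun i => wickIter (x i) m l R S) F (𝓝 0) := by
  induction m generalizing l R S with
  | zero => exact hx R S
  | succ m ih =>
    have h1 : l / 2 < 2 ^ m := by rw [pow_succ] at hl; omega
    have hfin := hy (m + 1) l hl R S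
    rw [wickIter, wickStep] at hfin
    simp only [wickIter, wickStep]
    refine ENNReal_tendsto_tsum_zero (y := fun N => (N.fact : ℝ≥0∞)⁻¹ * binomSum (if Even l then
      wickIter y m (l / 2) else Function.swap (wickIter y m (l / 2))) R (N + S) ^ 2) ?_ hfin ?_
    · intro i N
      gcongr
      refine binomSum_mono (fun I J => ?_) _ _
      split_ifs
      · exact wickIter_mono (hxy i) _ _ _ _
      · exact wickIter_mono (hxy i) _ _ _ _
    · intro N
      have h0 : (0 : ℝ≥0∞) = (N.fact : ℝ≥0∞)⁻¹ * 0 ^ 2 := by simp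
      rw [h0]
      refine ENNReal.Tendsto.const_mul (ENNReal.Tendsto.pow ?_)
        (Or.inr (ENNReal.inv_ne_top.2 (by exact_mod_cast N.fact_ne_zero)))
      unfold binomSum
      have h2 : (0 : ℝ≥0∞) = ∑ I ∈ Finset.Icc 0 R, ∑ J ∈ Finset.Icc 0 (N + S),
          (R.binom I : ℝ≥0∞) * ((N + S).binom J : ℝ≥0∞) * 0 := by simp
      rw [h2]
      refine tendsto_finsetSum _ fun I _ => tendsto_finsetSum _ fun J _ => ?_
      refine ENNReal.Tendsto.const_mul ?_
        (Or.inr (ENNReal.mul_ne_top (ENNReal.natCast_ne_top _) (ENNReal.natCast_ne_top _)))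
      split_ifs
      · exact ih h1 I J
      · exact ih h1 J I

/-- Fatou's lemma for the recursion: sums of nonnegative terms and increasing continuous functions
preserve lower semicontinuity. Bounds on seminorms thus survive entrywise limits, which is what
completeness needs. -/
theorem lowerSemicontinuous_wickIter_wickBase (ħ : ℝ) (m l : ℕ) (R S : MI n) :
    LowerSemicontinuous fun a : MI n → MI n → ℂ => wickIter (wickBase ħ a) m l R S := by
  have hmul : ∀ c : ℝ≥0∞, c ≠ ⊤ → Continuous fun t : ℝ≥0∞ => c * t :=
    fun c hc => ENNReal.continuous_const_mul hc
  induction m generalizing l R S with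
  | zero =>
    simp only [wickIter, wickBase]
    refine lowerSemicontinuous_tsum fun N => Continuous.lowerSemicontinuous ?_
    refine (hmul _ ?_).comp ?_
    · exact ENNReal.div_ne_top (ENNReal.pow_ne_top ENNReal.ofReal_ne_top)
        (by exact_mod_cast N.fact_ne_zero)
    · exact (ENNReal.continuous_pow 2).comp
        (continuous_enorm.comp ((continuous_apply (N + S)).comp (continuous_apply R)))
  | succ m ih =>
    simp only [wickIter, wickStep]
    refine lowerSemicontinuous_tsum fun N => ?_
    refine Continuous.comp_lowerSemicontinuous (g := fun t : ℝ≥0∞ => (N.fact : ℝ≥0∞)⁻¹ * t ^ 2)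
      ((hmul _ (ENNReal.inv_ne_top.2 (by exact_mod_cast N.fact_ne_zero))).comp
        (ENNReal.continuous_pow 2)) ?_ (fun a b hab => by dsimp only; gcongr)
    unfold binomSum
    refine lowerSemicontinuous_sum fun I _ => lowerSemicontinuous_sum fun J _ => ?_
    refine Continuous.comp_lowerSemicontinuous
      (g := fun t : ℝ≥0∞ => (R.binom I : ℝ≥0∞) * ((N + S).binom J : ℝ≥0∞) * t)
      (hmul _ (ENNReal.mul_ne_top (ENNReal.natCast_ne_top _) (ENNReal.natCast_ne_top _))) ?_
      (fun a b hab => by dsimp only; gcongr)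
    split_ifs
    · exact ih _ I J
    · exact ih _ J I

/-! ### Admissible coefficient arrays -/

/-- The arrays of Taylor coefficients for which all the seminorms are finite. -/
def WickArray (ħ : ℝ) (a : MI n → MI n → ℂ) : Prop :=
  ∀ m l, l < 2 ^ m → ∀ R S, wickIter (wickBase ħ a) m l R S ≠ ⊤

/-- The coefficients of the complex conjugate function. -/
noncomputable def arrConj (a : MI n → MI n → ℂ) (R S : MI n) : ℂ := (starRingEnd ℂ) (a S R)

/-- The coefficients of a product of functions. -/
noncomputable def arrMul (a b : MI n → MI n → ℂ) (R S : MI n) : ℂ :=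
  ∑ I ∈ Finset.Icc 0 R, ∑ J ∈ Finset.Icc 0 S,
    (R.binom I : ℂ) * (S.binom J : ℂ) * (a I J * b (R - I) (S - J))

/-- The coefficients of the Wick product. -/
noncomputable def arrStar (ħ : ℝ) (a b : MI n → MI n → ℂ) (R S : MI n) : ℂ :=
  ∑' N : MI n, (2 * (ħ : ℂ)) ^ N.deg / (N.fact : ℂ) *
    arrMul (fun I J => a (N + I) J) (fun I J => b I (N + J)) R S

theorem le_wickBase (ħ : ℝ) (a : MI n → MI n → ℂ) (R S N : MI n) :
    ENNReal.ofReal (2 * ħ) ^ (R.deg + S.deg + N.deg) / (N.fact : ℝ≥0∞) * ‖a R (N + S)‖ₑ ^ 2 ≤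
      wickBase ħ a R S :=
  ENNReal.le_tsum (f := fun N : MI n => ENNReal.ofReal (2 * ħ) ^ (R.deg + S.deg + N.deg) /
    (N.fact : ℝ≥0∞) * ‖a R (N + S)‖ₑ ^ 2) N

theorem le_wickBase_zero (ħ : ℝ) (a : MI n → MI n → ℂ) (R S : MI n) :
    ENNReal.ofReal (2 * ħ) ^ (R.deg + S.deg) * ‖a R S‖ₑ ^ 2 ≤ wickBase ħ a R S := by
  simpa [MI.deg_zero, MI.fact_zero] using le_wickBase ħ a R S 0

theorem wickBase_mono {a b : MI n → MI n → ℂ} (h : ∀ R S, ‖a R S‖ ≤ ‖b R S‖) (R S : MI n) :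
    wickBase ħ a R S ≤ wickBase ħ b R S := by
  unfold wickBase
  gcongr
  exact enorm_le_iff_norm_le.2 (h _ _)

/-- Because of this, any part of the Taylor series of an element of A_ħ again belongs to A_ħ. -/
theorem WickArray.mono {a b : MI n → MI n → ℂ} (hb : WickArray ħ b)
    (h : ∀ R S, ‖a R S‖ ≤ ‖b R S‖) : WickArray ħ a := fun m l hl R S =>
  ne_top_of_le_ne_top (hb m l hl R S) (wickIter_mono (wickBase_mono h) m l R S)

/-- The quantity |a(N+S, R)|² in the N-th term is controlled by the single summand I = R, J = N + S
of the swapped binomial sum. Cauchy–Schwarz with weights 1/N! does the rest. -/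
theorem wickBase_arrConj_sq_le (a : MI n → MI n → ℂ) (R S : MI n) :
    wickBase ħ (arrConj a) R S ^ 2 ≤
      (∑' N : MI n, (N.fact : ℝ≥0∞)⁻¹) * wickStep (Function.swap (wickBase ħ a)) R S := by
  refine ENNReal_tsum_sq_le fun N => ?_
  have h1 := binomSum_mono (x := Function.swap fun R S => ENNReal.ofReal (2 * ħ) ^ (R.deg + S.deg)
    * ‖a R S‖ₑ ^ 2) (y := Function.swap (wickBase ħ a)) (fun I J => le_wickBase_zero ħ a J I)
    R (N + S)
  have h2 : ENNReal.ofReal (2 * ħ) ^ (R.deg + S.deg + N.deg) * ‖a (N + S) R‖ₑ ^ 2 ≤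
      binomSum (Function.swap (wickBase ħ a)) R (N + S) := by
    refine le_trans ?_ h1
    unfold binomSum
    rw [← Finset.sum_product']
    refine le_trans (le_of_eq ?_) (Finset.single_le_sum (fun _ _ => zero_le)
      (Finset.mem_product.2 ⟨Finset.mem_Icc.2 ⟨zero_le, le_rfl⟩,
        Finset.mem_Icc.2 ⟨zero_le, le_rfl⟩⟩ : (R, N + S) ∈ _))
    simp only [MI.binom_self, Nat.cast_one, one_mul, Function.swap, MI.deg_add]
    congr 2
    ring
  have e : ‖arrConj a R (N + S)‖ₑ = ‖a (N + S) R‖ₑ := by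
    rw [← enorm_norm, ← enorm_norm (a (N + S) R), arrConj, RCLike.norm_conj]
  rw [e, ENNReal.div_eq_inv_mul, mul_assoc, mul_pow, sq (_⁻¹ : ℝ≥0∞), mul_assoc]
  gcongr

theorem WickArray.wickIter_conj_sq_le (a : MI n → MI n → ℂ) {m l : ℕ} (hl : l < 2 ^ m)
    (R S : MI n) : wickIter (wickBase ħ (arrConj a)) m l R S ^ 2 ≤
      wickIter (fun _ _ => ∑' N : MI n, (N.fact : ℝ≥0∞)⁻¹) m l R S *
        wickIter (wickBase ħ a) (m + 1) (l + 2 ^ m) R S := by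
  rw [wickIter_succ_add _ hl]
  exact wickIter_sq_le (wickBase_arrConj_sq_le a) m l R S

theorem wickIter_fact_inv_ne_top (m l : ℕ) (R S : MI n) :
    wickIter (fun _ _ => ∑' N : MI n, (N.fact : ℝ≥0∞)⁻¹) m l R S ≠ ⊤ := by
  refine wickIter_ne_top_of_le_geometric (C := ∑' N : MI n, (N.fact : ℝ≥0∞)⁻¹) (D := 1) ?_
    ENNReal.one_ne_top (fun _ _ => by simp) m l R S
  simpa using MI.tsum_pow_mul_fact_inv_ne_top (n := n) ENNReal.one_ne_top

theorem lt_two_pow_succ_of_lt {m l : ℕ} (hl : l < 2 ^ m) : l < 2 ^ (m + 1) := by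
  rw [pow_succ]; omega

theorem add_lt_two_pow_succ_of_lt {m l : ℕ} (hl : l < 2 ^ m) : l + 2 ^ m < 2 ^ (m + 1) := by
  rw [pow_succ]; omega

theorem ENNReal_ne_top_of_sq_le_mul {x y z : ℝ≥0∞} (h : x ^ 2 ≤ y * z) (hy : y ≠ ⊤) (hz : z ≠ ⊤) :
    x ≠ ⊤ := by
  rintro rfl
  simp only [ne_eq, OfNat.ofNat_ne_zero, not_false_eq_true, ENNReal.top_pow, top_le_iff] at h
  exact ENNReal.mul_ne_top hy hz h

theorem WickArray.conj {a : MI n → MI n → ℂ} (ha : WickArray ħ a) : WickArray ħ (arrConj a) :=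
  fun _ _ hl R S => ENNReal_ne_top_of_sq_le_mul (wickIter_conj_sq_le a hl R S)
    (wickIter_fact_inv_ne_top _ _ R S) (ha _ _ (add_lt_two_pow_succ_of_lt hl) R S)

theorem enorm_two_mul_pow_div (hħ : 0 < ħ) (N : MI n) :
    ‖(2 * (ħ : ℂ)) ^ N.deg / (N.fact : ℂ)‖ₑ = ENNReal.ofReal (2 * ħ) ^ N.deg / (N.fact : ℝ≥0∞) := by
  rw [← ofReal_norm, norm_div, norm_pow, norm_mul, Complex.norm_natCast, RCLike.norm_ofNat,
    Complex.norm_real, Real.norm_of_nonneg hħ.le, ENNReal.ofReal_div_of_pos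
    (by exact_mod_cast N.fact_pos), ENNReal.ofReal_pow (by positivity), ENNReal.ofReal_natCast]

/-- No summability is needed, since a divergent series has the value 0. Wick products of arrays can
so be estimated before their convergence is known. -/
theorem enorm_tsum_le {ι : Type*} (f : ι → ℂ) : ‖∑' i, f i‖ₑ ≤ ∑' i, ‖f i‖ₑ := by
  by_cases h : Summable f
  · exact enorm_tsum_le_tsum_enorm
  · rw [tsum_eq_zero_of_not_summable h]
    simp

/-- The Leibniz rule writes the coefficient as a sum over N, I ≤ R, J ≤ L of a(N+I, J) b(R-I,
N+L-J). Cauchy–Schwarz in N, with weights (2ħ)^{|N|}/N!, produces the quantities h_{0,0} of f̄ and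
g, and Cauchy–Schwarz in (I, J), with binomial weights, produces the two binomial sums. -/
theorem enorm_arrStar_sq_le (hħ : 0 < ħ) (a b : MI n → MI n → ℂ) (R L : MI n) :
    ENNReal.ofReal (2 * ħ) ^ (R.deg + L.deg) * ‖arrStar ħ a b R L‖ₑ ^ 2 ≤
      binomSum (Function.swap (wickBase ħ (arrConj a))) R L * binomSum (wickBase ħ b) R L := by
  set t := ENNReal.ofReal (2 * ħ) with ht
  -- Reflecting (I, J) to (R - I, L - J) leaves the binomial coefficients unchanged and matches the
  -- indices of b in the Leibniz rule.
  have hrefl : binomSum (wickBase ħ b) R L = ∑ P ∈ Finset.Icc 0 R ×ˢ Finset.Icc 0 L,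
      (R.binom P.1 : ℝ≥0∞) * (L.binom P.2 : ℝ≥0∞) * wickBase ħ b (R - P.1) (L - P.2) := by
    rw [binomSum, ← Finset.sum_product']
    refine Finset.sum_bij' (fun P _ => (R - P.1, L - P.2)) (fun P _ => (R - P.1, L - P.2)) ?_ ?_ ?_
      ?_ ?_
    all_goals
      rintro ⟨I, J⟩ hP
      simp only [Finset.mem_product, Finset.mem_Icc, zero_le, true_and] at hP ⊢
    · exact ⟨tsub_le_self, tsub_le_self⟩
    · exact ⟨tsub_le_self, tsub_le_self⟩
    · rw [tsub_tsub_cancel_of_le hP.1, tsub_tsub_cancel_of_le hP.2]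
    · rw [tsub_tsub_cancel_of_le hP.1, tsub_tsub_cancel_of_le hP.2]
    · rw [tsub_tsub_cancel_of_le hP.1, tsub_tsub_cancel_of_le hP.2, MI.binom_sub hP.1,
        MI.binom_sub hP.2]
  have h1 : ‖arrStar ħ a b R L‖ₑ ≤ ∑ P ∈ Finset.Icc 0 R ×ˢ Finset.Icc 0 L,
      (R.binom P.1 : ℝ≥0∞) * (L.binom P.2 : ℝ≥0∞) *
        ∑' N : MI n, t ^ N.deg / (N.fact : ℝ≥0∞) *
          (‖a (N + P.1) P.2‖ₑ * ‖b (R - P.1) (N + (L - P.2))‖ₑ) := by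
    refine (enorm_tsum_le _).trans ?_
    simp only [← ENNReal.tsum_mul_left]
    rw [← Summable.tsum_finsetSum fun _ _ => ENNReal.summable]
    refine ENNReal.tsum_le_tsum fun N => ?_
    rw [enorm_mul, enorm_two_mul_pow_div hħ, arrMul, ← Finset.sum_product']
    refine (mul_le_mul_right (enorm_sum_le _ _) _).trans (le_of_eq ?_)
    rw [Finset.mul_sum]
    refine Finset.sum_congr rfl fun P _ => ?_
    rw [enorm_mul, enorm_mul, enorm_mul]
    have hn : ∀ k : ℕ, ‖(k : ℂ)‖ₑ = k := fun k => by
      rw [← ofReal_norm, Complex.norm_natCast, ENNReal.ofReal_natCast]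
    rw [hn, hn, ht]
    ring
  rw [hrefl]
  have e2 : binomSum (Function.swap (wickBase ħ (arrConj a))) R L =
      ∑ P ∈ Finset.Icc 0 R ×ˢ Finset.Icc 0 L, (R.binom P.1 : ℝ≥0∞) * (L.binom P.2 : ℝ≥0∞) *
        wickBase ħ (arrConj a) P.2 P.1 := by
    rw [binomSum, ← Finset.sum_product']
  rw [e2]
  set u : ℝ≥0∞ := t ^ (R.deg + L.deg) with hu
  have h3 : u * ‖arrStar ħ a b R L‖ₑ ^ 2 ≤ u * (∑ P ∈ Finset.Icc 0 R ×ˢ Finset.Icc 0 L,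
      (R.binom P.1 : ℝ≥0∞) * (L.binom P.2 : ℝ≥0∞) *
        ∑' N : MI n, t ^ N.deg / (N.fact : ℝ≥0∞) *
          (‖a (N + P.1) P.2‖ₑ * ‖b (R - P.1) (N + (L - P.2))‖ₑ)) ^ 2 := by gcongr
  refine h3.trans ?_
  -- A square root of the power of 2ħ, in order to move that power inside the squared sum.
  obtain ⟨v, hs⟩ : ∃ v : ℝ≥0∞, v * v = u := by
    refine ⟨u ^ (1 / 2 : ℝ), ?_⟩
    rw [← ENNReal.rpow_add_of_nonneg _ _ (by norm_num) (by norm_num)]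
    norm_num
  have h4 : u * (∑ P ∈ Finset.Icc 0 R ×ˢ Finset.Icc 0 L,
      (R.binom P.1 : ℝ≥0∞) * (L.binom P.2 : ℝ≥0∞) *
        ∑' N : MI n, t ^ N.deg / (N.fact : ℝ≥0∞) *
          (‖a (N + P.1) P.2‖ₑ * ‖b (R - P.1) (N + (L - P.2))‖ₑ)) ^ 2 =
      (∑ P ∈ Finset.Icc 0 R ×ˢ Finset.Icc 0 L, (R.binom P.1 : ℝ≥0∞) * (L.binom P.2 : ℝ≥0∞) *
        (v * ∑' N : MI n, t ^ N.deg / (N.fact : ℝ≥0∞) *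
          (‖a (N + P.1) P.2‖ₑ * ‖b (R - P.1) (N + (L - P.2))‖ₑ))) ^ 2 := by
    rw [← hs, ← sq, ← mul_pow, Finset.mul_sum]
    congr 1
    exact Finset.sum_congr rfl fun P _ => by ring
  rw [h4]
  refine ENNReal_sum_sq_le _ fun P hP => ?_
  simp only [Finset.mem_product, Finset.mem_Icc, zero_le, true_and] at hP
  rw [mul_pow, sq (_ * _ : ℝ≥0∞), mul_mul_mul_comm _ (wickBase _ _ _ _), mul_pow, sq v, hs]
  refine mul_le_mul' le_rfl ?_
  -- The power of 2ħ splits exactly between the two factors.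
  have hdeg : R.deg + L.deg = (P.2.deg + P.1.deg) + ((R - P.1).deg + (L - P.2).deg) := by
    conv_lhs => rw [← tsub_add_cancel_of_le hP.1, ← tsub_add_cancel_of_le hP.2]
    rw [MI.deg_add, MI.deg_add]
    ring
  have h5 : ∀ (c : MI n → MI n → ℂ) (I J : MI n), wickBase ħ c I J = t ^ (I.deg + J.deg) *
      ∑' N : MI n, t ^ N.deg / (N.fact : ℝ≥0∞) * ‖c I (N + J)‖ₑ ^ 2 := by
    intro c I J
    rw [← ENNReal.tsum_mul_left]
    refine tsum_congr fun N => ?_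
    rw [pow_add _ (I.deg + J.deg), mul_div_assoc, mul_assoc]
  rw [h5, h5, hu, hdeg, pow_add, mul_mul_mul_comm]
  refine mul_le_mul' le_rfl ?_
  refine ENNReal_tsum_sq_le fun N => le_of_eq ?_
  have e : ‖arrConj a P.2 (N + P.1)‖ₑ = ‖a (N + P.1) P.2‖ₑ := by
    rw [← enorm_norm, ← enorm_norm (a (N + P.1) P.2), arrConj, RCLike.norm_conj]
  rw [e]
  ring

theorem wickBase_arrStar_sq_le (hħ : 0 < ħ) (a b : MI n → MI n → ℂ) (R S : MI n) :
    wickBase ħ (arrStar ħ a b) R S ^ 2 ≤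
      wickStep (Function.swap (wickBase ħ (arrConj a))) R S * wickStep (wickBase ħ b) R S := by
  refine ENNReal_tsum_sq_le fun N => ?_
  have h := enorm_arrStar_sq_le hħ a b R (N + S)
  have e : R.deg + S.deg + N.deg = R.deg + (N + S).deg := by rw [MI.deg_add]; ring
  rw [e, ENNReal.div_eq_inv_mul, mul_assoc, mul_pow, sq (_⁻¹ : ℝ≥0∞),
    mul_mul_mul_comm _ (binomSum _ _ _ ^ 2), ← mul_pow (binomSum _ _ _)]
  gcongr

/-- The swap in the factor of f̄ is the new top digit of ℓ, hence the index ℓ + 2^m; the factor of g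
keeps ℓ. -/
theorem wickIter_arrStar_sq_le (hħ : 0 < ħ) (a b : MI n → MI n → ℂ) {m l : ℕ} (hl : l < 2 ^ m)
    (R S : MI n) : wickIter (wickBase ħ (arrStar ħ a b)) m l R S ^ 2 ≤
      wickIter (wickBase ħ (arrConj a)) (m + 1) (l + 2 ^ m) R S *
        wickIter (wickBase ħ b) (m + 1) l R S := by
  rw [wickIter_succ_add _ hl, wickIter_succ_of_lt _ hl]
  exact wickIter_sq_le (wickBase_arrStar_sq_le hħ a b) m l R S

theorem WickArray.star (hħ : 0 < ħ) {a b : MI n → MI n → ℂ} (ha : WickArray ħ a)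
    (hb : WickArray ħ b) : WickArray ħ (arrStar ħ a b) :=
  fun _ _ hl R S => ENNReal_ne_top_of_sq_le_mul (wickIter_arrStar_sq_le hħ a b hl R S)
    (ha.conj _ _ (add_lt_two_pow_succ_of_lt hl) R S) (hb _ _ (lt_two_pow_succ_of_lt hl) R S)

/-- The admissible arrays are stable under taking derivatives. -/
theorem WickArray.shift (hħ : 0 < ħ) {a : MI n → MI n → ℂ} (ha : WickArray ħ a) (K M : MI n) :
    WickArray ħ fun R S => a (R + K) (S + M) := by
  intro m l hl R S
  set t := ENNReal.ofReal (2 * ħ) with ht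
  have ht0 : t ≠ 0 := by simpa [ht] using hħ
  have htt : t ≠ ⊤ := ENNReal.ofReal_ne_top
  have h1 : ∀ R S, wickBase ħ (fun R S => a (R + K) (S + M)) R S =
      (t ^ (K.deg + M.deg))⁻¹ * wickBase ħ a (R + K) (S + M) := by
    intro R S
    rw [wickBase, wickBase, ← ENNReal.tsum_mul_left]
    refine tsum_congr fun N => ?_
    have e : (R + K).deg + (S + M).deg + N.deg = (K.deg + M.deg) + (R.deg + S.deg + N.deg) := by
      rw [MI.deg_add, MI.deg_add]; ring
    rw [e, pow_add _ (K.deg + M.deg) (R.deg + S.deg + N.deg), mul_div_assoc, mul_assoc (_ ^ _),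
      ← mul_assoc _⁻¹, ENNReal.inv_mul_cancel
      (pow_ne_zero _ ht0) (ENNReal.pow_ne_top htt), one_mul, add_assoc N S M]
  obtain ⟨K', M', h2⟩ := wickIter_shift_le (wickBase ħ a) K M m l
  set c := (t ^ (K.deg + M.deg))⁻¹ with hc
  have hct : c ≠ ⊤ := ENNReal.inv_ne_top.2 (pow_ne_zero _ ht0)
  -- The equality x = c w is used in the form x² ≤ (c² w) w, so that the factors can be bounded
  -- separately.
  have h3 := wickIter_sq_le (x := wickBase ħ (fun R S => a (R + K) (S + M)))
    (y := fun R S => c ^ 2 * wickBase ħ a (R + K) (S + M))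
    (z := fun R S => wickBase ħ a (R + K) (S + M))
    (fun R S => by rw [h1]; exact le_of_eq (by ring)) m l R S
  -- The recursion is homogeneous: the scalar is squared at each step, and only its finiteness
  -- matters.
  have h4 : ∀ x : MI n → MI n → ℝ≥0∞, (∀ m l, l < 2 ^ m → ∀ R S, wickIter x m l R S ≠ ⊤) →
      ∀ d : ℝ≥0∞, d ≠ ⊤ → ∀ m l, l < 2 ^ m → ∀ R S,
        wickIter (fun R S => d * x R S) m l R S ≠ ⊤ := by
    intro x hx d hd m
    have : ∀ l, ∃ e : ℝ≥0∞, e ≠ ⊤ ∧ ∀ R S, wickIter (fun R S => d * x R S) m l R S =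
        e * wickIter x m l R S := by
      induction m with
      | zero => exact fun l => ⟨d, hd, fun R S => rfl⟩
      | succ m ih =>
        intro l
        obtain ⟨e, he, h⟩ := ih (l / 2)
        refine ⟨e ^ 2, ENNReal.pow_ne_top he, fun R S => ?_⟩
        simp only [wickIter, wickStep, ← ENNReal.tsum_mul_left]
        refine tsum_congr fun N => ?_
        have hb : binomSum (if Even l then wickIter (fun R S => d * x R S) m (l / 2) else
            Function.swap (wickIter (fun R S => d * x R S) m (l / 2))) R (N + S) =
            e * binomSum (if Even l then wickIter x m (l / 2) else
            Function.swap (wickIter x m (l / 2))) R (N + S) := by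
          unfold binomSum
          simp only [Finset.mul_sum]
          refine Finset.sum_congr rfl fun I _ => Finset.sum_congr rfl fun J _ => ?_
          split_ifs
          · rw [h]; ring
          · rw [Function.swap, Function.swap, h]; ring
        rw [hb]; ring
    intro l hl R S
    obtain ⟨e, he, h⟩ := this l
    rw [h]
    exact ENNReal.mul_ne_top he (hx m l hl R S)
  have h6 : ∀ m l, l < 2 ^ m → ∀ R S,
      wickIter (fun R S => wickBase ħ a (R + K) (S + M)) m l R S ≠ ⊤ := fun m l hl R S => by
    obtain ⟨K', M', h2⟩ := wickIter_shift_le (wickBase ħ a) K M m l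
    exact ne_top_of_le_ne_top (ha m l hl _ _) (h2 R S)
  exact ENNReal_ne_top_of_sq_le_mul h3
    (h4 _ h6 _ (ENNReal.pow_ne_top hct) m l hl R S) (h6 m l hl R S)

/-- Taylor coefficients of the admissible functions grow slowly. -/
theorem WickArray.exists_bound (hħ : 0 < ħ) {a : MI n → MI n → ℂ} (ha : WickArray ħ a) :
    ∃ C D : ℝ, 0 < C ∧ 0 < D ∧
      ∀ R S, ‖a R S‖ ^ 4 ≤ C * D ^ (R.deg + S.deg) * (R.fact * S.fact) := by
  set t := ENNReal.ofReal (2 * ħ) with ht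
  -- For m = 2, ℓ = 1 the outer step swaps and the inner one does not. Keeping N = R outside and N =
  -- S inside, one number B controls all coefficients in both indices at once.
  set B := wickIter (wickBase ħ a) 2 1 0 0 with hB
  have hBt : B ≠ ⊤ := ha 2 1 (by norm_num) 0 0
  have key : ∀ R S, (t ^ (R.deg + S.deg) * ‖a R S‖ₑ ^ 2) ^ 4 ≤
      B * (R.fact : ℝ≥0∞) * (S.fact : ℝ≥0∞) ^ 2 := by
    intro R S
    have e1 : wickIter (wickBase ħ a) 1 0 = wickStep (wickBase ħ a) := by simp [wickIter]
    have e2 : B = wickStep (Function.swap (wickStep (wickBase ħ a))) 0 0 := by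
      rw [hB, wickIter]
      simp only [Nat.not_even_one, if_false]
      rw [← e1]
    have h1 := le_wickStep (Function.swap (wickStep (wickBase ħ a))) R 0 0 0 R le_rfl (by simp)
    have h2 := le_wickStep (wickBase ħ a) S R 0 R S le_rfl (by simp)
    have h3 := le_wickBase_zero ħ a R S
    rw [← e2] at h1
    simp only [Function.swap] at h1
    have hf : ∀ N : MI n, ∀ x y : ℝ≥0∞, (N.fact : ℝ≥0∞)⁻¹ * x ≤ y → x ≤ y * N.fact := by
      intro N x y h
      rw [mul_comm]
      exact (ENNReal.inv_mul_le_iff (by exact_mod_cast N.fact_ne_zero)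
        (ENNReal.natCast_ne_top _)).1 h
    have h1' := hf _ _ _ h1
    have h2' := hf _ _ _ h2
    calc (t ^ (R.deg + S.deg) * ‖a R S‖ₑ ^ 2) ^ 4 ≤ (wickBase ħ a R S) ^ 4 := by gcongr
      _ = (wickBase ħ a R S ^ 2) ^ 2 := by ring
      _ ≤ (wickStep (wickBase ħ a) R 0 * S.fact) ^ 2 := by gcongr
      _ = wickStep (wickBase ħ a) R 0 ^ 2 * (S.fact : ℝ≥0∞) ^ 2 := by ring
      _ ≤ _ := by gcongr
  -- R! is enlarged to (R!)² so that both sides have a clean square root.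
  have key2 : ∀ R S, ((2 * ħ) ^ (R.deg + S.deg) * ‖a R S‖ ^ 2) ^ 4 ≤
      (B.toReal + 1) * ((R.fact : ℝ) * S.fact) ^ 2 := by
    intro R S
    have h := ENNReal.toReal_mono (ENNReal.mul_ne_top (ENNReal.mul_ne_top hBt
      (ENNReal.natCast_ne_top _)) (ENNReal.pow_ne_top (ENNReal.natCast_ne_top _))) (key R S)
    simp only [ENNReal.toReal_mul, ENNReal.toReal_pow, ENNReal.toReal_natCast, toReal_enorm, ht,
      ENNReal.toReal_ofReal (show (0 : ℝ) ≤ 2 * ħ by positivity)] at h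
    refine h.trans ?_
    have h1 : (1 : ℝ) ≤ R.fact := by exact_mod_cast R.fact_pos
    have h0 : 0 ≤ B.toReal := ENNReal.toReal_nonneg
    calc B.toReal * (R.fact : ℝ) * (S.fact : ℝ) ^ 2 ≤
        (B.toReal + 1) * (R.fact : ℝ) ^ 2 * (S.fact : ℝ) ^ 2 := by
          gcongr
          · linarith
          · nlinarith
      _ = _ := by ring
  refine ⟨√(B.toReal + 1), ((2 * ħ) ^ 2)⁻¹, Real.sqrt_pos.2 (by positivity), by positivity,
    fun R S => ?_⟩
  have h := Real.sqrt_le_sqrt (key2 R S)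
  rw [Real.sqrt_mul (by positivity), Real.sqrt_sq (by positivity)] at h
  have e : ((2 * ħ) ^ (R.deg + S.deg) * ‖a R S‖ ^ 2) ^ 4 =
      (((2 * ħ) ^ 2) ^ (R.deg + S.deg) * ‖a R S‖ ^ 4) ^ 2 := by
    generalize 2 * ħ = s
    ring
  rw [e, Real.sqrt_sq (by positivity)] at h
  rw [inv_pow, mul_assoc, mul_left_comm, ← div_eq_inv_mul, le_div_iff₀ (by positivity), mul_comm]
  exact h

/-! ### Everywhere convergent power series in `z` and `z̄` -/

/-- The holomorphic monomial `z^R`. -/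
noncomputable def zPow (R : MI n) (z : Fin n → ℂ) : ℂ := ∏ k, z k ^ R k

/-- The monomial `z^R z̄^S`. -/
noncomputable def monom (p : MI n × MI n) (z : Fin n → ℂ) : ℂ := zPow p.1 z * zbarPow p.2 z

/-- The coefficient of `z^R z̄^S` in the Taylor series with derivatives `a R S`. -/
noncomputable def serCoef (a : MI n → MI n → ℂ) (p : MI n × MI n) : ℂ :=
  a p.1 p.2 / ((p.1.fact : ℂ) * (p.2.fact : ℂ))

/-- The Taylor series `∑ a(R, S) z^R z̄^S / (R! S!)`. -/
noncomputable def taylorSum (a : MI n → MI n → ℂ) (z : Fin n → ℂ) : ℂ :=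
  ∑' p : MI n × MI n, serCoef a p * monom p z

/-- The sum of the absolute values of the Taylor series on the polydisc of radius `ρ`. -/
noncomputable def arrNorm (ρ : NNReal) (a : MI n → MI n → ℂ) : ℝ≥0∞ :=
  ∑' p : MI n × MI n, ‖serCoef a p‖ₑ * (ρ : ℝ≥0∞) ^ (p.1.deg + p.2.deg)

/-- The arrays whose Taylor series converges absolutely everywhere. -/
def EntireArray (a : MI n → MI n → ℂ) : Prop := ∀ ρ : NNReal, arrNorm ρ a ≠ ⊤

theorem EntireArray.summable {a : MI n → MI n → ℂ} (ha : EntireArray a) (ρ : NNReal) :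
    Summable fun p : MI n × MI n => ‖serCoef a p‖ * (ρ : ℝ) ^ (p.1.deg + p.2.deg) := by
  have h := ENNReal.summable_toReal (ha ρ)
  refine h.congr fun p => ?_
  rw [ENNReal.toReal_mul, ENNReal.toReal_pow, toReal_enorm, ENNReal.coe_toReal]

theorem EntireArray.of_summable {a : MI n → MI n → ℂ}
    (h : ∀ ρ : NNReal, Summable fun p : MI n × MI n =>
      ‖serCoef a p‖ * (ρ : ℝ) ^ (p.1.deg + p.2.deg)) : EntireArray a := by
  intro ρ
  have h1 : Summable fun p : MI n × MI n => ‖serCoef a p‖₊ * ρ ^ (p.1.deg + p.2.deg) := by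
    rw [← NNReal.summable_coe]
    refine (h ρ).congr fun p => ?_
    push_cast
    rfl
  have h2 := ENNReal.tsum_coe_ne_top_iff_summable.2 h1
  simpa [arrNorm, enorm_eq_nnnorm] using h2

theorem zbarPow_eq_conj (S : MI n) (z : Fin n → ℂ) :
    zbarPow S z = (starRingEnd ℂ) (zPow S z) := by
  simp [zbarPow, zPow, map_prod]

theorem norm_zPow_le (R : MI n) (z : Fin n → ℂ) : ‖zPow R z‖ ≤ ‖z‖ ^ R.deg := by
  rw [zPow, norm_prod, ← MI.prod_pow]
  refine Finset.prod_le_prod (fun _ _ => norm_nonneg _) fun k _ => ?_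
  rw [norm_pow]
  gcongr
  exact norm_le_pi_norm z k

theorem norm_zbarPow_le (R : MI n) (z : Fin n → ℂ) : ‖zbarPow R z‖ ≤ ‖z‖ ^ R.deg := by
  rw [zbarPow_eq_conj, RCLike.norm_conj]
  exact norm_zPow_le R z

theorem norm_monom_le (p : MI n × MI n) (z : Fin n → ℂ) :
    ‖monom p z‖ ≤ ‖z‖ ^ (p.1.deg + p.2.deg) := by
  rw [monom, norm_mul, pow_add]
  exact mul_le_mul (norm_zPow_le _ _) (norm_zbarPow_le _ _) (norm_nonneg _) (by positivity)

theorem EntireArray.summable_norm {a : MI n → MI n → ℂ} (ha : EntireArray a) (z : Fin n → ℂ) :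
    Summable fun p : MI n × MI n => ‖serCoef a p * monom p z‖ := by
  refine (ha.summable ‖z‖₊).of_nonneg_of_le (fun _ => norm_nonneg _) fun p => ?_
  rw [norm_mul]
  gcongr
  exact norm_monom_le p z

theorem EntireArray.hasSum {a : MI n → MI n → ℂ} (ha : EntireArray a) (z : Fin n → ℂ) :
    HasSum (fun p => serCoef a p * monom p z) (taylorSum a z) :=
  (ha.summable_norm z).of_norm.hasSum

theorem EntireArray.conj {a : MI n → MI n → ℂ} (ha : EntireArray a) :
    EntireArray (arrConj a) := by
  refine .of_summable fun ρ => ?_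
  refine ((Equiv.prodComm (MI n) (MI n)).summable_iff.2 (ha.summable ρ)).congr fun p => ?_
  simp only [Function.comp_apply, Equiv.prodComm_apply, serCoef, arrConj, norm_div, norm_mul,
    RCLike.norm_conj, Prod.fst_swap, Prod.snd_swap]
  rw [mul_comm ‖(p.2.fact : ℂ)‖, add_comm p.2.deg]

theorem conjFun_taylorSum (a : MI n → MI n → ℂ) :
    conjFun (taylorSum a) = taylorSum (arrConj a) := by
  funext z
  rw [conjFun, taylorSum, taylorSum, Complex.conj_tsum,
    ← (Equiv.prodComm (MI n) (MI n)).tsum_eq]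
  refine tsum_congr fun p => ?_
  simp only [Equiv.prodComm_apply, serCoef, arrConj, monom, Prod.fst_swap, Prod.snd_swap, map_mul,
    map_div₀, zbarPow_eq_conj, map_natCast, Complex.conj_conj]
  ring

/-! ### Real analyticity -/

/-- The coordinates `z^k` and `z̄^k`. -/
noncomputable def coordCLM : Fin n ⊕ Fin n → ((Fin n → ℂ) →L[ℝ] ℂ) :=
  Sum.elim (fun k => ContinuousLinearMap.proj k)
    (fun k => (conjCLE : ℂ →L[ℝ] ℂ).comp (ContinuousLinearMap.proj k))

theorem norm_coordCLM_apply_le (s : Fin n ⊕ Fin n) (z : Fin n → ℂ) : ‖coordCLM s z‖ ≤ ‖z‖ := by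
  rcases s with k | k
  · exact norm_le_pi_norm z k
  · simp only [coordCLM, Sum.elim_inr, ContinuousLinearMap.comp_apply]
    change ‖(starRingEnd ℂ) (z k)‖ ≤ _
    rw [RCLike.norm_conj]
    exact norm_le_pi_norm z k

/-- A monomial of degree k is the diagonal of a product of k coordinate functionals z_j or z̄_j,
each of norm at most 1. In all other degrees the zero form is chosen, so that for fixed k one may
sum over all exponents. -/
theorem exists_monom_multilinear (p : MI n × MI n) (k : ℕ) :
    ∃ M : ContinuousMultilinearMap ℝ (fun _ : Fin k => Fin n → ℂ) ℂ,
      ‖M‖ ≤ (if p.1.deg + p.2.deg = k then 1 else 0) ∧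
      ∀ z, M (fun _ => z) = if p.1.deg + p.2.deg = k then monom p z else 0 := by
  by_cases h : p.1.deg + p.2.deg = k
  swap
  · exact ⟨0, by simp [h], by simp [h]⟩
  simp only [h, if_true]
  set ex : Fin n ⊕ Fin n → ℕ := Sum.elim p.1 p.2 with hex
  have hcard : Fintype.card (Σ s : Fin n ⊕ Fin n, Fin (ex s)) = k := by
    simp [hex, ← h, MI.deg]
  let e : Fin k ≃ (Σ s : Fin n ⊕ Fin n, Fin (ex s)) := (Fintype.equivFinOfCardEq hcard).symm
  refine ⟨(ContinuousMultilinearMap.mkPiAlgebra ℝ (Fin k) ℂ).compContinuousLinearMap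
    fun i => coordCLM (e i).1, ?_, fun z => ?_⟩
  · refine ContinuousMultilinearMap.opNorm_le_bound zero_le_one fun m => ?_
    rw [ContinuousMultilinearMap.compContinuousLinearMap_apply,
      ContinuousMultilinearMap.mkPiAlgebra_apply, norm_prod, one_mul]
    exact Finset.prod_le_prod (fun _ _ => norm_nonneg _) fun i _ => norm_coordCLM_apply_le _ _
  · rw [ContinuousMultilinearMap.compContinuousLinearMap_apply,
      ContinuousMultilinearMap.mkPiAlgebra_apply,
      e.prod_comp (fun x : (Σ s : Fin n ⊕ Fin n, Fin (ex s)) => coordCLM x.1 z),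
      Fintype.prod_sigma]
    simp only [Finset.prod_const, Finset.card_univ, Fintype.card_fin, Fintype.prod_sum_type, hex,
      Sum.elim_inl, Sum.elim_inr]
    rfl

/-- Collecting the absolutely convergent series by total degree gives a power series in real
multilinear forms with infinite radius of convergence. -/
theorem EntireArray.analyticOnNhd {a : MI n → MI n → ℂ} (ha : EntireArray a) :
    AnalyticOnNhd ℝ (taylorSum a) Set.univ := by
  choose M hM1 hM2 using exists_monom_multilinear (n := n)
  set d : MI n × MI n → ℕ := fun p => p.1.deg + p.2.deg with hd
  have hfib : ∀ {E : Type} [NormedAddCommGroup E] (f : MI n × MI n → E) (k : ℕ),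
      ∑' p : d ⁻¹' {k}, f p = ∑' p, if d p = k then f p else 0 := by
    intro E _ f k
    rw [tsum_subtype]
    refine tsum_congr fun p => ?_
    by_cases h : d p = k
    · rw [if_pos h, Set.indicator_of_mem (show p ∈ d ⁻¹' {k} from h)]
    · rw [if_neg h, Set.indicator_of_notMem (show p ∉ d ⁻¹' {k} from h)]
  have hbd : ∀ k p, ‖serCoef a p • M p k‖ ≤ if d p = k then ‖serCoef a p‖ else 0 := by
    intro k p
    rw [norm_smul]
    refine (mul_le_mul_of_nonneg_left (hM1 p k) (norm_nonneg _)).trans (le_of_eq ?_)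
    simp only [hd]
    split_ifs <;> simp
  have hs1 : Summable fun p => ‖serCoef a p‖ := by simpa using ha.summable 1
  have hs2 : ∀ k, Summable fun p => if d p = k then ‖serCoef a p‖ else 0 := fun k =>
    hs1.of_nonneg_of_le (fun p => by split_ifs <;> positivity)
      (fun p => by split_ifs <;> simp)
  have hs3 : ∀ k, Summable fun p => serCoef a p • M p k := fun k =>
    Summable.of_norm_bounded (hs2 k) (hbd k)
  let P : FormalMultilinearSeries ℝ (Fin n → ℂ) ℂ := fun k => ∑' p, serCoef a p • M p k
  have hrad : ∀ r : NNReal, (r : ℝ≥0∞) ≤ P.radius := by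
    intro r
    refine FormalMultilinearSeries.le_radius_of_summable _ ?_
    have h1 := ((ha.summable r).hasSum.tsum_fiberwise d).summable
    refine h1.of_nonneg_of_le (fun k => by positivity) fun k => ?_
    have h2 : ‖P k‖ ≤ ∑' p, if d p = k then ‖serCoef a p‖ else 0 :=
      tsum_of_norm_bounded (hs2 k).hasSum (hbd k)
    rw [hfib (fun p => ‖serCoef a p‖ * (r : ℝ) ^ (p.1.deg + p.2.deg)) k]
    refine (mul_le_mul_of_nonneg_right h2 (by positivity)).trans (le_of_eq ?_)
    rw [← tsum_mul_right]
    refine tsum_congr fun p => ?_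
    split_ifs with h
    · rw [← h]
    · simp
  have hP : HasFPowerSeriesOnBall (taylorSum a) P 0 ⊤ := by
    refine ⟨ENNReal.le_of_forall_nnreal_lt fun r _ => hrad r, by simp, fun {y} _ => ?_⟩
    rw [zero_add]
    refine ((ha.hasSum y).tsum_fiberwise d).congr_fun fun k => ?_
    rw [hfib (fun p => serCoef a p * monom p y) k]
    have h3 := (ContinuousMultilinearMap.apply ℝ (fun _ : Fin k => Fin n → ℂ) ℂ
      (fun _ => y)).map_tsum (hs3 k)
    simp only [ContinuousMultilinearMap.apply_apply] at h3
    rw [h3]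
    refine tsum_congr fun p => ?_
    rw [smul_apply, hM2]
    simp only [hd]
    split_ifs <;> simp
  have h4 := hP.analyticOnNhd
  simpa using h4

/-! ### Termwise differentiation -/

theorem MI.deg_single (k : Fin n) : MI.deg (Pi.single k 1 : MI n) = 1 := by
  simp [MI.deg]

theorem MI.fact_add_single (R : MI n) (k : Fin n) :
    MI.fact (R + Pi.single k 1) = (R k + 1) * R.fact := by
  rw [MI.fact, MI.fact, ← Finset.mul_prod_erase _ _ (Finset.mem_univ k),
    ← Finset.mul_prod_erase _ (fun j => (R j).factorial) (Finset.mem_univ k), ← mul_assoc]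
  congr 1
  · simp [Nat.factorial_succ]
  · refine Finset.prod_congr rfl fun j hj => ?_
    simp [Pi.single_eq_of_ne (Finset.ne_of_mem_erase hj)]

theorem hasFDerivAt_zPow (R : MI n) (z : Fin n → ℂ) :
    HasFDerivAt (𝕜 := ℝ) (zPow R) (∑ k, ((R k : ℂ) * zPow (R - Pi.single k 1) z) •
      (ContinuousLinearMap.proj k : (Fin n → ℂ) →L[ℝ] ℂ)) z := by
  have h := HasFDerivAt.finsetProd (𝕜 := ℝ) (u := Finset.univ) (x := z)
    (g := fun (k : Fin n) (z : Fin n → ℂ) => z k ^ R k)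
    (g' := fun k => ((R k : ℂ) * z k ^ (R k - 1)) •
      (ContinuousLinearMap.proj k : (Fin n → ℂ) →L[ℝ] ℂ)) (fun k _ => by
        have h1 : HasFDerivAt (𝕜 := ℝ) (fun z : Fin n → ℂ => z k)
          (ContinuousLinearMap.proj k : (Fin n → ℂ) →L[ℝ] ℂ) z :=
          (ContinuousLinearMap.proj k : (Fin n → ℂ) →L[ℝ] ℂ).hasFDerivAt
        have h2 := h1.pow (R k)
        refine h2.congr_fderiv ?_
        ext v
        simp)
  refine h.congr_fderiv ?_
  refine Finset.sum_congr rfl fun k _ => ?_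
  rw [smul_smul]
  congr 1
  rw [zPow, ← Finset.mul_prod_erase _ _ (Finset.mem_univ k)]
  have h3 : ∏ j ∈ Finset.univ.erase k, z j ^ (R - Pi.single k 1 : MI n) j =
      ∏ j ∈ Finset.univ.erase k, z j ^ R j := by
    refine Finset.prod_congr rfl fun j hj => ?_
    simp [Pi.single_eq_of_ne (Finset.ne_of_mem_erase hj)]
  rw [h3]
  simp only [Pi.sub_apply, Pi.single_eq_same]
  ring

/-- The differential of a monomial. -/
noncomputable def monomDeriv (p : MI n × MI n) (z : Fin n → ℂ) : (Fin n → ℂ) →L[ℝ] ℂ :=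
  (∑ k, ((p.1 k : ℂ) * monom (p.1 - Pi.single k 1, p.2) z) • coordCLM (Sum.inl k)) +
    ∑ k, ((p.2 k : ℂ) * monom (p.1, p.2 - Pi.single k 1) z) • coordCLM (Sum.inr k)

theorem hasFDerivAt_monom (p : MI n × MI n) (z : Fin n → ℂ) :
    HasFDerivAt (𝕜 := ℝ) (monom p) (monomDeriv p z) z := by
  have h1 := hasFDerivAt_zPow p.1 z
  have h2 : HasFDerivAt (𝕜 := ℝ) (zbarPow p.2) _ z :=
    ((conjCLE : ℂ →L[ℝ] ℂ).hasFDerivAt.comp z (hasFDerivAt_zPow p.2 z)).congr_of_eventuallyEq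
      (Eventually.of_forall fun w => zbarPow_eq_conj p.2 w)
  refine (h1.mul h2).congr_fderiv ?_
  ext v
  simp only [monomDeriv, coordCLM, monom, add_apply, smul_apply, ContinuousLinearMap.comp_apply,
    sum_apply, Sum.elim_inl, Sum.elim_inr, smul_eq_mul, Finset.mul_sum,
    map_sum, ContinuousLinearMap.proj_apply]
  rw [add_comm]
  congr 1
  · refine Finset.sum_congr rfl fun k _ => ?_
    ring
  · refine Finset.sum_congr rfl fun k _ => ?_
    simp only [zbarPow_eq_conj, ContinuousLinearEquiv.coe_coe, conjCLE_apply, map_mul, map_natCast]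
    ring

/-- Differentiation produces the sum of the exponents as a factor, which is at most 2 to the degree;
a larger radius absorbs it. Since ρ ≥ 1, the loss of one degree does no harm. -/
theorem norm_monomDeriv_le (p : MI n × MI n) {z : Fin n → ℂ} {ρ : ℝ} (hρ : 1 ≤ ρ) (hz : ‖z‖ ≤ ρ) :
    ‖monomDeriv p z‖ ≤ (2 * ρ) ^ (p.1.deg + p.2.deg) := by
  have hm : ∀ q : MI n × MI n, q.1.deg + q.2.deg ≤ p.1.deg + p.2.deg →
      ‖monom q z‖ ≤ ρ ^ (p.1.deg + p.2.deg) := fun q hq =>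
    (norm_monom_le q z).trans ((pow_le_pow_left₀ (norm_nonneg _) hz _).trans
      (pow_le_pow_right₀ hρ hq))
  have hc : ∀ s : Fin n ⊕ Fin n, ‖coordCLM s‖ ≤ 1 := fun s =>
    ContinuousLinearMap.opNorm_le_bound _ zero_le_one fun v => by
      rw [one_mul]; exact norm_coordCLM_apply_le s v
  have hle : ∀ (R : MI n) (k : Fin n), (R - Pi.single k 1).deg ≤ R.deg := fun R k =>
    Finset.sum_le_sum fun j _ => Nat.sub_le _ _
  have hterm : ∀ (r : ℕ) (q : MI n × MI n) (s : Fin n ⊕ Fin n),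
      q.1.deg + q.2.deg ≤ p.1.deg + p.2.deg →
      ‖((r : ℂ) * monom q z) • coordCLM s‖ ≤ r * ρ ^ (p.1.deg + p.2.deg) := by
    intro r q s hq
    rw [norm_smul, norm_mul, Complex.norm_natCast]
    calc (r : ℝ) * ‖monom q z‖ * ‖coordCLM s‖ ≤ r * ρ ^ (p.1.deg + p.2.deg) * 1 := by
          gcongr
          · exact hm q hq
          · exact hc s
      _ = _ := mul_one _
  have h2 : ‖monomDeriv p z‖ ≤ (∑ k, (p.1 k : ℝ) * ρ ^ (p.1.deg + p.2.deg)) +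
      ∑ k, (p.2 k : ℝ) * ρ ^ (p.1.deg + p.2.deg) := by
    refine (norm_add_le _ _).trans (add_le_add ?_ ?_)
    · exact norm_sum_le_of_le _ fun k _ => hterm _ _ _ (Nat.add_le_add_right (hle _ _) _)
    · exact norm_sum_le_of_le _ fun k _ => hterm _ _ _ (Nat.add_le_add_left (hle _ _) _)
  refine h2.trans ?_
  rw [← Finset.sum_mul, ← Finset.sum_mul, ← add_mul, mul_pow]
  gcongr
  have h3 : ((p.1.deg + p.2.deg : ℕ) : ℝ) ≤ 2 ^ (p.1.deg + p.2.deg) := by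
    exact_mod_cast Nat.lt_two_pow_self.le
  simpa [MI.deg] using h3

theorem EntireArray.hasFDerivAt {a : MI n → MI n → ℂ} (ha : EntireArray a) (z : Fin n → ℂ) :
    HasFDerivAt (𝕜 := ℝ) (taylorSum a) (∑' p, serCoef a p • monomDeriv p z) z ∧
      Summable fun p => serCoef a p • monomDeriv p z := by
  set ρ : NNReal := 2 * (‖z‖₊ + 1) with hρ
  have hb : ∀ p, ∀ w ∈ Metric.ball (0 : Fin n → ℂ) (‖z‖ + 1), ‖serCoef a p • monomDeriv p w‖ ≤
      ‖serCoef a p‖ * (ρ : ℝ) ^ (p.1.deg + p.2.deg) := by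
    intro p w hw
    rw [norm_smul]
    gcongr
    have h1 : ‖w‖ ≤ ‖z‖ + 1 := by simpa using (mem_ball_zero_iff.1 hw).le
    have h2 := norm_monomDeriv_le p (ρ := ‖z‖ + 1) (by simp) h1
    simpa [hρ] using h2
  have hz : z ∈ Metric.ball (0 : Fin n → ℂ) (‖z‖ + 1) := by simp
  constructor
  · exact hasFDerivAt_tsum_of_isPreconnected (ha.summable ρ) Metric.isOpen_ball
      (convex_ball _ _).isPreconnected (fun p w _ => (hasFDerivAt_monom p w).const_mul _) hb hz
      (ha.hasSum z).summable hz
  · exact Summable.of_norm_bounded (ha.summable ρ) fun p => hb p z hz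

theorem EntireArray.dz_taylorSum {a : MI n → MI n → ℂ} (ha : EntireArray a) (k : Fin n) :
    dz k (taylorSum a) = taylorSum fun R S => a (R + Pi.single k 1) S := by
  funext z
  obtain ⟨h1, h2⟩ := ha.hasFDerivAt z
  -- The continuous functional of the differential that gives 2 ∂/∂z_k; it may be applied to the
  -- series of differentials term by term.
  let Λ : ((Fin n → ℂ) →L[ℝ] ℂ) →L[ℝ] ℂ :=
    ContinuousLinearMap.apply ℝ ℂ (Pi.single k 1) -
      ((I : ℂ) • ContinuousLinearMap.apply ℝ ℂ (Pi.single k I) :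
        ((Fin n → ℂ) →L[ℝ] ℂ) →L[ℝ] ℂ)
  have hΛ : ∀ L, Λ L = L (Pi.single k 1) - I * L (Pi.single k I) := fun L => rfl
  have h3 : dz k (taylorSum a) z = (1 / 2 : ℂ) * Λ (∑' p, serCoef a p • monomDeriv p z) := by
    rw [dz, h1.fderiv, hΛ]
  have h4 : ∀ p, Λ (serCoef a p • monomDeriv p z) =
      2 * (serCoef a p * ((p.1 k : ℂ) * monom (p.1 - Pi.single k 1, p.2) z)) := by
    intro p
    have e1 : ∀ c : ℂ, monomDeriv p z (Pi.single k c) =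
        (p.1 k : ℂ) * monom (p.1 - Pi.single k 1, p.2) z * c +
          (p.2 k : ℂ) * monom (p.1, p.2 - Pi.single k 1) z * (starRingEnd ℂ) c := by
      intro c
      simp only [monomDeriv, coordCLM, add_apply, sum_apply, smul_apply,
        Sum.elim_inl, Sum.elim_inr, ContinuousLinearMap.comp_apply,
        ContinuousLinearMap.proj_apply, smul_eq_mul, ContinuousLinearEquiv.coe_coe, conjCLE_apply]
      congr 1
      · rw [Finset.sum_eq_single k (fun j _ hj => by simp [Pi.single_eq_of_ne hj]) (by simp)]
        simp
      · rw [Finset.sum_eq_single k (fun j _ hj => by simp [Pi.single_eq_of_ne hj]) (by simp)]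
        simp
    rw [hΛ, smul_apply, smul_apply, e1, e1, map_one, conj_I, smul_eq_mul, smul_eq_mul]
    linear_combination (-serCoef a p * (p.1 k : ℂ) * monom (p.1 - Pi.single k 1, p.2) z +
      serCoef a p * (p.2 k : ℂ) * monom (p.1, p.2 - Pi.single k 1) z) * I_mul_I
  rw [h3, Λ.map_tsum h2]
  simp only [h4]
  rw [tsum_mul_left, ← mul_assoc]
  norm_num
  -- The sum is reindexed by raising the exponent of z_k. The exponents that are missed have k-th
  -- entry 0, and their terms vanish.
  have hinj : Function.Injective fun p : MI n × MI n => (p.1 + Pi.single k 1, p.2) := by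
    rintro ⟨p, q⟩ ⟨p', q'⟩ h
    simpa using h
  rw [taylorSum, ← hinj.tsum_eq]
  · refine tsum_congr fun p => ?_
    have e : p.1 + Pi.single k 1 - Pi.single k 1 = p.1 := add_tsub_cancel_right _ _
    simp only [serCoef, e]
    have hf := MI.fact_add_single p.1 k
    have h5 : (p.1.fact : ℂ) ≠ 0 := by exact_mod_cast p.1.fact_ne_zero
    have h6 : (p.2.fact : ℂ) ≠ 0 := by exact_mod_cast p.2.fact_ne_zero
    have h7 : ((p.1 k : ℂ) + 1) ≠ 0 := Nat.cast_add_one_ne_zero _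
    rw [hf]
    simp only [Pi.add_apply, Pi.single_eq_same]
    push_cast
    field_simp
  · rintro ⟨R, S⟩ hp
    have hk : R k ≠ 0 := by
      intro h
      simp [h] at hp
    refine ⟨(R - Pi.single k 1, S), ?_⟩
    ext j
    · by_cases hj : j = k
      · subst hj
        simp only [Pi.add_apply, Pi.sub_apply, Pi.single_eq_same]
        omega
      · simp [Pi.single_eq_of_ne hj]
    · rfl

/-- The factor R_k + 1 gained from the factorial is at most 2^{|R|+1}, so convergence on the radius
2(ρ + 1) suffices for the radius ρ. -/
theorem EntireArray.shift_single {a : MI n → MI n → ℂ} (ha : EntireArray a) (k : Fin n) :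
    EntireArray fun R S => a (R + Pi.single k 1) S := by
  refine .of_summable fun ρ => ?_
  have hinj : Function.Injective fun p : MI n × MI n => (p.1 + Pi.single k 1, p.2) := by
    rintro ⟨p, q⟩ ⟨p', q'⟩ h
    simpa using h
  have h := (ha.summable (2 * (ρ + 1))).comp_injective hinj
  refine h.of_nonneg_of_le (fun _ => by positivity) fun p => ?_
  simp only [Function.comp_apply, serCoef, norm_div, norm_mul, Complex.norm_natCast]
  have hf := MI.fact_add_single p.1 k
  have h1 : (p.1 k + 1 : ℝ) ≤ 2 ^ (p.1.deg + 1) := by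
    have h2 : p.1 k ≤ p.1.deg := Finset.single_le_sum (f := p.1) (fun _ _ => Nat.zero_le _)
      (Finset.mem_univ k)
    have h3 : p.1.deg + 1 < 2 ^ (p.1.deg + 1) := Nat.lt_two_pow_self
    exact_mod_cast (by omega : p.1 k + 1 ≤ 2 ^ (p.1.deg + 1))
  have h5 : (0 : ℝ) < p.1.fact := by exact_mod_cast p.1.fact_pos
  have h6 : (0 : ℝ) < p.2.fact := by exact_mod_cast p.2.fact_pos
  rw [hf, MI.deg_add, MI.deg_single]
  push_cast
  have e : ‖a (p.1 + Pi.single k 1) p.2‖ / (p.1.fact * p.2.fact) * (ρ : ℝ) ^ (p.1.deg + p.2.deg) =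
      ‖a (p.1 + Pi.single k 1) p.2‖ / ((p.1 k + 1) * p.1.fact * p.2.fact) *
        ((p.1 k + 1) * (ρ : ℝ) ^ (p.1.deg + p.2.deg)) := by
    field_simp
  rw [e]
  gcongr
  calc (p.1 k + 1 : ℝ) * (ρ : ℝ) ^ (p.1.deg + p.2.deg) ≤
        2 ^ (p.1.deg + 1 + p.2.deg) * ((ρ : ℝ) + 1) ^ (p.1.deg + 1 + p.2.deg) := by
        gcongr
        · exact h1.trans (pow_le_pow_right₀ (by norm_num) (by omega))
        · calc (ρ : ℝ) ^ (p.1.deg + p.2.deg) ≤ ((ρ : ℝ) + 1) ^ (p.1.deg + p.2.deg) := by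
                gcongr; simp
            _ ≤ _ := pow_le_pow_right₀ (by simp) (by omega)
    _ = _ := by rw [← mul_pow]

theorem conjFun_conjFun (f : (Fin n → ℂ) → ℂ) : conjFun (conjFun f) = f := by
  funext z
  simp [conjFun]

theorem dzbar_eq (k : Fin n) (f : (Fin n → ℂ) → ℂ) :
    dzbar k f = conjFun (dz k (conjFun f)) := by
  rw [dz_conj, conjFun_conjFun]

theorem EntireArray.dzbar_taylorSum {a : MI n → MI n → ℂ} (ha : EntireArray a) (k : Fin n) :
    dzbar k (taylorSum a) = taylorSum fun R S => a R (S + Pi.single k 1) := by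
  rw [dzbar_eq, conjFun_taylorSum, ha.conj.dz_taylorSum, conjFun_taylorSum]
  congr 1
  funext R S
  simp [arrConj]

/-- Reduces iterated derivatives of Taylor series to a single derivative, which acts as an index
shift. -/
theorem iterD_of_shift (D : Fin n → ((Fin n → ℂ) → ℂ) → ((Fin n → ℂ) → ℂ))
    (X : MI n → (Fin n → ℂ) → ℂ) (h : ∀ k P, D k (X P) = X (P + Pi.single k 1)) (R : MI n) :
    iterD D R (X 0) = X R := by
  have h1 : ∀ k r P, (D k)^[r] (X P) = X (P + Pi.single k r) := by
    intro k r
    induction r with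
    | zero => simp
    | succ r ih =>
      intro P
      rw [Function.iterate_succ_apply', ih, h, add_assoc, ← Pi.single_add]
  have h2 : ∀ l : List (Fin n), l.foldr (fun k g => (D k)^[R k] g) (X 0) =
      X (l.map fun k => Pi.single k (R k)).sum := by
    intro l
    induction l with
    | nil => rfl
    | cons k t ih =>
      rw [List.foldr_cons, ih, h1, List.map_cons, List.sum_cons, add_comm]
  rw [iterD, h2]
  congr 1
  rw [← Fin.sum_univ_def, Finset.univ_sum_single]

theorem EntireArray.shift {a : MI n → MI n → ℂ} (ha : EntireArray a) (K M : MI n) :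
    EntireArray fun R S => a (R + K) (S + M) := by
  have h1 : ∀ (b : MI n → MI n → ℂ), EntireArray b → ∀ K : MI n,
      EntireArray fun R S => b (R + K) S := by
    intro b hb K
    obtain ⟨d, hd⟩ : ∃ d, K.deg = d := ⟨_, rfl⟩
    induction d generalizing K with
    | zero =>
      have : K = 0 := by
        funext j
        exact (Finset.sum_eq_zero_iff.1 hd) j (Finset.mem_univ j)
      simpa [this] using hb
    | succ d ih =>
      obtain ⟨k, -, hk⟩ := Finset.exists_ne_zero_of_sum_ne_zero (ne_of_eq_of_ne hd d.succ_ne_zero)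
      have e : K - Pi.single k 1 + Pi.single k 1 = K := by
        funext j
        by_cases hj : j = k
        · subst hj
          simp only [Pi.add_apply, Pi.sub_apply, Pi.single_eq_same]
          omega
        · simp [Pi.single_eq_of_ne hj]
      have h2 := (ih (K - Pi.single k 1) (by
        have := congrArg MI.deg e
        rw [MI.deg_add, MI.deg_single] at this
        omega)).shift_single k
      refine (congrArg EntireArray ?_).mp h2
      funext R S
      rw [add_assoc, add_comm (Pi.single k 1), e]
  -- Conjugation exchanges the indices, so shifts in the second index need no separate proof.
  have h2 := (h1 _ (h1 a ha K).conj M).conj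
  refine (congrArg EntireArray ?_).mp h2
  funext R S
  simp [arrConj]

theorem EntireArray.mixedD_taylorSum {a : MI n → MI n → ℂ} (ha : EntireArray a) (K M : MI n) :
    mixedD K M (taylorSum a) = taylorSum fun R S => a (R + K) (S + M) := by
  have h1 : iterD dzbar M (taylorSum a) = taylorSum fun R S => a R (S + M) := by
    have := iterD_of_shift dzbar (fun P => taylorSum fun R S => a R (S + P)) (fun k P => by
      have h := (ha.shift 0 P).dzbar_taylorSum k
      simp only [add_zero] at h
      rw [h]
      congr 1
      funext R S
      rw [add_assoc, add_comm (Pi.single k 1)]) M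
    simpa using this
  have h2 := iterD_of_shift dz (fun P => taylorSum fun R S => a (R + P) (S + M)) (fun k P => by
      rw [(ha.shift P M).dz_taylorSum k]
      congr 1
      funext R S
      rw [add_assoc, add_comm (Pi.single k 1)]) K
  rw [mixedD, h1]
  simpa using h2

theorem zPow_apply_zero (R : MI n) : zPow R 0 = if R = 0 then 1 else 0 := by
  split_ifs with h
  · simp [h, zPow]
  · obtain ⟨k, hk⟩ := Function.ne_iff.1 h
    exact Finset.prod_eq_zero (Finset.mem_univ k) (by simpa using hk)

theorem taylorSum_apply_zero (a : MI n → MI n → ℂ) : taylorSum a 0 = a 0 0 := by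
  rw [taylorSum, tsum_eq_single (0 : MI n × MI n)]
  · simp [serCoef, monom, zbarPow_eq_conj, zPow_apply_zero, MI.fact_zero]
  · rintro ⟨R, S⟩ h
    rw [monom, zbarPow_eq_conj, zPow_apply_zero, zPow_apply_zero]
    by_cases hR : R = 0
    · have hS : S ≠ 0 := by
        rintro rfl
        exact h (by rw [hR]; rfl)
      simp [hS]
    · simp [hR]

theorem EntireArray.taylorCoef_taylorSum {a : MI n → MI n → ℂ} (ha : EntireArray a) :
    taylorCoef (taylorSum a) 0 = a := by
  funext R S
  rw [taylorCoef, ha.mixedD_taylorSum, taylorSum_apply_zero]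
  simp

/-! ### Commutation of the Wirtinger derivatives -/

/-- `(1/2)(∂_x + s ∂_y)`; the Wirtinger derivatives are the cases `s = ∓i`. -/
noncomputable def wirt (k : Fin n) (s : ℂ) (f : (Fin n → ℂ) → ℂ) (x : Fin n → ℂ) : ℂ :=
  (1 / 2 : ℂ) * (fderiv ℝ f x (Pi.single k 1) + s * fderiv ℝ f x (Pi.single k I))

theorem dz_eq_wirt (k : Fin n) : dz k = wirt k (-I) := by
  funext f x
  simp only [dz, wirt]
  ring

theorem dzbar_eq_wirt (k : Fin n) : dzbar k = wirt k I := rfl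

/-- Symmetry of the second derivative. -/
theorem wirt_comm (j k : Fin n) (s t : ℂ) {f : (Fin n → ℂ) → ℂ} (hf : ContDiff ℝ ∞ f) :
    wirt j s (wirt k t f) = wirt k t (wirt j s f) := by
  funext x
  have h1 : ContDiff ℝ ∞ (fderiv ℝ f) := hf.fderiv_right (by simp)
  have h2 : DifferentiableAt ℝ (fderiv ℝ f) x := h1.differentiable (by simp) x
  have hd : ∀ v w : Fin n → ℂ, fderiv ℝ (fun y => fderiv ℝ f y v) x w =
      fderiv ℝ (fderiv ℝ f) x w v := by
    intro v w
    rw [fderiv_clm_apply h2 (differentiableAt_const v)]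
    simp
  have hdv : ∀ v, DifferentiableAt ℝ (fun y => fderiv ℝ f y v) x := fun v =>
    h2.clm_apply (differentiableAt_const v)
  have hw : ∀ (i : Fin n) (r : ℂ) (w : Fin n → ℂ), fderiv ℝ (wirt i r f) x w = (1 / 2 : ℂ) *
      (fderiv ℝ (fderiv ℝ f) x w (Pi.single i 1) +
        r * fderiv ℝ (fderiv ℝ f) x w (Pi.single i I)) := by
    intro i r w
    have h3 : HasFDerivAt (wirt i r f) _ x := ((hdv (Pi.single i 1)).hasFDerivAt.add
      ((hdv (Pi.single i I)).hasFDerivAt.const_mul r)).const_mul (1 / 2 : ℂ)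
    rw [h3.fderiv]
    simp only [smul_apply, add_apply, smul_eq_mul, hd]
  have hsymm : IsSymmSndFDerivAt ℝ f x :=
    hf.contDiffAt.isSymmSndFDerivAt (by
      rw [minSmoothness_of_isRCLikeNormedField]
      exact WithTop.coe_le_coe.2 le_top)
  rw [wirt, wirt, hw, hw, hw, hw, hsymm.eq (Pi.single j 1), hsymm.eq (Pi.single j 1),
    hsymm.eq (Pi.single j I), hsymm.eq (Pi.single j I)]
  ring

theorem iterD_comp_comm {D : Fin n → ((Fin n → ℂ) → ℂ) → ((Fin n → ℂ) → ℂ)}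
    {T : ((Fin n → ℂ) → ℂ) → ((Fin n → ℂ) → ℂ)} (hD : ∀ k, SmoothLinear (D k))
    (hc : ∀ k f, ContDiff ℝ ∞ f → D k (T f) = T (D k f)) (l : List (Fin n)) (R : MI n)
    {f : (Fin n → ℂ) → ℂ} (hf : ContDiff ℝ ∞ f) :
    l.foldr (fun k g => (D k)^[R k] g) (T f) = T (l.foldr (fun k g => (D k)^[R k] g) f) := by
  have h1 : ∀ k r g, ContDiff ℝ ∞ g → (D k)^[r] (T g) = T ((D k)^[r] g) := by
    intro k r g hg
    induction r generalizing g with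
    | zero => rfl
    | succ r ih =>
      rw [Function.iterate_succ_apply, Function.iterate_succ_apply, hc k g hg,
        ih _ ((hD k).1 g hg)]
  have h2 : ∀ l : List (Fin n), ContDiff ℝ ∞ (l.foldr (fun k g => (D k)^[R k] g) f) := by
    intro l
    induction l with
    | nil => exact hf
    | cons k t ih => exact ((hD k).iter (R k)).1 _ ih
  induction l with
  | nil => rfl
  | cons k t ih =>
    rw [List.foldr_cons, ih, h1 _ _ _ (h2 t), List.foldr_cons]

theorem iterD_apply_single {D : Fin n → ((Fin n → ℂ) → ℂ) → ((Fin n → ℂ) → ℂ)}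
    (hD : ∀ k, SmoothLinear (D k))
    (hc : ∀ j k f, ContDiff ℝ ∞ f → D j (D k f) = D k (D j f)) (R : MI n) (k : Fin n)
    {f : (Fin n → ℂ) → ℂ} (hf : ContDiff ℝ ∞ f) :
    iterD D R (D k f) = iterD D (R + Pi.single k 1) f := by
  -- In a list without repetitions the coordinate k occurs at most once; where it occurs, the extra
  -- derivative is carried past the others by commutation.
  have key : ∀ l : List (Fin n), l.Nodup → l.foldr (fun j g => (D j)^[(R + Pi.single k 1 : MI n) j] g) f
      = if k ∈ l then l.foldr (fun j g => (D j)^[R j] g) (D k f)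
        else l.foldr (fun j g => (D j)^[R j] g) f := by
    intro l hl
    induction l with
    | nil => rfl
    | cons j t ih =>
      obtain ⟨hj, ht⟩ := List.nodup_cons.1 hl
      rw [List.foldr_cons, ih ht]
      by_cases hjk : k = j
      · subst hjk
        rw [if_neg hj, if_pos List.mem_cons_self, List.foldr_cons,
          iterD_comp_comm hD (fun i g hg => hc i k g hg) t R hf, Pi.add_apply, Pi.single_eq_same,
          Function.iterate_succ_apply]
      · rw [Pi.add_apply, Pi.single_eq_of_ne (Ne.symm hjk), add_zero]
        simp only [List.mem_cons, hjk, false_or, List.foldr_cons]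
        split_ifs <;> rfl
  rw [iterD, iterD, key _ (List.nodup_finRange n), if_pos (List.mem_finRange k)]

theorem mixedD_dz (R S : MI n) (k : Fin n) {f : (Fin n → ℂ) → ℂ} (hf : ContDiff ℝ ∞ f) :
    mixedD R S (dz k f) = mixedD (R + Pi.single k 1) S f := by
  have h1 : iterD dzbar S (dz k f) = dz k (iterD dzbar S f) :=
    iterD_comp_comm smoothLinear_dzbar (fun j g hg => by
      rw [dz_eq_wirt, dzbar_eq_wirt]; exact wirt_comm _ _ _ _ hg) _ S hf
  rw [mixedD, h1, iterD_apply_single smoothLinear_dz (fun j k g hg => by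
      rw [dz_eq_wirt, dz_eq_wirt]; exact wirt_comm _ _ _ _ hg) R k
      ((smoothLinear_iterD smoothLinear_dzbar S).1 f hf), mixedD]

theorem mixedD_dzbar (R S : MI n) (k : Fin n) {f : (Fin n → ℂ) → ℂ} (hf : ContDiff ℝ ∞ f) :
    mixedD R S (dzbar k f) = mixedD R (S + Pi.single k 1) f := by
  rw [mixedD, iterD_apply_single smoothLinear_dzbar (fun j k g hg => by
      rw [dzbar_eq_wirt, dzbar_eq_wirt]; exact wirt_comm _ _ _ _ hg) S k hf, mixedD]

/-! ### The identity theorem -/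

theorem fderiv_eq_sum_wirtinger (f : (Fin n → ℂ) → ℂ) (x w : Fin n → ℂ) :
    fderiv ℝ f x w = ∑ k, (w k * dz k f x + (starRingEnd ℂ) (w k) * dzbar k f x) := by
  have hw : w = ∑ k, ((w k).re • (Pi.single k 1 : Fin n → ℂ) +
      (w k).im • (Pi.single k I : Fin n → ℂ)) := by
    funext j
    rw [Finset.sum_apply, Finset.sum_eq_single j]
    · simp [re_add_im]
    · intro k _ hk
      simp [Pi.single_eq_of_ne (Ne.symm hk)]
    · simp
  conv_lhs => rw [hw]
  rw [map_sum]
  refine Finset.sum_congr rfl fun k _ => ?_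
  rw [map_add, map_smul, map_smul, dz, dzbar, real_smul, real_smul]
  conv_rhs => rw [← re_add_im (w k)]
  simp only [map_add, map_mul, conj_ofReal, conj_I]
  linear_combination (((w k).im : ℂ) * fderiv ℝ f x (Pi.single k I)) * I_mul_I

theorem iteratedFDeriv_const_apply {f : (Fin n → ℂ) → ℂ} (hf : ContDiff ℝ ∞ f) (w : Fin n → ℂ)
    (m : ℕ) (x : Fin n → ℂ) : iteratedFDeriv ℝ m f x (fun _ => w) =
      ((fun (g : (Fin n → ℂ) → ℂ) x => fderiv ℝ g x w)^[m] f) x := by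
  induction m generalizing x with
  | zero => simp
  | succ m ih =>
    rw [Function.iterate_succ_apply', ← funext ih, iteratedFDeriv_succ_apply_left]
    have h1 : DifferentiableAt ℝ (iteratedFDeriv ℝ m f) x :=
      (hf.differentiable_iteratedFDeriv (by exact_mod_cast ENat.natCast_lt_top m)) x
    have h2 : HasFDerivAt (fun x => iteratedFDeriv ℝ m f x fun _ => w)
        ((ContinuousMultilinearMap.apply ℝ (fun _ : Fin m => Fin n → ℂ) ℂ (fun _ => w)).comp
          (fderiv ℝ (iteratedFDeriv ℝ m f) x)) x :=
      (ContinuousMultilinearMap.apply ℝ (fun _ : Fin m => Fin n → ℂ) ℂ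
        (fun _ => w)).hasFDerivAt.comp x h1.hasFDerivAt
    rw [h2.fderiv]
    rfl

/-- A directional derivative is a combination of Wirtinger derivatives with constant coefficients.
Hence it preserves the class of smooth functions all of whose mixed derivatives vanish at 0. -/
theorem iterate_fderiv_eq_zero_of_mixedD_eq_zero {u : (Fin n → ℂ) → ℂ} (hu : ContDiff ℝ ∞ u)
    (h : ∀ R S, mixedD R S u 0 = 0) (w : Fin n → ℂ) (m : ℕ) :
    ((fun (g : (Fin n → ℂ) → ℂ) x => fderiv ℝ g x w)^[m] u) 0 = 0 := by
  have hdir : ∀ (w : Fin n → ℂ) (v : (Fin n → ℂ) → ℂ),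
      (ContDiff ℝ ∞ v ∧ ∀ R S, mixedD R S v 0 = 0) →
      (ContDiff ℝ ∞ (fun x => fderiv ℝ v x w) ∧ ∀ R S, mixedD R S (fun x => fderiv ℝ v x w) 0 = 0) := by
    rintro w v ⟨hv, h0⟩
    have e : (fun x => fderiv ℝ v x w) =
        ∑ k, (w k • dz k v + (starRingEnd ℂ) (w k) • dzbar k v) := by
      funext x
      rw [fderiv_eq_sum_wirtinger, Finset.sum_apply]
      rfl
    refine ⟨(hv.fderiv_right (m := ∞) (by simp)).clm_apply contDiff_const, fun R S => ?_⟩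
    rw [e]
    have hz : ∀ k, ContDiff ℝ ∞ (w k • dz k v) := fun k =>
      contDiff_const.smul ((smoothLinear_dz k).1 v hv)
    have hzb : ∀ k, ContDiff ℝ ∞ ((starRingEnd ℂ) (w k) • dzbar k v) := fun k =>
      contDiff_const.smul ((smoothLinear_dzbar k).1 v hv)
    have hT := smoothLinear_mixedD (n := n) R S
    have hterm : ∀ k, mixedD R S (w k • dz k v + (starRingEnd ℂ) (w k) • dzbar k v) 0 = 0 := by
      intro k
      rw [hT.2.1 _ _ (hz k) (hzb k), hT.2.2 _ _ ((smoothLinear_dz k).1 v hv),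
        hT.2.2 _ _ ((smoothLinear_dzbar k).1 v hv), mixedD_dz R S k hv, mixedD_dzbar R S k hv]
      simp [h0]
    suffices H : ∀ s : Finset (Fin n),
        ContDiff ℝ ∞ (∑ k ∈ s, (w k • dz k v + (starRingEnd ℂ) (w k) • dzbar k v)) ∧
        mixedD R S (∑ k ∈ s, (w k • dz k v + (starRingEnd ℂ) (w k) • dzbar k v)) 0 = 0 from
      (H Finset.univ).2
    intro s
    induction s using Finset.induction_on with
    | empty =>
      have h0' := hT.2.2 0 0 contDiff_const
      rw [zero_smul, zero_smul] at h0'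
      exact ⟨contDiff_const, by rw [Finset.sum_empty, h0']; rfl⟩
    | insert k s hk ih =>
      rw [Finset.sum_insert hk]
      have hk' : ContDiff ℝ ∞ (w k • dz k v + (starRingEnd ℂ) (w k) • dzbar k v) :=
        (hz k).add (hzb k)
      refine ⟨hk'.add ih.1, ?_⟩
      rw [hT.2.1 _ _ hk' ih.1, Pi.add_apply, hterm, ih.2, add_zero]
  have hit : ∀ m, ContDiff ℝ ∞ ((fun (g : (Fin n → ℂ) → ℂ) x => fderiv ℝ g x w)^[m] u) ∧
      ∀ R S, mixedD R S ((fun (g : (Fin n → ℂ) → ℂ) x => fderiv ℝ g x w)^[m] u) 0 = 0 := by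
    intro m
    induction m with
    | zero => exact ⟨hu, h⟩
    | succ m ih =>
      rw [Function.iterate_succ_apply']
      exact hdir w _ ih
  have h1 := (hit m).2 0 0
  simpa only [mixedD, iterD_zero] using h1

/-- The power series at 0 is determined on the diagonal by iterated directional derivatives, so u
vanishes near 0, and then everywhere by analytic continuation. -/
theorem eq_zero_of_mixedD_eq_zero {u : (Fin n → ℂ) → ℂ} (hu : AnalyticOnNhd ℝ u Set.univ)
    (h : ∀ R S, mixedD R S u 0 = 0) : u = 0 := by
  have hit : ∀ (w : Fin n → ℂ) (m : ℕ), iteratedFDeriv ℝ m u 0 (fun _ => w) = 0 := by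
    intro w m
    rw [iteratedFDeriv_const_apply hu.contDiff]
    exact iterate_fderiv_eq_zero_of_mixedD_eq_zero hu.contDiff h w m
  obtain ⟨p, r, hp⟩ := hu 0 (Set.mem_univ _)
  refine hu.eq_of_eventuallyEq analyticOnNhd_const (z₀ := 0) ?_
  filter_upwards [Metric.eball_mem_nhds (0 : Fin n → ℂ) hp.r_pos] with y hy
  have h2 := hp.hasSum hy
  have h3 : ∀ m, (p m fun _ => y) = 0 := by
    intro m
    have h4 := hp.factorial_smul y m
    rw [hit] at h4
    exact (smul_eq_zero.1 h4).resolve_left m.factorial_ne_zero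
  simp only [h3, zero_add] at h2
  exact h2.unique hasSum_zero

/-! ### `A_ħ` as a space of arrays -/

theorem MI.exists_pow_le_mul_fact (n : ℕ) {D : ℝ} (hD : 0 ≤ D) :
    ∃ K : ℝ, 0 < K ∧ ∀ N : MI n, D ^ N.deg ≤ K * N.fact := by
  refine ⟨∏ _k : Fin n, Real.exp D, by positivity, fun N => ?_⟩
  rw [← MI.prod_pow, MI.fact, Nat.cast_prod, ← Finset.prod_mul_distrib]
  refine Finset.prod_le_prod (fun _ _ => by positivity) fun k _ => ?_
  have h := Real.pow_div_factorial_le_exp D hD (N k)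
  rwa [div_le_iff₀ (by positivity)] at h

theorem MI.tsum_half_pow_ne_top (n : ℕ) : ∑' N : MI n, (2⁻¹ : ℝ≥0∞) ^ N.deg ≠ ⊤ := by
  have h : ∀ N : MI n, (2⁻¹ : ℝ≥0∞) ^ N.deg = ∏ k, (2⁻¹ : ℝ≥0∞) ^ N k :=
    fun N => (MI.prod_pow _ N).symm
  simp only [h]
  rw [ENNReal_tsum_prod_apply fun _ i => (2⁻¹ : ℝ≥0∞) ^ i]
  refine ENNReal.prod_ne_top fun _ _ => ?_
  rw [ENNReal.tsum_geometric, ENNReal.one_sub_inv_two, inv_inv]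
  exact ENNReal.ofNat_ne_top

theorem MI.summable_half_pow (n : ℕ) : Summable fun N : MI n => (1 / 2 : ℝ) ^ N.deg := by
  refine (ENNReal.summable_toReal (MI.tsum_half_pow_ne_top n)).congr fun N => ?_
  simp

theorem MI.summable_half_pow_prod (n : ℕ) :
    Summable fun p : MI n × MI n => (1 / 2 : ℝ) ^ (p.1.deg + p.2.deg) := by
  have h := (MI.summable_half_pow n).mul_of_nonneg (MI.summable_half_pow n)
    (fun _ => by positivity) (fun _ => by positivity)
  exact h.congr fun p => (pow_add _ _ _).symm

theorem MI.one_le_fact (N : MI n) : (1 : ℝ) ≤ N.fact := by exact_mod_cast N.fact_pos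

/-- Arrays whose entries are at most of size `(R! S!)^{1/4}` up to geometric factors: a uniform
bound for the Taylor series. -/
theorem exists_norm_serCoef_le (n : ℕ) {D : ℝ} (hD : 0 ≤ D) (ρ : NNReal) :
    ∃ K : ℝ, 0 < K ∧ ∀ (C : ℝ) (a : MI n → MI n → ℂ), 0 ≤ C →
      (∀ R S, ‖a R S‖ ^ 4 ≤ C ^ 4 * D ^ (R.deg + S.deg) * (R.fact * S.fact)) →
      ∀ p : MI n × MI n, ‖serCoef a p‖ * (ρ : ℝ) ^ (p.1.deg + p.2.deg) ≤
        C * K * (1 / 2) ^ (p.1.deg + p.2.deg) := by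
  -- The estimate is proved for fourth powers: ρ contributes ρ⁴, and 16 = 2⁴ pays for the factors
  -- 1/2 in the claim.
  obtain ⟨K, hK, h⟩ := MI.exists_pow_le_mul_fact n (D := D * ρ ^ 4 * 16) (by positivity)
  -- K + 1 ≥ 1 makes K² ≤ (K + 1)⁴ available.
  refine ⟨K + 1, by linarith, fun C a hC ha p => ?_⟩
  rw [← pow_le_pow_iff_left₀ (by positivity) (by positivity) (n := 4) (by norm_num)]
  set d := p.1.deg + p.2.deg with hd
  have h1 := ha p.1 p.2
  have h2 : (D * ρ ^ 4 * 16) ^ d ≤ K ^ 2 * (p.1.fact * p.2.fact) := by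
    calc (D * ρ ^ 4 * 16) ^ d = (D * ρ ^ 4 * 16) ^ p.1.deg * (D * ρ ^ 4 * 16) ^ p.2.deg :=
          pow_add _ _ _
      _ ≤ (K * p.1.fact) * (K * p.2.fact) :=
          mul_le_mul (h _) (h _) (by positivity) (by positivity)
      _ = _ := by ring
  have f1 := p.1.one_le_fact
  have f2 := p.2.one_le_fact
  set F : ℝ := (p.1.fact : ℝ) * p.2.fact with hF
  have hF1 : 1 ≤ F := by nlinarith
  have e1 : ‖serCoef a p‖ = ‖a p.1 p.2‖ / F := by
    simp [serCoef, hF]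
  rw [e1, div_mul_eq_mul_div, div_pow, div_le_iff₀ (by positivity)]
  have h16 : ((1 / 2 : ℝ) ^ d) ^ 4 * 16 ^ d = 1 := by
    rw [← pow_mul, mul_comm d, pow_mul, ← mul_pow]
    norm_num
  calc (‖a p.1 p.2‖ * (ρ : ℝ) ^ d) ^ 4 = ‖a p.1 p.2‖ ^ 4 * ((ρ : ℝ) ^ 4) ^ d := by
        rw [mul_pow, ← pow_mul, ← pow_mul, mul_comm d]
    _ ≤ (C ^ 4 * D ^ d * F) * ((ρ : ℝ) ^ 4) ^ d := by gcongr
    _ = C ^ 4 * F * (D * ρ ^ 4 * 16) ^ d * ((1 / 2 : ℝ) ^ d) ^ 4 := by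
        rw [mul_pow (_ * _) 16, mul_pow D]
        linear_combination (-C ^ 4 * D ^ d * F * ((ρ : ℝ) ^ 4) ^ d) * h16
    _ ≤ C ^ 4 * F * (K ^ 2 * F) * ((1 / 2 : ℝ) ^ d) ^ 4 := by gcongr
    _ = C ^ 4 * ((1 / 2 : ℝ) ^ d) ^ 4 * (K ^ 2 * F ^ 2) := by ring
    _ ≤ C ^ 4 * ((1 / 2 : ℝ) ^ d) ^ 4 * ((K + 1) ^ 4 * F ^ 4) := by
        gcongr ?_ * ?_
        refine mul_le_mul ?_ (pow_le_pow_right₀ hF1 (by norm_num)) (by positivity) (by positivity)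
        calc K ^ 2 ≤ (K + 1) ^ 2 := by gcongr; linarith
          _ ≤ (K + 1) ^ 4 := pow_le_pow_right₀ (by linarith) (by norm_num)
    _ = _ := by ring

theorem exists_pow_four_eq {C : ℝ} (hC : 0 ≤ C) : ∃ c : ℝ, 0 ≤ c ∧ c ^ 4 = C :=
  ⟨√√C, by positivity, by
    rw [show (4 : ℕ) = 2 * 2 by norm_num, pow_mul, Real.sq_sqrt (by positivity), Real.sq_sqrt hC]⟩

theorem WickArray.entire (hħ : 0 < ħ) {a : MI n → MI n → ℂ} (ha : WickArray ħ a) :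
    EntireArray a := by
  obtain ⟨C, D, hC, hD, h⟩ := ha.exists_bound hħ
  obtain ⟨c, hc, rfl⟩ := exists_pow_four_eq hC.le
  refine .of_summable fun ρ => ?_
  obtain ⟨K, hK, hb⟩ := exists_norm_serCoef_le n hD.le ρ
  exact ((MI.summable_half_pow_prod n).mul_left (c * K)).of_nonneg_of_le
    (fun _ => by positivity) fun p => hb c a hc h p

/-- The Taylor coefficients of an element of `A_ħ` at the origin. -/
noncomputable def WickAlg.coef (f : WickAlg n ħ) : MI n → MI n → ℂ :=
  taylorCoef (f : (Fin n → ℂ) → ℂ) 0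

theorem wickArray_iff {f : (Fin n → ℂ) → ℂ} : WickArray ħ (taylorCoef f 0) ↔
    ∀ (m : ℕ) (l : Fin (2 ^ m)) (R S : MI n), eNormWick ħ 0 m l R S f < ⊤ := by
  have h : ∀ m l R S, eNormWick ħ 0 m l R S f < ⊤ ↔
      wickIter (wickBase ħ (taylorCoef f 0)) m l R S ≠ ⊤ := by
    intro m l R S
    rw [eNormWick, hWick_eq_wickIter, ENNReal.rpow_lt_top_iff_of_pos (by positivity),
      lt_top_iff_ne_top]
  simp only [h]
  exact ⟨fun H m l R S => H m l l.2 R S, fun H m l hl R S => H m ⟨l, hl⟩ R S⟩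

theorem WickAlg.wickArray_coef (f : WickAlg n ħ) : WickArray ħ f.coef :=
  wickArray_iff.2 f.finite

/-- The element of `A_ħ` with given Taylor coefficients. -/
noncomputable def WickAlg.ofArray (hħ : 0 < ħ) (a : MI n → MI n → ℂ) (ha : WickArray ħ a) :
    WickAlg n ħ :=
  ⟨taylorSum a, (ha.entire hħ).analyticOnNhd,
    wickArray_iff.1 (by rwa [(ha.entire hħ).taylorCoef_taylorSum])⟩

theorem WickAlg.coef_ofArray (hħ : 0 < ħ) (a : MI n → MI n → ℂ) (ha : WickArray ħ a) :
    (WickAlg.ofArray hħ a ha).coef = a :=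
  (ha.entire hħ).taylorCoef_taylorSum

theorem WickAlg.coef_add (f g : WickAlg n ħ) : (f + g).coef = f.coef + g.coef := by
  funext R S
  exact congrFun ((smoothLinear_mixedD R S).2.1 _ _ f.contDiff g.contDiff) 0

theorem WickAlg.coef_smul (c : ℂ) (f : WickAlg n ħ) : (c • f).coef = c • f.coef := by
  funext R S
  exact congrFun ((smoothLinear_mixedD R S).2.2 c _ f.contDiff) 0

theorem eq_of_taylorCoef_eq {u v : (Fin n → ℂ) → ℂ} (hu : AnalyticOnNhd ℝ u Set.univ)
    (hv : AnalyticOnNhd ℝ v Set.univ) (h : taylorCoef u 0 = taylorCoef v 0) : u = v := by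
  have h1 : u - v = 0 := by
    refine eq_zero_of_mixedD_eq_zero (hu.sub hv) fun R S => ?_
    have e : u - v = u + (-1 : ℂ) • v := by
      funext x
      simp [sub_eq_add_neg]
    have hT := smoothLinear_mixedD (n := n) R S
    have hv' : ContDiff ℝ ∞ ((-1 : ℂ) • v) := contDiff_const.smul hv.contDiff
    rw [e, hT.2.1 _ _ hu.contDiff hv', hT.2.2 _ _ hv.contDiff]
    have h2 : mixedD R S u 0 = mixedD R S v 0 := congrFun (congrFun h R) S
    simp [h2]
  exact sub_eq_zero.1 h1

theorem WickAlg.coef_injective : Function.Injective (WickAlg.coef (n := n) (ħ := ħ)) :=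
  fun f g h => Subtype.ext (eq_of_taylorCoef_eq f.analytic g.analytic h)

theorem WickAlg.coe_eq_taylorSum (hħ : 0 < ħ) (f : WickAlg n ħ) :
    (f : (Fin n → ℂ) → ℂ) = taylorSum f.coef :=
  congrArg Subtype.val (WickAlg.coef_injective (WickAlg.coef_ofArray hħ f.coef f.wickArray_coef).symm)

theorem WickAlg.mixedD_apply (hħ : 0 < ħ) (f : WickAlg n ħ) (K M : MI n) (z : Fin n → ℂ) :
    mixedD K M f z = taylorSum (fun R S => f.coef (R + K) (S + M)) z := by
  rw [f.coe_eq_taylorSum hħ, (f.wickArray_coef.entire hħ).mixedD_taylorSum]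

/-- Raising to the power 2^{m+1} removes the root, so seminorms are compared through the recursion
in [0, ∞]. -/
theorem wickSeminorm_pow (q : SIdx n) (f : WickAlg n ħ) :
    ENNReal.ofReal (wickSeminorm n ħ q f) ^ 2 ^ (q.1 + 1) =
      wickIter (wickBase ħ f.coef) q.1 q.2.1 q.2.2.1 q.2.2.2 := by
  change ENNReal.ofReal (eNormWick ħ 0 q.1 q.2.1 q.2.2.1 q.2.2.2 f.1).toReal ^ _ = _
  rw [ENNReal.ofReal_toReal (f.finite _ _ _ _).ne]
  have h := hWick_eq_rpow ħ 0 q.1 q.2.1 q.2.2.1 q.2.2.2 f.1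
  rw [hWick_eq_wickIter] at h
  change _ = wickIter (wickBase ħ (taylorCoef f.1 0)) _ _ _ _
  rw [h, ← ENNReal.rpow_natCast]
  push_cast
  rfl

/-! ### Products of Taylor series -/

theorem zPow_add (R S : MI n) (z : Fin n → ℂ) : zPow (R + S) z = zPow R z * zPow S z := by
  simp [zPow, pow_add, Finset.prod_mul_distrib]

theorem monom_add (p q : MI n × MI n) (z : Fin n → ℂ) :
    monom (p + q) z = monom p z * monom q z := by
  simp only [monom, zbarPow_eq_conj, Prod.fst_add, Prod.snd_add, zPow_add, map_mul]
  ring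

theorem le_of_mem_Icc_product {p r : MI n × MI n}
    (h : p ∈ Finset.Icc 0 r.1 ×ˢ Finset.Icc 0 r.2) : p.1 ≤ r.1 ∧ p.2 ≤ r.2 :=
  ⟨(Finset.mem_Icc.1 (Finset.mem_product.1 h).1).2, (Finset.mem_Icc.1 (Finset.mem_product.1 h).2).2⟩

/-- Pairs of pairs of multi-indices, sorted by their sum. -/
def sigmaIccEquiv (n : ℕ) : (Σ r : MI n × MI n, {p : MI n × MI n // p ∈ Finset.Icc 0 r.1 ×ˢ Finset.Icc 0 r.2}) ≃
    (MI n × MI n) × (MI n × MI n) where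
  toFun x := (x.2.1, (x.1.1 - x.2.1.1, x.1.2 - x.2.1.2))
  invFun y := ⟨y.1 + y.2, y.1, Finset.mem_product.2
    ⟨Finset.mem_Icc.2 ⟨zero_le, le_self_add⟩, Finset.mem_Icc.2 ⟨zero_le, le_self_add⟩⟩⟩
  left_inv := by
    rintro ⟨r, p, hp⟩
    have h := le_of_mem_Icc_product hp
    have e : p + (r.1 - p.1, r.2 - p.2) = r :=
      Prod.ext (add_tsub_cancel_of_le h.1) (add_tsub_cancel_of_le h.2)
    refine Sigma.ext e ?_
    refine (Subtype.heq_iff_coe_eq fun x => ?_).2 rfl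
    dsimp only
    rw [e]
  right_inv := by
    rintro ⟨p, q⟩
    refine Prod.ext rfl (Prod.ext ?_ ?_)
    · exact add_tsub_cancel_left p.1 q.1
    · exact add_tsub_cancel_left p.2 q.2

theorem MI.binom_div_fact {R I : MI n} (h : I ≤ R) :
    (R.binom I : ℂ) / R.fact = 1 / (I.fact * (R - I).fact) := by
  rw [← MI.binom_mul_fact_mul_fact h]
  have h0 : (R.binom I : ℂ) ≠ 0 := by
    exact_mod_cast (Finset.prod_pos fun k _ => Nat.choose_pos (h k)).ne'
  have h1 : (I.fact : ℂ) ≠ 0 := by exact_mod_cast I.fact_ne_zero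
  have h2 : ((R - I).fact : ℂ) ≠ 0 := by exact_mod_cast (R - I).fact_ne_zero
  push_cast
  field_simp

theorem serCoef_arrMul (a b : MI n → MI n → ℂ) (r : MI n × MI n) :
    serCoef (arrMul a b) r =
      ∑ p ∈ Finset.Icc 0 r.1 ×ˢ Finset.Icc 0 r.2, serCoef a p * serCoef b (r.1 - p.1, r.2 - p.2) := by
  rw [Finset.sum_product, serCoef, arrMul, Finset.sum_div]
  refine Finset.sum_congr rfl fun I hI => ?_
  rw [Finset.sum_div]
  refine Finset.sum_congr rfl fun J hJ => ?_
  have h1 := MI.binom_div_fact (Finset.mem_Icc.1 hI).2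
  have h2 := MI.binom_div_fact (Finset.mem_Icc.1 hJ).2
  simp only [serCoef]
  calc _ = ((r.1.binom I : ℂ) / r.1.fact) * ((r.2.binom J : ℂ) / r.2.fact) *
        (a I J * b (r.1 - I) (r.2 - J)) := by ring
    _ = _ := by rw [h1, h2]; ring

/-- The Cauchy product: the absolutely convergent double series is sorted by the sum of the
exponents. -/
theorem taylorSum_arrMul {a b : MI n → MI n → ℂ} (ha : EntireArray a) (hb : EntireArray b)
    (z : Fin n → ℂ) : taylorSum (arrMul a b) z = taylorSum a z * taylorSum b z := by
  have h1 := summable_mul_of_summable_norm (ha.summable_norm z) (hb.summable_norm z)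
  change _ = (∑' p, serCoef a p * monom p z) * ∑' p, serCoef b p * monom p z
  rw [tsum_mul_tsum_of_summable_norm (ha.summable_norm z) (hb.summable_norm z),
    ← (sigmaIccEquiv n).tsum_eq]
  refine Eq.trans ?_ ((sigmaIccEquiv n).summable_iff.2 h1).tsum_sigma.symm
  rw [taylorSum]
  refine tsum_congr fun r => ?_
  rw [tsum_fintype, serCoef_arrMul, Finset.sum_mul,
    ← Finset.sum_coe_sort (Finset.Icc 0 r.1 ×ˢ Finset.Icc 0 r.2)]
  refine Finset.sum_congr rfl fun p _ => ?_
  have h := le_of_mem_Icc_product p.2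
  have e : p.1 + (r.1 - p.1.1, r.2 - p.1.2) = r :=
    Prod.ext (add_tsub_cancel_of_le h.1) (add_tsub_cancel_of_le h.2)
  simp only [sigmaIccEquiv, Equiv.coe_fn_mk, Function.comp_apply]
  conv_lhs => rw [← congrArg (fun q => monom q z) e]
  rw [monom_add]
  ring

theorem arrNorm_arrMul_le (ρ : NNReal) (a b : MI n → MI n → ℂ) :
    arrNorm ρ (arrMul a b) ≤ arrNorm ρ a * arrNorm ρ b := by
  have h1 : arrNorm ρ a * arrNorm ρ b = ∑' y : (MI n × MI n) × (MI n × MI n),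
      (‖serCoef a y.1‖ₑ * (ρ : ℝ≥0∞) ^ (y.1.1.deg + y.1.2.deg)) *
        (‖serCoef b y.2‖ₑ * (ρ : ℝ≥0∞) ^ (y.2.1.deg + y.2.2.deg)) := by
    rw [ENNReal.tsum_prod']
    simp only [ENNReal.tsum_mul_left, ENNReal.tsum_mul_right, arrNorm]
  rw [h1, ← (sigmaIccEquiv n).tsum_eq, ENNReal.tsum_sigma', arrNorm]
  refine ENNReal.tsum_le_tsum fun r => ?_
  rw [tsum_fintype, serCoef_arrMul]
  refine (mul_le_mul_left (enorm_sum_le _ _) _).trans (le_of_eq ?_)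
  rw [Finset.sum_mul, ← Finset.sum_coe_sort (Finset.Icc 0 r.1 ×ˢ Finset.Icc 0 r.2)]
  refine Finset.sum_congr rfl fun p _ => ?_
  have h := le_of_mem_Icc_product p.2
  have e : r.1.deg + r.2.deg =
      (p.1.1.deg + p.1.2.deg) + ((r.1 - p.1.1).deg + (r.2 - p.1.2).deg) := by
    have hd : ∀ {I R : MI n}, I ≤ R → R.deg = I.deg + (R - I).deg := fun {I R} hIR => by
      rw [← MI.deg_add, add_tsub_cancel_of_le hIR]
    rw [hd h.1, hd h.2]
    ring
  simp only [sigmaIccEquiv, Equiv.coe_fn_mk]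
  rw [e, pow_add, enorm_mul]
  ring

theorem arrNorm_smul (ρ : NNReal) (c : ℂ) (a : MI n → MI n → ℂ) :
    arrNorm ρ (c • a) = ‖c‖ₑ * arrNorm ρ a := by
  rw [arrNorm, arrNorm, ← ENNReal.tsum_mul_left]
  refine tsum_congr fun p => ?_
  have e : serCoef (c • a) p = c * serCoef a p := by
    simp [serCoef, mul_div_assoc]
  rw [e, enorm_mul, mul_assoc]

theorem taylorSum_smul (c : ℂ) (a : MI n → MI n → ℂ) (z : Fin n → ℂ) :
    taylorSum (c • a) z = c * taylorSum a z := by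
  rw [taylorSum, taylorSum, ← tsum_mul_left]
  refine tsum_congr fun p => ?_
  simp [serCoef, mul_div_assoc, mul_assoc]

/-- A series of Taylor series may be summed coefficientwise. -/
theorem hasSum_taylorSum {ι : Type*} {c : ι → MI n → MI n → ℂ}
    (h : ∀ ρ : NNReal, ∑' i, arrNorm ρ (c i) ≠ ⊤) (z : Fin n → ℂ) :
    HasSum (fun i => taylorSum (c i) z) (taylorSum (fun R S => ∑' i, c i R S) z) := by
  have hent : ∀ i, EntireArray (c i) := fun i ρ =>
    ne_top_of_le_ne_top (h ρ) (ENNReal.le_tsum i)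
  -- Absolute summability over the product of ι with the exponents justifies the exchange of the two
  -- sums.
  have h1 : Summable fun x : ι × (MI n × MI n) =>
      ‖serCoef (c x.1) x.2‖ * (‖z‖₊ : ℝ) ^ (x.2.1.deg + x.2.2.deg) := by
    have h2 : ∑' x : ι × (MI n × MI n), ‖serCoef (c x.1) x.2‖ₑ *
        ((‖z‖₊ : NNReal) : ℝ≥0∞) ^ (x.2.1.deg + x.2.2.deg) ≠ ⊤ := by
      rw [ENNReal.tsum_prod']
      exact h ‖z‖₊
    refine (ENNReal.summable_toReal h2).congr fun x => ?_
    rw [ENNReal.toReal_mul, ENNReal.toReal_pow, toReal_enorm, ENNReal.coe_toReal]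
  have h3 : Summable fun x : ι × (MI n × MI n) => serCoef (c x.1) x.2 * monom x.2 z := by
    refine Summable.of_norm_bounded h1 fun x => ?_
    rw [norm_mul]
    gcongr
    exact norm_monom_le _ _
  have h4 := h3.hasSum.prod_fiberwise (g := fun i => taylorSum (c i) z) fun i => (hent i).hasSum z
  convert! h4 using 1
  rw [← (Equiv.prodComm (MI n × MI n) ι).tsum_eq]
  refine Eq.trans ?_ ((Equiv.prodComm (MI n × MI n) ι).summable_iff.2 h3).tsum_prod.symm
  rw [taylorSum]
  refine tsum_congr fun p => ?_
  simp only [Function.comp_apply, Equiv.prodComm_apply, Prod.fst_swap, Prod.snd_swap, tsum_mul_right]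
  rw [serCoef, ← tsum_div_const]
  rfl

/-! ### The Wick product -/

theorem arrNorm_le_of_le {a : MI n → MI n → ℂ} {ρ : NNReal} {M : ℝ} (hM : 0 ≤ M)
    (h : ∀ p : MI n × MI n, ‖serCoef a p‖ * (ρ : ℝ) ^ (p.1.deg + p.2.deg) ≤
      M * (1 / 2) ^ (p.1.deg + p.2.deg)) :
    arrNorm ρ a ≤ ENNReal.ofReal (M * ∑' p : MI n × MI n, (1 / 2 : ℝ) ^ (p.1.deg + p.2.deg)) := by
  rw [← tsum_mul_left, ENNReal.ofReal_tsum_of_nonneg (fun _ => by positivity)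
    ((MI.summable_half_pow_prod n).mul_left M)]
  refine ENNReal.tsum_le_tsum fun p => ?_
  refine le_trans (le_of_eq ?_) (ENNReal.ofReal_le_ofReal (h p))
  rw [ENNReal.ofReal_mul (norm_nonneg _), ofReal_norm, ENNReal.ofReal_pow ρ.coe_nonneg,
    ENNReal.ofReal_coe_nnreal]

theorem MI.fact_add_le (R S : MI n) :
    ((R + S).fact : ℝ) ≤ 2 ^ (R.deg + S.deg) * (R.fact * S.fact) := by
  have h : (R + S).fact ≤ 2 ^ (R.deg + S.deg) * (R.fact * S.fact) := by
    rw [← MI.deg_add, ← MI.prod_pow, MI.fact, MI.fact, MI.fact, ← Finset.prod_mul_distrib,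
      ← Finset.prod_mul_distrib]
    refine Finset.prod_le_prod' fun k _ => ?_
    rw [Pi.add_apply, ← Nat.add_choose_mul_factorial_mul_factorial, mul_assoc]
    exact Nat.mul_le_mul_right _ (Nat.choose_le_two_pow _ _)
  exact_mod_cast h

/-- A uniform bound for the shifted arrays that enter the Wick product. -/
theorem WickArray.exists_arrNorm_shift_le (hħ : 0 < ħ) {a : MI n → MI n → ℂ}
    (ha : WickArray ħ a) (ρ : NNReal) : ∃ (C D : ℝ) (A : MI n → ℝ), 0 ≤ C ∧ 0 ≤ D ∧
      (∀ N, 0 ≤ A N ∧ A N ^ 4 = C * D ^ N.deg * N.fact) ∧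
      ∀ N, arrNorm ρ (fun I J => a (N + I) J) ≤ ENNReal.ofReal (A N) := by
  obtain ⟨C, D, hC, hD, h⟩ := ha.exists_bound hħ
  -- Splitting (N+R)! costs powers of 2, leaving the ratios 2D in R and D in S; 4D dominates both.
  obtain ⟨K, hK, hb⟩ := exists_norm_serCoef_le n (D := 2 * D + 2 * D) (by positivity) ρ
  have hex : ∀ N : MI n, ∃ c : ℝ, 0 ≤ c ∧ c ^ 4 = C * (2 * D) ^ N.deg * N.fact := fun N =>
    exists_pow_four_eq (by positivity)
  choose c hc0 hc using hex
  set H : ℝ := ∑' p : MI n × MI n, (1 / 2 : ℝ) ^ (p.1.deg + p.2.deg) with hH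
  have hH0 : 0 ≤ H := tsum_nonneg fun _ => by positivity
  refine ⟨C * (K * H) ^ 4, 2 * D, fun N => c N * K * H, by positivity, by positivity,
    fun N => ⟨by have := hc0 N; positivity, ?_⟩, fun N => ?_⟩
  · calc (c N * K * H) ^ 4 = c N ^ 4 * (K * H) ^ 4 := by ring
      _ = _ := by rw [hc]; ring
  · refine arrNorm_le_of_le (by have := hc0 N; positivity) (hb (c N) _ (hc0 N) fun R S => ?_)
    rw [hc]
    have h1 := MI.fact_add_le N R
    calc ‖a (N + R) S‖ ^ 4 ≤ C * D ^ ((N + R).deg + S.deg) * ((N + R).fact * S.fact) := h _ _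
      _ ≤ C * D ^ ((N + R).deg + S.deg) * (2 ^ (N.deg + R.deg) * (N.fact * R.fact) * S.fact) := by
          gcongr
      _ = C * (2 * D) ^ N.deg * N.fact * ((2 * D) ^ R.deg * D ^ S.deg) * (R.fact * S.fact) := by
          rw [MI.deg_add]
          ring
      _ ≤ C * (2 * D) ^ N.deg * N.fact * ((2 * D + 2 * D) ^ R.deg * (2 * D + 2 * D) ^ S.deg) *
          (R.fact * S.fact) := by
          gcongr <;> linarith
      _ = _ := by rw [pow_add]

theorem arrNorm_arrConj (ρ : NNReal) (a : MI n → MI n → ℂ) :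
    arrNorm ρ (arrConj a) = arrNorm ρ a := by
  rw [arrNorm, ← (Equiv.prodComm (MI n) (MI n)).tsum_eq, arrNorm]
  refine tsum_congr fun p => ?_
  have e : serCoef (arrConj a) p.swap = (starRingEnd ℂ) (serCoef a p) := by
    simp [serCoef, arrConj, mul_comm]
  rw [Equiv.prodComm_apply, e, ← enorm_norm, RCLike.norm_conj, enorm_norm, Prod.fst_swap,
    Prod.snd_swap, add_comm p.2.deg]

/-- Each of the two shifted arrays grows like (N!)^{1/4} up to geometric factors, so the prefactor
1/N! leaves (N!)^{-1/2}. The shift of b in its second index is treated through its conjugate. -/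
theorem arrNorm_wick_summable (hħ : 0 < ħ) {a b : MI n → MI n → ℂ} (ha : WickArray ħ a)
    (hb : WickArray ħ b) (ρ : NNReal) :
    ∑' N : MI n, arrNorm ρ (((2 * (ħ : ℂ)) ^ N.deg / (N.fact : ℂ)) •
      arrMul (fun I J => a (N + I) J) (fun I J => b I (N + J))) ≠ ⊤ := by
  obtain ⟨C, D, A, hC, hD, hA, hA'⟩ := ha.exists_arrNorm_shift_le hħ ρ
  obtain ⟨C', D', B, hC', hD', hB, hB'⟩ := hb.conj.exists_arrNorm_shift_le hħ ρ
  -- The ratio that appears in the fourth power of the N-th bound, times 16 for the factor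
  -- (1/2)^{|N|}. That fourth power still has (N!)² in its denominator.
  obtain ⟨K, hK, hKb⟩ := MI.exists_pow_le_mul_fact n (D := (2 * ħ) ^ 4 * D * D' * 16)
    (by positivity)
  obtain ⟨k, hk0, hk⟩ := exists_pow_four_eq (C := C * C' * K) (by positivity)
  have hbound : ∀ N : MI n, arrNorm ρ (((2 * (ħ : ℂ)) ^ N.deg / (N.fact : ℂ)) •
      arrMul (fun I J => a (N + I) J) (fun I J => b I (N + J))) ≤
      ENNReal.ofReal (k * (1 / 2) ^ N.deg) := by
    intro N
    have h1 : arrNorm ρ (fun I J => b I (N + J)) ≤ ENNReal.ofReal (B N) := by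
      refine le_trans (le_of_eq ?_) (hB' N)
      rw [← arrNorm_arrConj]
      rfl
    have hA0 := (hA N).1
    have hB0 := (hB N).1
    have h2 : ‖(2 * (ħ : ℂ)) ^ N.deg / (N.fact : ℂ)‖ = (2 * ħ) ^ N.deg / N.fact := by
      rw [norm_div, norm_pow, norm_mul, Complex.norm_natCast, RCLike.norm_ofNat,
        Complex.norm_real, Real.norm_of_nonneg hħ.le]
    rw [arrNorm_smul]
    calc _ ≤ ENNReal.ofReal ((2 * ħ) ^ N.deg / N.fact) *
          (ENNReal.ofReal (A N) * ENNReal.ofReal (B N)) := by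
          rw [← h2, ofReal_norm]
          gcongr
          exact (arrNorm_arrMul_le _ _ _).trans (mul_le_mul' (hA' N) h1)
      _ = ENNReal.ofReal ((2 * ħ) ^ N.deg / N.fact * (A N * B N)) := by
          rw [ENNReal.ofReal_mul (by positivity), ENNReal.ofReal_mul hA0]
      _ ≤ _ := by
          refine ENNReal.ofReal_le_ofReal ?_
          rw [← pow_le_pow_iff_left₀ (by positivity) (by positivity) (n := 4) (by norm_num)]
          have h16 : ((1 / 2 : ℝ) ^ N.deg) ^ 4 * 16 ^ N.deg = 1 := by
            rw [← pow_mul, mul_comm N.deg, pow_mul, ← mul_pow]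
            norm_num
          have f1 := N.one_le_fact
          have e1 : ((2 * ħ) ^ N.deg / N.fact * (A N * B N)) ^ 4 =
              C * C' * ((2 * ħ) ^ 4 * D * D' * 16) ^ N.deg * ((1 / 2 : ℝ) ^ N.deg) ^ 4 /
                (N.fact : ℝ) ^ 2 := by
            rw [mul_pow, mul_pow (A N), (hA N).2, (hB N).2, mul_pow _ 16, mul_pow _ D',
              mul_pow _ D, ← pow_mul (2 * ħ), mul_comm 4, pow_mul (2 * ħ)]
            field_simp
            linear_combination (-(C * C' * D ^ N.deg * D' ^ N.deg)) * h16
          rw [e1, div_le_iff₀ (by positivity), mul_pow k, hk]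
          have h3 := hKb N
          calc C * C' * ((2 * ħ) ^ 4 * D * D' * 16) ^ N.deg * ((1 / 2 : ℝ) ^ N.deg) ^ 4 ≤
              C * C' * (K * N.fact) * ((1 / 2 : ℝ) ^ N.deg) ^ 4 := by gcongr
            _ ≤ C * C' * (K * (N.fact : ℝ) ^ 2) * ((1 / 2 : ℝ) ^ N.deg) ^ 4 := by
                gcongr
                nlinarith
            _ = _ := by ring
  refine ne_top_of_le_ne_top ?_ (ENNReal.tsum_le_tsum hbound)
  rw [← ENNReal.ofReal_tsum_of_nonneg (fun _ => by positivity)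
    ((MI.summable_half_pow n).mul_left k)]
  exact ENNReal.ofReal_ne_top

theorem wickTerm_eq (hħ : 0 < ħ) (f g : WickAlg n ħ) (z : Fin n → ℂ) (N : MI n) :
    wickTerm ħ f g z N = taylorSum (((2 * (ħ : ℂ)) ^ N.deg / (N.fact : ℂ)) •
      arrMul (fun I J => f.coef (N + I) J) (fun I J => g.coef I (N + J))) z := by
  have hf := (f.wickArray_coef.entire hħ).shift N 0
  have hg := (g.wickArray_coef.entire hħ).shift 0 N
  simp only [add_zero, add_comm _ N] at hf hg
  rw [taylorSum_smul, taylorSum_arrMul hf hg, wickTerm, f.mixedD_apply hħ, g.mixedD_apply hħ]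
  simp only [add_zero, add_comm _ N]
  ring

theorem hasSum_wickTerm (hħ : 0 < ħ) (f g : WickAlg n ħ) (z : Fin n → ℂ) :
    HasSum (wickTerm ħ f g z) (taylorSum (arrStar ħ f.coef g.coef) z) := by
  have h := hasSum_taylorSum
    (fun ρ => arrNorm_wick_summable hħ f.wickArray_coef g.wickArray_coef ρ) z
  simp only [← wickTerm_eq hħ f g z] at h
  exact h

/-! ### The topology of `A_ħ` -/

theorem ENNReal_le_of_pow_le {x y : ℝ≥0∞} {k : ℕ} (hk : k ≠ 0) (h : x ^ k ≤ y ^ k) : x ≤ y :=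
  (ENNReal.pow_le_pow_left_iff hk).1 h

theorem wickSeminorm_le_iff (q : SIdx n) (f : WickAlg n ħ) {C : ℝ} (hC : 0 ≤ C) :
    wickSeminorm n ħ q f ≤ C ↔
      wickIter (wickBase ħ f.coef) q.1 q.2.1 q.2.2.1 q.2.2.2 ≤ ENNReal.ofReal C ^ 2 ^ (q.1 + 1) := by
  rw [← wickSeminorm_pow, ENNReal.pow_le_pow_left_iff (by positivity), ENNReal.ofReal_le_ofReal_iff hC]

theorem withSeminorms_wickSeminorm : WithSeminorms (wickSeminorm n ħ) := ⟨rfl⟩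

instance : IsTopologicalAddGroup (WickAlg n ħ) := withSeminorms_wickSeminorm.topologicalAddGroup

theorem WickAlg.coef_zero : (0 : WickAlg n ħ).coef = 0 := by
  have h := WickAlg.coef_smul (0 : ℂ) (0 : WickAlg n ħ)
  rwa [zero_smul, zero_smul] at h

theorem WickAlg.coef_sub (f g : WickAlg n ħ) : (f - g).coef = f.coef - g.coef := by
  rw [eq_sub_iff_add_eq, ← WickAlg.coef_add, sub_add_cancel]

/-- The term N = 0 of h_{0,0,R,S}. It yields continuity of the coefficients and separation of
points. -/
theorem WickAlg.norm_coef_le (hħ : 0 < ħ) (f : WickAlg n ħ) (R S : MI n) :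
    ‖f.coef R S‖ ≤ (√(2 * ħ) ^ (R.deg + S.deg))⁻¹ *
      wickSeminorm n ħ ⟨0, ⟨0, by simp⟩, R, S⟩ f := by
  have h := le_wickBase_zero ħ f.coef R S
  have h2 := wickSeminorm_pow ⟨0, ⟨0, by simp⟩, R, S⟩ f
  simp only [wickIter] at h2
  rw [← h2, ← ofReal_norm, ← ENNReal.ofReal_pow (by positivity), ← ENNReal.ofReal_pow (by positivity),
    ← ENNReal.ofReal_pow (apply_nonneg _ _), ← ENNReal.ofReal_mul (by positivity)] at h
  have h3 := (ENNReal.ofReal_le_ofReal_iff (by positivity)).1 h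
  rw [zero_add, pow_one] at h3
  have h4 : (2 * ħ) ^ (R.deg + S.deg) = (√(2 * ħ) ^ (R.deg + S.deg)) ^ 2 := by
    rw [← pow_mul, mul_comm (R.deg + S.deg), pow_mul, Real.sq_sqrt (by positivity)]
  rw [h4, ← mul_pow] at h3
  have h5 : √(2 * ħ) ^ (R.deg + S.deg) * ‖f.coef R S‖ ≤ wickSeminorm n ħ ⟨0, ⟨0, by simp⟩, R, S⟩ f :=
    le_of_sq_le_sq h3 (apply_nonneg _ _)
  rw [inv_mul_eq_div, le_div_iff₀' (by positivity)]
  exact h5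

/-- The Taylor coefficients are continuous functionals. -/
noncomputable def WickAlg.coefCLM (hħ : 0 < ħ) (R S : MI n) : WickAlg n ħ →L[ℂ] ℂ where
  toFun f := f.coef R S
  map_add' f g := by rw [WickAlg.coef_add]; rfl
  map_smul' c f := by rw [WickAlg.coef_smul]; rfl
  cont := by
    refine withSeminorms_wickSeminorm.continuous_normedSpace_rng ℂ
      ({ toFun := fun f => f.coef R S, map_add' := fun f g => by rw [WickAlg.coef_add]; rfl
         map_smul' := fun c f => by rw [WickAlg.coef_smul]; rfl } : WickAlg n ħ →ₗ[ℂ] ℂ)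
      ⟨{⟨0, ⟨0, by simp⟩, R, S⟩}, ⟨(√(2 * ħ) ^ (R.deg + S.deg))⁻¹, by positivity⟩, fun f => ?_⟩
    rw [Finset.sup_singleton]
    exact WickAlg.norm_coef_le hħ f R S

theorem WickAlg.coefCLM_apply (hħ : 0 < ħ) (R S : MI n) (f : WickAlg n ħ) :
    WickAlg.coefCLM hħ R S f = f.coef R S := rfl

theorem wickSeminorm_separating (hħ : 0 < ħ) (f : WickAlg n ħ) (h : ∀ q, wickSeminorm n ħ q f = 0) :
    f = 0 := by
  refine WickAlg.coef_injective ?_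
  rw [WickAlg.coef_zero]
  funext R S
  have h1 := WickAlg.norm_coef_le hħ f R S
  rw [h, mul_zero] at h1
  exact norm_le_zero_iff.1 h1

theorem WickAlg.t2Space (hħ : 0 < ħ) : T2Space (WickAlg n ħ) := by
  have : T1Space (WickAlg n ħ) := withSeminorms_wickSeminorm.T1_of_separating fun f hf => by
    by_contra! h
    exact hf (wickSeminorm_separating hħ f h)
  infer_instance

theorem WickAlg.tendsto_iff {ι : Type*} {F : Filter ι} {u : ι → WickAlg n ħ} {x : WickAlg n ħ} :
    Tendsto u F (𝓝 x) ↔ ∀ q : SIdx n, Tendsto (fun i =>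
      wickIter (wickBase ħ ((u i).coef - x.coef)) q.1 q.2.1 q.2.2.1 q.2.2.2) F (𝓝 0) := by
  rw [withSeminorms_wickSeminorm.tendsto_nhds]
  refine forall_congr' fun q => ?_
  simp only [← WickAlg.coef_sub, ← wickSeminorm_pow]
  constructor
  · intro h
    have h1 : Tendsto (fun i => wickSeminorm n ħ q (u i - x)) F (𝓝 0) := by
      rw [Metric.tendsto_nhds]
      intro ε hε
      filter_upwards [h ε hε] with i hi
      rwa [Real.dist_0_eq_abs, abs_of_nonneg (apply_nonneg _ _)]
    have h2 := ((ENNReal.continuous_pow (2 ^ (q.1 + 1))).tendsto _).comp (ENNReal.tendsto_ofReal h1)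
    simpa [Function.comp_def] using h2
  · intro h ε hε
    have h1 : (0 : ℝ≥0∞) < ENNReal.ofReal ε ^ 2 ^ (q.1 + 1) :=
      ENNReal.pow_pos (ENNReal.ofReal_pos.2 hε) _
    filter_upwards [h.eventually_lt_const h1] with i hi
    by_contra! hle
    exact absurd hi (not_lt.2 (by gcongr))

/-- Dominated convergence in `A_ħ`. -/
theorem WickAlg.tendsto_of_dominated {ι : Type*} {F : Filter ι} [F.IsCountablyGenerated]
    {u : ι → WickAlg n ħ} {x : WickAlg n ħ} {b : MI n → MI n → ℂ} (hb : WickArray ħ b)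
    (hub : ∀ i R S, ‖(u i).coef R S - x.coef R S‖ ≤ ‖b R S‖)
    (hu : ∀ R S, Tendsto (fun i => (u i).coef R S) F (𝓝 (x.coef R S))) : Tendsto u F (𝓝 x) := by
  rw [WickAlg.tendsto_iff]
  intro q
  refine wickIter_tendsto_zero (y := wickBase ħ b) (fun i => wickBase_mono (hub i)) hb ?_ q.2.1.2 _ _
  intro R S
  unfold wickBase
  refine ENNReal_tendsto_tsum_zero (y := fun N : MI n => ENNReal.ofReal (2 * ħ) ^
    (R.deg + S.deg + N.deg) / (N.fact : ℝ≥0∞) * ‖b R (N + S)‖ₑ ^ 2) ?_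
    (by simpa [wickIter, wickBase] using hb 0 0 (by simp) R S) ?_
  · intro i N
    gcongr
    exact enorm_le_iff_norm_le.2 (hub _ _ _)
  · intro N
    have h1 : Tendsto (fun i => (u i).coef R (N + S) - x.coef R (N + S)) F (𝓝 0) := by
      have := (hu R (N + S)).sub_const (x.coef R (N + S))
      rwa [sub_self] at this
    have h2 := ((ENNReal.continuous_pow 2).tendsto _).comp h1.enorm
    have h3 := ENNReal.Tendsto.const_mul (a := ENNReal.ofReal (2 * ħ) ^
      (R.deg + S.deg + N.deg) / (N.fact : ℝ≥0∞)) h2 (.inr (ENNReal.div_ne_top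
        (ENNReal.pow_ne_top ENNReal.ofReal_ne_top) (by exact_mod_cast N.fact_ne_zero)))
    simpa [Function.comp_def] using h3

/-! ### Fréchet spaces -/

/-- `IsFrechet` asks for a family indexed by ℕ; an infinite countable index set is in bijection with
it. -/
theorem IsFrechet.of_countable {E ι : Type*} [AddCommGroup E] [Module ℂ E] [TopologicalSpace E]
    [Countable ι] [Infinite ι] {P : SeminormFamily ℂ E ι} (hP : WithSeminorms P)
    (hsep : ∀ x, (∀ i, P i x = 0) → x = 0)
    (hcomp : ∀ u : ℕ → E, (∀ i, ∀ ε > (0 : ℝ), ∃ N, ∀ a ≥ N, ∀ b ≥ N, P i (u a - u b) < ε) →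
      ∃ x, Tendsto u atTop (𝓝 x)) : IsFrechet E := by
  obtain ⟨e⟩ := nonempty_equiv_of_countable (α := ℕ) (β := ι)
  refine ⟨P ∘ e, hP.congr_equiv e, fun x hx => hsep x fun i => ?_, fun u hu => hcomp u fun i => ?_⟩
  · simpa using hx (e.symm i)
  · simpa using hu (e.symm i)

theorem IsFrechet.of_continuousLinearEquiv {E F : Type*} [AddCommGroup E] [Module ℂ E]
    [TopologicalSpace E] [AddCommGroup F] [Module ℂ F] [TopologicalSpace F] (hE : IsFrechet E)
    (e : F ≃L[ℂ] E) : IsFrechet F := by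
  obtain ⟨P, hP, hsep, hcomp⟩ := hE
  have hi : IsInducing (e.toLinearEquiv : F →ₗ[ℂ] E) := e.toHomeomorph.isInducing
  refine ⟨P.comp (e.toLinearEquiv : F →ₗ[ℂ] E), hi.withSeminorms hP, fun x hx => ?_, fun u hu => ?_⟩
  · exact e.injective (by rw [map_zero]; exact hsep _ hx)
  · obtain ⟨x, hx⟩ := hcomp (fun k => e (u k)) fun i ε hε => by
      obtain ⟨N, hN⟩ := hu i ε hε
      refine ⟨N, fun a ha b hb => ?_⟩
      have := hN a ha b hb
      rw [SeminormFamily.comp_apply, Seminorm.comp_apply, map_sub] at this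
      exact this
    refine ⟨e.symm x, ?_⟩
    have h := (e.symm.continuous.tendsto x).comp hx
    simpa [Function.comp_def] using h

theorem IsFrechet.of_isClosed {E : Type*} [AddCommGroup E] [Module ℂ E] [TopologicalSpace E]
    (hE : IsFrechet E) (p : Submodule ℂ E) (hp : IsClosed (p : Set E)) : IsFrechet p := by
  obtain ⟨P, hP, hsep, hcomp⟩ := hE
  have hi : IsInducing p.subtype := IsInducing.subtypeVal
  refine ⟨P.comp p.subtype, hi.withSeminorms hP, fun x hx => ?_, fun u hu => ?_⟩
  · exact Subtype.ext (hsep _ hx)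
  · obtain ⟨x, hx⟩ := hcomp (fun k => (u k : E)) hu
    have hxp : x ∈ p := hp.mem_of_tendsto hx (Eventually.of_forall fun k => (u k).2)
    exact ⟨⟨x, hxp⟩, tendsto_subtype_rng.2 hx⟩

instance : Infinite (SIdx n) :=
  Infinite.of_injective (fun m : ℕ => (⟨m, ⟨0, by positivity⟩, 0, 0⟩ : SIdx n)) fun a b h => by
    simpa using congrArg Sigma.fst h

/-- A Cauchy sequence converges coefficientwise. Lower semicontinuity shows that the limiting array
is admissible and that the sequence converges to it in every seminorm. -/
theorem WickAlg.isFrechet (hħ : 0 < ħ) : IsFrechet (WickAlg n ħ) := by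
  refine IsFrechet.of_countable withSeminorms_wickSeminorm (wickSeminorm_separating hħ) fun u hu => ?_
  have hcau : ∀ R S, CauchySeq fun k => (u k).coef R S := by
    intro R S
    rw [Metric.cauchySeq_iff]
    intro ε hε
    have hs : 0 < √(2 * ħ) ^ (R.deg + S.deg) := by positivity
    obtain ⟨N, hN⟩ := hu ⟨0, ⟨0, by simp⟩, R, S⟩ (√(2 * ħ) ^ (R.deg + S.deg) * ε) (by positivity)
    refine ⟨N, fun a ha b hb => ?_⟩
    have h1 := WickAlg.norm_coef_le hħ (u a - u b) R S
    rw [WickAlg.coef_sub] at h1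
    rw [dist_eq_norm]
    refine h1.trans_lt ?_
    rw [inv_mul_eq_div, div_lt_iff₀' hs]
    exact hN a ha b hb
  choose a ha using fun R S => cauchySeq_tendsto_of_complete (hcau R S)
  have ha' : Tendsto (fun k => (u k).coef) atTop (𝓝 a) :=
    tendsto_pi_nhds.2 fun R => tendsto_pi_nhds.2 fun S => ha R S
  have key : ∀ (q : SIdx n) (ε : ℝ), 0 < ε → ∃ N, ∀ k ≥ N,
      wickIter (wickBase ħ ((u k).coef - a)) q.1 q.2.1 q.2.2.1 q.2.2.2 ≤
        ENNReal.ofReal ε ^ 2 ^ (q.1 + 1) := by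
    intro q ε hε
    obtain ⟨N, hN⟩ := hu q ε hε
    refine ⟨N, fun k hk => ?_⟩
    have hcl := (lowerSemicontinuous_wickIter_wickBase (n := n) ħ q.1 q.2.1 q.2.2.1
      q.2.2.2).isClosed_preimage (ENNReal.ofReal ε ^ 2 ^ (q.1 + 1))
    refine hcl.mem_of_tendsto (tendsto_const_nhds.sub ha' : Tendsto
      (fun j => (u k).coef - (u j).coef) atTop (𝓝 ((u k).coef - a))) ?_
    filter_upwards [eventually_ge_atTop N] with j hj
    have h1 := (wickSeminorm_le_iff q (u k - u j) hε.le).1 (hN k hk j hj).le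
    rwa [WickAlg.coef_sub] at h1
  -- From some N on, the seminorms of the sequence are bounded by 1 plus that of the N-th member,
  -- and this bound passes to the limit.
  have hbd : WickArray ħ a := by
    intro m l hl R S
    obtain ⟨N, hN⟩ := hu ⟨m, ⟨l, hl⟩, R, S⟩ 1 one_pos
    have hcl := (lowerSemicontinuous_wickIter_wickBase (n := n) ħ m l R S).isClosed_preimage
      (ENNReal.ofReal (1 + wickSeminorm n ħ ⟨m, ⟨l, hl⟩, R, S⟩ (u N)) ^ 2 ^ (m + 1))
    refine ne_top_of_le_ne_top (ENNReal.pow_ne_top ENNReal.ofReal_ne_top)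
      (hcl.mem_of_tendsto ha' ?_)
    filter_upwards [eventually_ge_atTop N] with j hj
    refine (wickSeminorm_le_iff ⟨m, ⟨l, hl⟩, R, S⟩ (u j) (by positivity)).1 ?_
    have h1 := map_add_le_add (wickSeminorm n ħ ⟨m, ⟨l, hl⟩, R, S⟩) (u j - u N) (u N)
    rw [sub_add_cancel] at h1
    linarith [hN j hj N le_rfl]
  refine ⟨WickAlg.ofArray hħ a hbd, (withSeminorms_wickSeminorm.tendsto_nhds_atTop _ _).2
    fun q ε hε => ?_⟩
  obtain ⟨N, hN⟩ := key q (ε / 2) (half_pos hε)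
  refine ⟨N, fun k hk => lt_of_le_of_lt ?_ (half_lt_self hε)⟩
  rw [wickSeminorm_le_iff _ _ (half_pos hε).le, WickAlg.coef_sub, WickAlg.coef_ofArray]
  exact hN k hk

/-! ### Conjugation and the Wick product on `A_ħ` -/

theorem WickAlg.ext_apply {f g : WickAlg n ħ} (h : ∀ z, f z = g z) : f = g :=
  Subtype.ext (funext h)

/-- Complex conjugation on `A_ħ`. -/
noncomputable def WickAlg.conj (hħ : 0 < ħ) (f : WickAlg n ħ) : WickAlg n ħ :=
  .ofArray hħ (arrConj f.coef) f.wickArray_coef.conj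

theorem WickAlg.conj_apply (hħ : 0 < ħ) (f : WickAlg n ħ) (z : Fin n → ℂ) :
    f.conj hħ z = (starRingEnd ℂ) (f z) := by
  have h := congrFun (conjFun_taylorSum f.coef) z
  rw [← f.coe_eq_taylorSum hħ] at h
  exact h.symm

theorem WickAlg.mixedD_linear_add (f g : WickAlg n ħ) (R S : MI n) (z : Fin n → ℂ) :
    mixedD R S (f + g : WickAlg n ħ) z = mixedD R S f z + mixedD R S g z :=
  congrFun ((smoothLinear_mixedD R S).2.1 _ _ f.contDiff g.contDiff) z

theorem WickAlg.mixedD_linear_smul (c : ℂ) (f : WickAlg n ħ) (R S : MI n) (z : Fin n → ℂ) :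
    mixedD R S (c • f : WickAlg n ħ) z = c * mixedD R S f z :=
  congrFun ((smoothLinear_mixedD R S).2.2 c _ f.contDiff) z

theorem wickTerm_add_left (f f' g : WickAlg n ħ) (z : Fin n → ℂ) :
    wickTerm ħ (f + f' : WickAlg n ħ) g z = wickTerm ħ f g z + wickTerm ħ f' g z := by
  funext N
  simp only [wickTerm, WickAlg.mixedD_linear_add, Pi.add_apply]
  ring

theorem wickTerm_add_right (f g g' : WickAlg n ħ) (z : Fin n → ℂ) :
    wickTerm ħ f (g + g' : WickAlg n ħ) z = wickTerm ħ f g z + wickTerm ħ f g' z := by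
  funext N
  simp only [wickTerm, WickAlg.mixedD_linear_add, Pi.add_apply]
  ring

theorem wickTerm_smul_left (c : ℂ) (f g : WickAlg n ħ) (z : Fin n → ℂ) :
    wickTerm ħ (c • f : WickAlg n ħ) g z = fun N => c * wickTerm ħ f g z N := by
  funext N
  simp only [wickTerm, WickAlg.mixedD_linear_smul]
  ring

theorem wickTerm_smul_right (c : ℂ) (f g : WickAlg n ħ) (z : Fin n → ℂ) :
    wickTerm ħ f (c • g : WickAlg n ħ) z = fun N => c * wickTerm ħ f g z N := by
  funext N
  simp only [wickTerm, WickAlg.mixedD_linear_smul]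
  ring

/-- The Wick product of two elements of `A_ħ`. -/
noncomputable def WickAlg.mulAux (hħ : 0 < ħ) (f g : WickAlg n ħ) : WickAlg n ħ :=
  .ofArray hħ (arrStar ħ f.coef g.coef) (f.wickArray_coef.star hħ g.wickArray_coef)

theorem WickAlg.hasSum_mulAux (hħ : 0 < ħ) (f g : WickAlg n ħ) (z : Fin n → ℂ) :
    HasSum (wickTerm ħ f g z) (WickAlg.mulAux hħ f g z) := hasSum_wickTerm hħ f g z

/-- The Wick product as a bilinear map. -/
noncomputable def WickAlg.star (hħ : 0 < ħ) :
    WickAlg n ħ →ₗ[ℂ] WickAlg n ħ →ₗ[ℂ] WickAlg n ħ :=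
  LinearMap.mk₂ ℂ (WickAlg.mulAux hħ)
    (fun f f' g => WickAlg.ext_apply fun z => (WickAlg.hasSum_mulAux hħ _ _ z).unique (by
      rw [wickTerm_add_left]
      exact (WickAlg.hasSum_mulAux hħ f g z).add (WickAlg.hasSum_mulAux hħ f' g z)))
    (fun c f g => WickAlg.ext_apply fun z => (WickAlg.hasSum_mulAux hħ _ _ z).unique (by
      rw [wickTerm_smul_left]
      exact (WickAlg.hasSum_mulAux hħ f g z).mul_left c))
    (fun f g g' => WickAlg.ext_apply fun z => (WickAlg.hasSum_mulAux hħ _ _ z).unique (by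
      rw [wickTerm_add_right]
      exact (WickAlg.hasSum_mulAux hħ f g z).add (WickAlg.hasSum_mulAux hħ f g' z)))
    (fun c f g => WickAlg.ext_apply fun z => (WickAlg.hasSum_mulAux hħ _ _ z).unique (by
      rw [wickTerm_smul_right]
      exact (WickAlg.hasSum_mulAux hħ f g z).mul_left c))

theorem WickAlg.hasSum_star (hħ : 0 < ħ) (f g : WickAlg n ħ) (z : Fin n → ℂ) :
    HasSum (wickTerm ħ f g z) (WickAlg.star hħ f g z) := WickAlg.hasSum_mulAux hħ f g z

theorem WickAlg.coef_star (hħ : 0 < ħ) (f g : WickAlg n ħ) :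
    (WickAlg.star hħ f g).coef = arrStar ħ f.coef g.coef :=
  WickAlg.coef_ofArray hħ _ (f.wickArray_coef.star hħ g.wickArray_coef)

/-- The square of the quantity of level m is the seminorm to the power 2^{m+2}, exactly the exponent
of level m + 1; after taking roots the estimate is bilinear. -/
theorem wickSeminorm_star_le (hħ : 0 < ħ) (q : SIdx n) (f g : WickAlg n ħ) :
    wickSeminorm n ħ q (WickAlg.star hħ f g) ≤
      wickSeminorm n ħ ⟨q.1 + 1, ⟨q.2.1 + 2 ^ q.1, add_lt_two_pow_succ_of_lt q.2.1.2⟩, q.2.2⟩ (f.conj hħ) *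
      wickSeminorm n ħ ⟨q.1 + 1, ⟨q.2.1, lt_two_pow_succ_of_lt q.2.1.2⟩, q.2.2⟩ g := by
  have h := wickIter_arrStar_sq_le hħ f.coef g.coef q.2.1.2 q.2.2.1 q.2.2.2
  have h1 := wickSeminorm_pow ⟨q.1 + 1, ⟨q.2.1 + 2 ^ q.1, add_lt_two_pow_succ_of_lt q.2.1.2⟩, q.2.2⟩
    (f.conj hħ)
  have h2 := wickSeminorm_pow ⟨q.1 + 1, ⟨q.2.1, lt_two_pow_succ_of_lt q.2.1.2⟩, q.2.2⟩ g
  have h3 := wickSeminorm_pow q (WickAlg.star hħ f g)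
  rw [WickAlg.coef_star] at h3
  rw [WickAlg.conj, WickAlg.coef_ofArray] at h1
  simp only at h1 h2
  rw [← h1, ← h2, ← h3, ← pow_mul, ← pow_succ, ← mul_pow, ENNReal.pow_le_pow_left_iff (by positivity),
    ← ENNReal.ofReal_mul (apply_nonneg _ _), ENNReal.ofReal_le_ofReal_iff (by positivity)] at h
  exact h

theorem exists_wickSeminorm_conj_le (hħ : 0 < ħ) (q : SIdx n) : ∃ (C : ℝ) (q' : SIdx n), 0 ≤ C ∧
    ∀ f : WickAlg n ħ, wickSeminorm n ħ q (f.conj hħ) ≤ C * wickSeminorm n ħ q' f := by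
  set K := wickIter (fun _ _ => ∑' N : MI n, (N.fact : ℝ≥0∞)⁻¹) q.1 q.2.1 q.2.2.1 q.2.2.2
  have hK : K ≠ ⊤ := wickIter_fact_inv_ne_top _ _ _ _
  refine ⟨K.toReal + 1, ⟨q.1 + 1, ⟨q.2.1 + 2 ^ q.1, add_lt_two_pow_succ_of_lt q.2.1.2⟩, q.2.2⟩,
    by positivity, fun f => ?_⟩
  have h := WickArray.wickIter_conj_sq_le (ħ := ħ) f.coef q.2.1.2 q.2.2.1 q.2.2.2
  have h1 := wickSeminorm_pow
    ⟨q.1 + 1, ⟨q.2.1 + 2 ^ q.1, add_lt_two_pow_succ_of_lt q.2.1.2⟩, q.2.2⟩ f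
  have h3 := wickSeminorm_pow q (f.conj hħ)
  rw [WickAlg.conj, WickAlg.coef_ofArray] at h3
  simp only at h1
  -- A number that is at least 1 is dominated by its powers; this spares taking a root of the
  -- constant.
  have hK2 : K ≤ ENNReal.ofReal (K.toReal + 1) ^ 2 ^ (q.1 + 1 + 1) := by
    calc K = ENNReal.ofReal K.toReal := (ENNReal.ofReal_toReal hK).symm
      _ ≤ ENNReal.ofReal (K.toReal + 1) := ENNReal.ofReal_le_ofReal (by linarith)
      _ ≤ _ := le_self_pow₀ (by
        rw [← ENNReal.ofReal_one]
        exact ENNReal.ofReal_le_ofReal (by linarith [ENNReal.toReal_nonneg (a := K)])) (by positivity)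
  rw [← h1, ← h3, ← pow_mul, ← pow_succ] at h
  replace h := h.trans (mul_le_mul_left hK2 _)
  rw [← mul_pow, ENNReal.pow_le_pow_left_iff (by positivity),
    ← ENNReal.ofReal_mul (by positivity), ENNReal.ofReal_le_ofReal_iff (by positivity)] at h
  exact h

theorem continuous_star (hħ : 0 < ħ) :
    Continuous fun p : WickAlg n ħ × WickAlg n ħ => WickAlg.star hħ p.1 p.2 := by
  have hc : ∀ q, Continuous (wickSeminorm n ħ q) := withSeminorms_wickSeminorm.continuous_seminorm
  -- Continuity of a biadditive map need only be tested at (0, 0) and, in each variable separately,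
  -- at 0. Arbitrary filters treat the three cases at once.
  have key : ∀ (F : Filter (WickAlg n ħ × WickAlg n ħ)) (f g : WickAlg n ħ),
      Tendsto Prod.fst F (𝓝 f) → Tendsto Prod.snd F (𝓝 g) → f = 0 ∨ g = 0 →
      Tendsto (fun p => WickAlg.star hħ p.1 p.2) F (𝓝 0) := by
    intro F f g hf hg hfg
    rw [withSeminorms_wickSeminorm.tendsto_nhds]
    intro q ε hε
    set q1 : SIdx n := ⟨q.1 + 1, ⟨q.2.1 + 2 ^ q.1, add_lt_two_pow_succ_of_lt q.2.1.2⟩, q.2.2⟩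
    set q2 : SIdx n := ⟨q.1 + 1, ⟨q.2.1, lt_two_pow_succ_of_lt q.2.1.2⟩, q.2.2⟩
    obtain ⟨C, q3, hC, h⟩ := exists_wickSeminorm_conj_le hħ q1
    have ht : Tendsto (fun p : WickAlg n ħ × WickAlg n ħ =>
        C * wickSeminorm n ħ q3 p.1 * wickSeminorm n ħ q2 p.2) F (𝓝 0) := by
      have h0 : C * wickSeminorm n ħ q3 f * wickSeminorm n ħ q2 g = 0 := by
        rcases hfg with rfl | rfl <;> simp
      rw [← h0]
      exact ((((hc q3).tendsto f).comp hf).const_mul C).mul (((hc q2).tendsto g).comp hg)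
    filter_upwards [ht.eventually_lt_const hε] with p hp
    rw [sub_zero]
    refine (wickSeminorm_star_le hħ q p.1 p.2).trans_lt (lt_of_le_of_lt ?_ hp)
    exact mul_le_mul_of_nonneg_right (h p.1) (apply_nonneg _ _)
  refine continuous_of_continuousAt_zero₂ (AddMonoidHom.mk'
    (fun f => (WickAlg.star hħ f).toAddMonoidHom) fun f g => by ext1 x; simp) ?_ ?_ ?_
  · have := key (𝓝 0) 0 0 (continuous_fst.tendsto 0) (continuous_snd.tendsto 0) (.inl rfl)
    simpa [ContinuousAt, Prod.zero_eq_mk] using this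
  · intro f
    have := (key (map (fun g => (f, g)) (𝓝 0)) f 0 (tendsto_map'_iff.2 tendsto_const_nhds)
      (tendsto_map'_iff.2 tendsto_id) (.inr rfl))
    rw [tendsto_map'_iff] at this
    simpa [ContinuousAt, Function.comp_def] using this
  · intro g
    have := (key (map (fun f => (f, g)) (𝓝 0)) 0 g (tendsto_map'_iff.2 tendsto_id)
      (tendsto_map'_iff.2 tendsto_const_nhds) (.inl rfl))
    rw [tendsto_map'_iff] at this
    simpa [ContinuousAt, Function.comp_def] using this

/-! ### The `z̄`-Taylor expansion at the origin -/

/-- The part of an array with first index `0`. -/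
def antiPart (a : MI n → MI n → ℂ) (R S : MI n) : ℂ := if R = 0 then a 0 S else 0

theorem norm_antiPart_le (a : MI n → MI n → ℂ) (R S : MI n) : ‖antiPart a R S‖ ≤ ‖a R S‖ := by
  unfold antiPart
  split_ifs with h
  · rw [h]
  · rw [norm_zero]
    exact norm_nonneg _

theorem antiPart_antiPart (a : MI n → MI n → ℂ) : antiPart (antiPart a) = antiPart a := by
  funext R S
  simp [antiPart]

/-- The seminorms see only absolute values of Taylor coefficients, and see them monotonically.
Contractivity of Ψ is an instance. -/
theorem wickSeminorm_le_of_norm_coef_le {f g : WickAlg n ħ}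
    (h : ∀ R S, ‖f.coef R S‖ ≤ ‖g.coef R S‖) (q : SIdx n) :
    wickSeminorm n ħ q f ≤ wickSeminorm n ħ q g := by
  rw [wickSeminorm_le_iff q f (apply_nonneg _ _), wickSeminorm_pow]
  exact wickIter_mono (wickBase_mono h) _ _ _ _

/-- The `z̄`-Taylor expansion at the origin as a linear map. -/
noncomputable def WickAlg.psiAux (hħ : 0 < ħ) : WickAlg n ħ →ₗ[ℂ] WickAlg n ħ where
  toFun f := .ofArray hħ (antiPart f.coef) (f.wickArray_coef.mono (norm_antiPart_le _))
  map_add' f g := WickAlg.coef_injective (by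
    simp only [WickAlg.coef_ofArray, WickAlg.coef_add]
    funext R S
    by_cases h : R = 0 <;> simp [antiPart, h])
  map_smul' c f := WickAlg.coef_injective (by
    simp only [RingHom.id_apply, WickAlg.coef_ofArray, WickAlg.coef_smul]
    funext R S
    by_cases h : R = 0 <;> simp [antiPart, h])

theorem WickAlg.coef_psiAux (hħ : 0 < ħ) (f : WickAlg n ħ) :
    (WickAlg.psiAux hħ f).coef = antiPart f.coef :=
  WickAlg.coef_ofArray hħ _ (f.wickArray_coef.mono (norm_antiPart_le _))

theorem wickSeminorm_psiAux_le (hħ : 0 < ħ) (q : SIdx n) (f : WickAlg n ħ) :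
    wickSeminorm n ħ q (WickAlg.psiAux hħ f) ≤ wickSeminorm n ħ q f :=
  wickSeminorm_le_of_norm_coef_le (fun R S => by
    rw [WickAlg.coef_psiAux]
    exact norm_antiPart_le _ _ _) q

/-- The continuous projection `Ψ` of `A_ħ`. -/
noncomputable def WickAlg.psi (hħ : 0 < ħ) : WickAlg n ħ →L[ℂ] WickAlg n ħ where
  toLinearMap := WickAlg.psiAux hħ
  cont := WithSeminorms.continuous_of_isBounded withSeminorms_wickSeminorm withSeminorms_wickSeminorm
    _ fun q => ⟨{q}, 1, fun f => by simpa using wickSeminorm_psiAux_le hħ q f⟩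

theorem WickAlg.coef_psi (hħ : 0 < ħ) (f : WickAlg n ħ) :
    (WickAlg.psi hħ f).coef = antiPart f.coef := WickAlg.coef_psiAux hħ f

theorem WickAlg.psi_eq_self_iff (hħ : 0 < ħ) (f : WickAlg n ħ) :
    WickAlg.psi hħ f = f ↔ ∀ R S, R ≠ 0 → f.coef R S = 0 := by
  constructor
  · intro h R S hR
    rw [← h, WickAlg.coef_psi, antiPart, if_neg hR]
  · intro h
    refine WickAlg.coef_injective ?_
    funext R S
    rw [WickAlg.coef_psi, antiPart]
    split_ifs with hR
    · rw [hR]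
    · exact (h R S hR).symm

theorem WickAlg.psi_psi (hħ : 0 < ħ) (f : WickAlg n ħ) :
    WickAlg.psi hħ (WickAlg.psi hħ f) = WickAlg.psi hħ f :=
  WickAlg.coef_injective (by rw [WickAlg.coef_psi, WickAlg.coef_psi, antiPart_antiPart])

theorem WickAlg.mem_range_psi_iff (hħ : 0 < ħ) (f : WickAlg n ħ) :
    f ∈ LinearMap.range (WickAlg.psi (n := n) hħ).toLinearMap ↔ WickAlg.psi hħ f = f := by
  constructor
  · rintro ⟨g, rfl⟩
    exact WickAlg.psi_psi hħ g
  · intro h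
    exact ⟨f, h⟩

theorem WickAlg.ker_psi (hħ : 0 < ħ) :
    LinearMap.ker (WickAlg.psi (n := n) hħ).toLinearMap = gelfandIdeal n ħ hħ := by
  ext f
  rw [mem_gelfandIdeal_iff, LinearMap.mem_ker]
  change WickAlg.psi hħ f = 0 ↔ ∀ N, f.coef 0 N = 0
  rw [← WickAlg.coef_injective.eq_iff, WickAlg.coef_psi, WickAlg.coef_zero]
  constructor
  · intro h N
    have := congrFun (congrFun h 0) N
    simpa [antiPart] using this
  · intro h
    funext R S
    by_cases hR : R = 0 <;> simp [antiPart, hR, h]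

theorem WickAlg.hasSum_psi (hħ : 0 < ħ) (f : WickAlg n ħ) (z : Fin n → ℂ) :
    HasSum (fun I : MI n => mixedD 0 I f 0 / (I.fact : ℂ) * zbarPow I z) (WickAlg.psi hħ f z) := by
  have h := ((WickAlg.psi hħ f).wickArray_coef.entire hħ).hasSum z
  rw [← WickAlg.coe_eq_taylorSum hħ] at h
  have hinj : Function.Injective fun I : MI n => ((0 : MI n), I) := fun I J h => (Prod.ext_iff.1 h).2
  rw [← hinj.hasSum_iff] at h
  · convert h using 1
    funext I
    have hz : zPow (0 : MI n) z = 1 := by simp [zPow]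
    simp only [Function.comp_apply, serCoef, WickAlg.coef_psi, antiPart, if_true, monom, hz, one_mul,
      MI.fact_zero, Nat.cast_one]
    rfl
  · rintro ⟨R, S⟩ hRS
    have hR : R ≠ 0 := by
      rintro rfl
      exact hRS ⟨S, rfl⟩
    simp [serCoef, WickAlg.coef_psi, antiPart, hR]

/-! ### Antiholomorphic elements -/

theorem dzbar_conjFun (k : Fin n) (f : (Fin n → ℂ) → ℂ) :
    dzbar k (conjFun f) = conjFun (dz k f) := by
  have h := dz_conj k (conjFun f)
  rw [conjFun_conjFun] at h
  rw [h, conjFun_conjFun]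

theorem dzbar_eq_zero_of_differentiable {g : (Fin n → ℂ) → ℂ} (hg : Differentiable ℂ g) (k : Fin n) :
    dzbar k g = 0 := by
  funext x
  have h1 : fderiv ℝ g x = (fderiv ℂ g x).restrictScalars ℝ :=
    ((hg x).hasFDerivAt.restrictScalars ℝ).fderiv
  have h2 : (Pi.single k I : Fin n → ℂ) = I • Pi.single k 1 := by
    rw [← Pi.single_smul, smul_eq_mul, mul_one]
  rw [dzbar, h1, h2, ContinuousLinearMap.coe_restrictScalars', map_smul, smul_eq_mul, ← mul_assoc,
    I_mul_I]
  simp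

theorem differentiable_of_dzbar_eq_zero {g : (Fin n → ℂ) → ℂ} (hg : Differentiable ℝ g)
    (h : ∀ k, dzbar k g = 0) : Differentiable ℂ g := by
  intro x
  set L : (Fin n → ℂ) →L[ℂ] ℂ := ∑ k, dz k g x • ContinuousLinearMap.proj k with hL
  have e : L.restrictScalars ℝ = fderiv ℝ g x := by
    ext1 w
    rw [fderiv_eq_sum_wirtinger g x w]
    simp [hL, h, mul_comm]
  exact (hasFDerivAt_of_restrictScalars ℝ (hg x).hasFDerivAt e).differentiableAt

theorem isAntiholomorphic_iff_dz {f : (Fin n → ℂ) → ℂ} (hf : Differentiable ℝ f) :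
    IsAntiholomorphic f ↔ ∀ k, dz k f = 0 := by
  have h0 : conjFun (0 : (Fin n → ℂ) → ℂ) = 0 := by
    funext z
    simp [conjFun]
  constructor
  · intro h k
    have h1 := dz_conj k (conjFun f)
    rwa [conjFun_conjFun, dzbar_eq_zero_of_differentiable h, h0] at h1
  · intro h
    refine differentiable_of_dzbar_eq_zero (conjCLE.differentiable.comp hf) fun k => ?_
    rw [dzbar_conjFun, h k, h0]

theorem exists_eq_add_single {R : MI n} (hR : R ≠ 0) : ∃ (Q : MI n) (k : Fin n), R = Q + Pi.single k 1 := by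
  obtain ⟨k, hk⟩ := Function.ne_iff.1 hR
  refine ⟨R - Pi.single k 1, k, (tsub_add_cancel_of_le fun j => ?_).symm⟩
  by_cases hj : j = k
  · subst hj
    simpa using Nat.one_le_iff_ne_zero.2 hk
  · simp [hj]

theorem mixedD_zero_fun (R S : MI n) : mixedD R S (0 : (Fin n → ℂ) → ℂ) = 0 := by
  have := (smoothLinear_mixedD R S).2.2 (0 : ℂ) (0 : (Fin n → ℂ) → ℂ) contDiff_const
  rwa [zero_smul, zero_smul] at this

theorem mixedD_eq_zero_of_dz_eq_zero {f : (Fin n → ℂ) → ℂ} (hf : ContDiff ℝ ∞ f)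
    (h : ∀ k, dz k f = 0) {R : MI n} (hR : R ≠ 0) (S : MI n) : mixedD R S f = 0 := by
  obtain ⟨Q, k, rfl⟩ := exists_eq_add_single hR
  rw [← mixedD_dz _ _ _ hf, h k, mixedD_zero_fun]

theorem mixedD_eq_zero_of_dzbar_eq_zero {f : (Fin n → ℂ) → ℂ} (hf : ContDiff ℝ ∞ f)
    (h : ∀ k, dzbar k f = 0) (R : MI n) {S : MI n} (hS : S ≠ 0) : mixedD R S f = 0 := by
  obtain ⟨Q, k, rfl⟩ := exists_eq_add_single hS
  rw [← mixedD_dzbar _ _ _ hf, h k, mixedD_zero_fun]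

theorem WickAlg.isAntiholomorphic_iff (hħ : 0 < ħ) (f : WickAlg n ħ) :
    IsAntiholomorphic f ↔ WickAlg.psi hħ f = f := by
  rw [isAntiholomorphic_iff_dz (f.contDiff.differentiable (by simp)), WickAlg.psi_eq_self_iff]
  constructor
  · intro h R S hR
    exact congrFun (mixedD_eq_zero_of_dz_eq_zero f.contDiff h hR S) 0
  · intro h k
    have h1 := mixedD_dz 0 0 k f.contDiff
    have h2 : mixedD (0 : MI n) 0 (dz k f) = dz k f := by simp [mixedD, iterD_zero]
    funext z
    rw [← h2, h1, f.mixedD_apply hħ]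
    have h3 : (fun R S : MI n => f.coef (R + (0 + Pi.single k 1)) (S + 0)) = fun _ _ => 0 := by
      funext R S
      refine h _ _ fun h4 => ?_
      have := congrFun h4 k
      simp at this
    rw [h3]
    simp [taylorSum, serCoef]

/-- For R ≠ 0 the seminorm with m = 0 and indices R, S vanishes on Ψ_f but dominates the coefficient
a(R,S) of f. Equality therefore forces all these coefficients to be 0. -/
theorem WickAlg.wickSeminorm_psi_eq_iff (hħ : 0 < ħ) (f : WickAlg n ħ) :
    (∀ q, wickSeminorm n ħ q (WickAlg.psi hħ f) = wickSeminorm n ħ q f) ↔ IsAntiholomorphic f := by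
  rw [WickAlg.isAntiholomorphic_iff hħ]
  constructor
  · intro h
    rw [WickAlg.psi_eq_self_iff]
    intro R S hR
    have h1 := wickSeminorm_pow ⟨0, ⟨0, by simp⟩, R, S⟩ (WickAlg.psi hħ f)
    rw [WickAlg.coef_psi] at h1
    have h2 : wickBase ħ (antiPart f.coef) R S = 0 := by simp [wickBase, antiPart, hR]
    simp only [wickIter, h2] at h1
    have h3 : wickSeminorm n ħ ⟨0, ⟨0, by simp⟩, R, S⟩ (WickAlg.psi hħ f) ≤ 0 := by
      rw [← ENNReal.ofReal_eq_zero]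
      exact (pow_eq_zero_iff (by simp)).1 h1
    have h4 := WickAlg.norm_coef_le hħ f R S
    rw [← h] at h4
    refine norm_le_zero_iff.1 (h4.trans ?_)
    exact mul_nonpos_of_nonneg_of_nonpos (by positivity) h3
  · intro h q
    rw [h]

/-! ### The GNS space -/

/-- The range of a continuous projection of a Hausdorff space is its set of fixed points. -/
theorem WickAlg.isClosed_range_psi (hħ : 0 < ħ) :
    IsClosed (LinearMap.range (WickAlg.psi (n := n) hħ).toLinearMap : Set (WickAlg n ħ)) := by
  have := WickAlg.t2Space (n := n) hħ
  have e : (LinearMap.range (WickAlg.psi (n := n) hħ).toLinearMap : Set (WickAlg n ħ)) =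
      {f | WickAlg.psi hħ f = f} := Set.ext fun f => WickAlg.mem_range_psi_iff hħ f
  rw [e]
  exact isClosed_eq (WickAlg.psi hħ).continuous continuous_id

theorem WickAlg.psi_eq_psi_iff (hħ : 0 < ħ) (f g : WickAlg n ħ) :
    WickAlg.psi hħ f = WickAlg.psi hħ g ↔ gnsClass hħ f = gnsClass hħ g := by
  rw [gnsClass, gnsClass, Submodule.mkQ_apply, Submodule.mkQ_apply, Submodule.Quotient.eq,
    ← WickAlg.ker_psi, LinearMap.mem_ker]
  change _ ↔ WickAlg.psi hħ (f - g) = 0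
  rw [map_sub, sub_eq_zero]

/-- The identification of the GNS space with the range of `Ψ`. -/
noncomputable def WickAlg.gnsEquiv (hħ : 0 < ħ) :
    GNSSpace n ħ hħ ≃L[ℂ] LinearMap.range (WickAlg.psi (n := n) hħ).toLinearMap where
  toFun := (gelfandIdeal n ħ hħ).liftQ (WickAlg.psi hħ).toLinearMap.rangeRestrict
    (by rw [LinearMap.ker_rangeRestrict, WickAlg.ker_psi])
  map_add' := map_add _
  map_smul' := map_smul _
  invFun d := gnsClass hħ d
  left_inv x := by
    obtain ⟨f, rfl⟩ := Submodule.mkQ_surjective _ x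
    exact (WickAlg.psi_eq_psi_iff hħ _ _).1 (WickAlg.psi_psi hħ f)
  right_inv d := Subtype.ext ((WickAlg.mem_range_psi_iff hħ _).1 d.2)
  continuous_toFun := by
    refine continuous_coinduced_dom.2 ?_
    exact (WickAlg.psi hħ).continuous.subtype_mk _
  continuous_invFun := continuous_coinduced_rng.comp continuous_subtype_val

theorem WickAlg.gnsEquiv_apply (hħ : 0 < ħ) (f : WickAlg n ħ) :
    (WickAlg.gnsEquiv hħ (gnsClass hħ f) : WickAlg n ħ) = WickAlg.psi hħ f := rfl

/-- Ψ_f is itself a representative, and every representative g satisfies ‖Ψ_f‖ = ‖Ψ_g‖ ≤ ‖g‖, so the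
infimum is attained at Ψ_f. -/
theorem gnsSeminorm_gnsClass (hħ : 0 < ħ) (q : SIdx n) (f : WickAlg n ħ) :
    gnsSeminorm hħ q (gnsClass hħ f) = wickSeminorm n ħ q (WickAlg.psi hħ f) := by
  refine IsLeast.csInf_eq ⟨⟨_, (WickAlg.psi_eq_psi_iff hħ _ _).1 (WickAlg.psi_psi hħ f), rfl⟩, ?_⟩
  rintro _ ⟨g, hg, rfl⟩
  rw [← (WickAlg.psi_eq_psi_iff hħ g f).2 hg]
  exact wickSeminorm_psiAux_le hħ q g

/-! ### Decomposition of an element into parts of its Taylor series -/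

open Classical in
/-- The part of an array supported on a fibre of `κ`. -/
noncomputable def arrFibre {ι : Type*} (κ : MI n → MI n → ι) (i : ι) (a : MI n → MI n → ℂ)
    (R S : MI n) : ℂ := if κ R S = i then a R S else 0

theorem norm_arrFibre_le {ι : Type*} (κ : MI n → MI n → ι) (i : ι) (a : MI n → MI n → ℂ)
    (R S : MI n) : ‖arrFibre κ i a R S‖ ≤ ‖a R S‖ := by
  unfold arrFibre
  split_ifs
  · rfl
  · rw [norm_zero]
    exact norm_nonneg _

/-- The part of the Taylor series supported on a fibre of `κ`. -/
noncomputable def WickAlg.fibre (hħ : 0 < ħ) {ι : Type*} (κ : MI n → MI n → ι) (f : WickAlg n ħ)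
    (i : ι) : WickAlg n ħ :=
  .ofArray hħ (arrFibre κ i f.coef) (f.wickArray_coef.mono (norm_arrFibre_le κ i _))

theorem WickAlg.coef_fibre (hħ : 0 < ħ) {ι : Type*} (κ : MI n → MI n → ι) (f : WickAlg n ħ)
    (i : ι) : (f.fibre hħ κ i).coef = arrFibre κ i f.coef :=
  WickAlg.coef_ofArray hħ _ (f.wickArray_coef.mono (norm_arrFibre_le κ i _))

/-- Finite partial sums are truncations of the coefficient array, so the error is dominated by f
itself. Countability of ι lets dominated convergence run along the filter of finite subsets. -/
theorem WickAlg.hasSum_fibre (hħ : 0 < ħ) {ι : Type*} [Countable ι] (κ : MI n → MI n → ι)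
    (f : WickAlg n ħ) : HasSum (f.fibre hħ κ) f := by
  classical
  have hc : ∀ (s : Finset ι) R S, (∑ i ∈ s, f.fibre hħ κ i).coef R S =
      if κ R S ∈ s then f.coef R S else 0 := by
    intro s R S
    rw [← WickAlg.coefCLM_apply hħ, map_sum]
    simp only [WickAlg.coefCLM_apply, WickAlg.coef_fibre, arrFibre]
    simp
  refine WickAlg.tendsto_of_dominated f.wickArray_coef (fun s R S => ?_) fun R S => ?_
  · rw [hc]
    split_ifs <;> simp
  · refine tendsto_const_nhds.congr' ?_
    filter_upwards [eventually_ge_atTop {κ R S}] with s hs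
    rw [hc, if_pos (hs (Finset.mem_singleton_self _))]

/-! ### Monomials and products -/

/-- Bounded coefficients give a geometric bound with ratio 2ħ for h_{0,0}. In particular polynomials
belong to A_ħ. -/
theorem WickArray.of_norm_le {a : MI n → MI n → ℂ} {C : ℝ} (h : ∀ R S, ‖a R S‖ ≤ C) :
    WickArray ħ a := by
  intro m l _ R S
  refine wickIter_ne_top_of_le_geometric (D := ENNReal.ofReal (2 * ħ))
    (C := (∑' N : MI n, (N.fact : ℝ≥0∞)⁻¹ * ENNReal.ofReal (2 * ħ) ^ N.deg) * ENNReal.ofReal C ^ 2)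
    (ENNReal.mul_ne_top (MI.tsum_pow_mul_fact_inv_ne_top ENNReal.ofReal_ne_top)
      (ENNReal.pow_ne_top ENNReal.ofReal_ne_top)) ENNReal.ofReal_ne_top (fun R S => ?_) m l R S
  rw [mul_assoc, ← ENNReal.tsum_mul_right, wickBase]
  refine ENNReal.tsum_le_tsum fun N => ?_
  have h1 : ‖a R (N + S)‖ₑ ≤ ENNReal.ofReal C := by
    rw [← ofReal_norm]
    exact ENNReal.ofReal_le_ofReal (h _ _)
  calc _ ≤ ENNReal.ofReal (2 * ħ) ^ (R.deg + S.deg + N.deg) / (N.fact : ℝ≥0∞) *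
        ENNReal.ofReal C ^ 2 := by gcongr
    _ = _ := by rw [pow_add _ (R.deg + S.deg), div_eq_mul_inv]; ring

/-- The array of the monomial `z̄^J`. -/
noncomputable def arrMonom (J R S : MI n) : ℂ := if R = 0 ∧ S = J then J.fact else 0

theorem WickArray.arrMonom (J : MI n) : WickArray ħ (arrMonom J) :=
  .of_norm_le (C := J.fact) fun R S => by
    unfold WickGNS.arrMonom
    split_ifs <;> simp

theorem taylorSum_arrMonom (J : MI n) (z : Fin n → ℂ) : taylorSum (arrMonom J) z = zbarPow J z := by
  rw [taylorSum, tsum_eq_single ((0 : MI n), J)]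
  · have hz : zPow (0 : MI n) z = 1 := by simp [zPow]
    have hJ : (J.fact : ℂ) ≠ 0 := by exact_mod_cast J.fact_ne_zero
    simp [serCoef, arrMonom, monom, hz, MI.fact_zero, hJ]
  · rintro ⟨R, S⟩ h
    have : ¬ (R = 0 ∧ S = J) := fun h' => h (Prod.ext h'.1 h'.2)
    simp [serCoef, arrMonom, this]

/-- The subspace `D`, the range of `Ψ`. -/
noncomputable abbrev psiRange (n : ℕ) (hħ : 0 < ħ) : Submodule ℂ (WickAlg n ħ) :=
  LinearMap.range (WickAlg.psi (n := n) hħ).toLinearMap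

/-- The monomial `z̄^J` as an element of `D`. -/
noncomputable def psiMonom (hħ : 0 < ħ) (J : MI n) : psiRange n hħ :=
  ⟨.ofArray hħ (arrMonom J) (.arrMonom J), (WickAlg.mem_range_psi_iff hħ _).2
    ((WickAlg.psi_eq_self_iff hħ _).2 fun R S hR => by
      rw [WickAlg.coef_ofArray, arrMonom, if_neg fun h => hR h.1])⟩

theorem psiMonom_apply (hħ : 0 < ħ) (J : MI n) (z : Fin n → ℂ) :
    (psiMonom hħ J : WickAlg n ħ) z = zbarPow J z := taylorSum_arrMonom J z

theorem coef_psiMonom (hħ : 0 < ħ) (J : MI n) :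
    (psiMonom hħ J : WickAlg n ħ).coef = arrMonom J := WickAlg.coef_ofArray hħ _ (.arrMonom J)

/-- The derivative `∂^K ∂̄^M f` as an element of `A_ħ`. -/
noncomputable def WickAlg.deriv (hħ : 0 < ħ) (K M : MI n) (f : WickAlg n ħ) : WickAlg n ħ :=
  .ofArray hħ (fun R S => f.coef (R + K) (S + M)) (f.wickArray_coef.shift hħ K M)

theorem WickAlg.deriv_apply (hħ : 0 < ħ) (K M : MI n) (f : WickAlg n ħ) (z : Fin n → ℂ) :
    f.deriv hħ K M z = mixedD K M f z := (f.mixedD_apply hħ K M z).symm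

theorem WickAlg.coef_deriv (hħ : 0 < ħ) (K M : MI n) (f : WickAlg n ħ) (R S : MI n) :
    (f.deriv hħ K M).coef R S = f.coef (R + K) (S + M) :=
  congrFun (congrFun (WickAlg.coef_ofArray hħ _ (f.wickArray_coef.shift hħ K M)) R) S

/-- The inner sum `∑_J ∂^I ∂̄^J f(0) z̄^J / J!`. -/
noncomputable def innerSeries (hħ : 0 < ħ) (f : WickAlg n ħ) (I : MI n) : psiRange n hħ :=
  (WickAlg.psi hħ).toLinearMap.rangeRestrict (f.deriv hħ I 0)

theorem coef_innerSeries (hħ : 0 < ħ) (f : WickAlg n ħ) (I R S : MI n) :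
    (innerSeries hħ f I : WickAlg n ħ).coef R S = if R = 0 then f.coef I S else 0 := by
  change (WickAlg.psi hħ (f.deriv hħ I 0)).coef R S = _
  rw [WickAlg.coef_psi, antiPart, WickAlg.coef_deriv, zero_add, add_zero]

theorem isInducing_subtype (p : Submodule ℂ (WickAlg n ħ)) : IsInducing p.subtype :=
  IsInducing.subtypeVal

theorem hasSum_innerSeries (hħ : 0 < ħ) (f : WickAlg n ħ) (I : MI n) :
    HasSum (fun J : MI n => (mixedD I J f 0 / (J.fact : ℂ)) • psiMonom hħ J) (innerSeries hħ f I) := by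
  refine ((isInducing_subtype (psiRange n hħ)).hasSum_iff _ _).1 ?_
  have h := WickAlg.hasSum_fibre hħ (fun _ S : MI n => S) (innerSeries hħ f I : WickAlg n ħ)
  refine (congrArg (HasSum · _) (funext fun J => ?_)).mpr h
  refine WickAlg.coef_injective ?_
  funext R S
  rw [WickAlg.coef_fibre, arrFibre, coef_innerSeries]
  change ((mixedD I J f 0 / (J.fact : ℂ)) • (psiMonom hħ J : WickAlg n ħ)).coef R S = _
  rw [WickAlg.coef_smul, coef_psiMonom, Pi.smul_apply, Pi.smul_apply, arrMonom, smul_eq_mul]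
  have hJ : (J.fact : ℂ) ≠ 0 := by exact_mod_cast J.fact_ne_zero
  by_cases hR : R = 0
  · by_cases hS : S = J
    · subst hS
      simp only [hR, and_self, if_true]
      rw [div_mul_cancel₀ _ hJ]
      rfl
    · simp [hS]
  · simp [hR]

/-! ### Products inside D and the terms of the outer series -/

theorem IsAntiholomorphic.mul {f g : (Fin n → ℂ) → ℂ} (hf : IsAntiholomorphic f)
    (hg : IsAntiholomorphic g) : IsAntiholomorphic fun z => f z * g z := by
  have e : (conjFun fun z => f z * g z) = fun z => conjFun f z * conjFun g z := by
    funext z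
    simp [conjFun]
  rw [IsAntiholomorphic, e]
  exact Differentiable.mul hf hg

theorem WickAlg.isAntiholomorphic_of_mem (hħ : 0 < ħ) {f : WickAlg n ħ} (hf : f ∈ psiRange n hħ) :
    IsAntiholomorphic f :=
  (f.isAntiholomorphic_iff hħ).2 ((WickAlg.mem_range_psi_iff hħ f).1 hf)

theorem WickAlg.mem_of_isAntiholomorphic (hħ : 0 < ħ) {f : WickAlg n ħ} (hf : IsAntiholomorphic f) :
    f ∈ psiRange n hħ :=
  (WickAlg.mem_range_psi_iff hħ f).2 ((f.isAntiholomorphic_iff hħ).1 hf)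

theorem WickAlg.coef_eq_zero_of_mem (hħ : 0 < ħ) {f : WickAlg n ħ} (hf : f ∈ psiRange n hħ)
    {R : MI n} (hR : R ≠ 0) (S : MI n) : f.coef R S = 0 :=
  (WickAlg.psi_eq_self_iff hħ f).1 ((WickAlg.mem_range_psi_iff hħ f).1 hf) R S hR

theorem add_ne_zero_of_right {R N : MI n} (hN : N ≠ 0) : R + N ≠ 0 := by
  obtain ⟨k, hk⟩ := Function.ne_iff.1 hN
  exact fun h => hk (by have := congrFun h k; simp at this; simpa using this.2)

theorem WickAlg.deriv_mem (hħ : 0 < ħ) {f : WickAlg n ħ} (hf : f ∈ psiRange n hħ) (M : MI n) :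
    f.deriv hħ 0 M ∈ psiRange n hħ :=
  (WickAlg.mem_range_psi_iff hħ _).2 ((WickAlg.psi_eq_self_iff hħ _).2 fun R S hR => by
    rw [WickAlg.coef_deriv, add_zero]
    exact WickAlg.coef_eq_zero_of_mem hħ hf hR _)

/-- All z-derivatives of an antiholomorphic left factor vanish, so only the term N = 0 of the Wick
product remains. Pointwise products of elements of D thus lie in A_ħ. -/
theorem WickAlg.star_apply_of_mem (hħ : 0 < ħ) {f : WickAlg n ħ} (hf : f ∈ psiRange n hħ)
    (g : WickAlg n ħ) (z : Fin n → ℂ) : WickAlg.star hħ f g z = f z * g z := by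
  refine (WickAlg.hasSum_star hħ f g z).unique ?_
  have h0 : wickTerm ħ f g z 0 = f z * g z := by
    simp [wickTerm, mixedD, iterD_zero, MI.deg_zero, MI.fact_zero]
  rw [← h0]
  refine hasSum_single 0 fun N hN => ?_
  have h1 : (fun R S : MI n => f.coef (R + N) (S + 0)) = fun _ _ => 0 := by
    funext R S
    exact WickAlg.coef_eq_zero_of_mem hħ hf (add_ne_zero_of_right hN) _
  rw [wickTerm, f.mixedD_apply hħ, h1]
  simp [taylorSum, serCoef]

/-- The product of two elements of `D`. -/
noncomputable def psiMul (hħ : 0 < ħ) (c d : psiRange n hħ) : psiRange n hħ :=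
  ⟨WickAlg.star hħ c d, WickAlg.mem_of_isAntiholomorphic hħ (by
    have e : (WickAlg.star hħ c d : (Fin n → ℂ) → ℂ) =
        fun z => (c : WickAlg n ħ) z * (d : WickAlg n ħ) z :=
      funext fun z => WickAlg.star_apply_of_mem hħ c.2 _ z
    rw [e]
    exact (WickAlg.isAntiholomorphic_of_mem hħ c.2).mul (WickAlg.isAntiholomorphic_of_mem hħ d.2))⟩

/-- The term `(∑_J ∂^I ∂̄^J f(0) z̄^J / J!) ∂̄^I d`. -/
noncomputable def outerTerm (hħ : 0 < ħ) (f : WickAlg n ħ) (d : psiRange n hħ) (I : MI n) :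
    psiRange n hħ :=
  psiMul hħ (innerSeries hħ f I) ⟨(d : WickAlg n ħ).deriv hħ 0 I, WickAlg.deriv_mem hħ d.2 I⟩

theorem outerTerm_apply (hħ : 0 < ħ) (f : WickAlg n ħ) (d : psiRange n hħ) (I : MI n)
    (z : Fin n → ℂ) : (outerTerm hħ f d I : WickAlg n ħ) z =
      (innerSeries hħ f I : WickAlg n ħ) z * mixedD 0 I (d : WickAlg n ħ) z := by
  rw [← WickAlg.deriv_apply hħ]
  exact WickAlg.star_apply_of_mem hħ (innerSeries hħ f I).2 _ z

/-! ### The GNS representation and the Bargmann–Fock representation -/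

theorem arrStar_zero_left (a b : MI n → MI n → ℂ) (S : MI n) :
    arrStar ħ a b 0 S = ∑' N : MI n, (2 * (ħ : ℂ)) ^ N.deg / (N.fact : ℂ) *
      ∑ J ∈ Finset.Icc 0 S, (S.binom J : ℂ) * (a N J * b 0 (N + (S - J))) := by
  unfold arrStar arrMul
  refine tsum_congr fun N => ?_
  congr 1
  simp [MI.binom_self]

theorem arrStar_antiPart_zero_left (a b : MI n → MI n → ℂ) (S : MI n) :
    arrStar ħ a (antiPart b) 0 S = arrStar ħ a b 0 S := by
  simp [arrStar_zero_left, antiPart]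

/-- The coefficients of f ⋆ g with first index 0 involve those of g with first index 0 only. This
makes J₀ a left ideal and identifies π(f) with Ψ(f ⋆ ·) on D. -/
theorem WickAlg.psi_star_psi (hħ : 0 < ħ) (f g : WickAlg n ħ) :
    WickAlg.psi hħ (WickAlg.star hħ f (WickAlg.psi hħ g)) = WickAlg.psi hħ (WickAlg.star hħ f g) := by
  refine WickAlg.coef_injective ?_
  funext R S
  simp only [WickAlg.coef_psi, WickAlg.coef_star, antiPart, ← arrStar_antiPart_zero_left f.coef g.coef]

theorem gelfandIdeal_le_comap_star (hħ : 0 < ħ) (f : WickAlg n ħ) :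
    gelfandIdeal n ħ hħ ≤ (gelfandIdeal n ħ hħ).comap (WickAlg.star hħ f) := by
  intro g hg
  rw [Submodule.mem_comap]
  rw [← WickAlg.ker_psi, LinearMap.mem_ker] at hg ⊢
  have h := WickAlg.psi_star_psi hħ f g
  change WickAlg.psi hħ g = 0 at hg
  rw [hg, map_zero, map_zero] at h
  exact h.symm

/-- The GNS representation. -/
noncomputable def gnsRep (hħ : 0 < ħ) :
    WickAlg n ħ →ₗ[ℂ] GNSSpace n ħ hħ →ₗ[ℂ] GNSSpace n ħ hħ where
  toFun f := (gelfandIdeal n ħ hħ).mapQ (gelfandIdeal n ħ hħ) (WickAlg.star hħ f)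
    (gelfandIdeal_le_comap_star hħ f)
  map_add' f g := by
    ext x
    simp
  map_smul' c f := by
    ext x
    simp

theorem gnsRep_gnsClass (hħ : 0 < ħ) (f g : WickAlg n ħ) :
    gnsRep hħ f (gnsClass hħ g) = gnsClass hħ (WickAlg.star hħ f g) := rfl

/-- The Bargmann–Fock representation. -/
noncomputable def bfRep (hħ : 0 < ħ) :
    WickAlg n ħ →ₗ[ℂ] psiRange n hħ →ₗ[ℂ] psiRange n hħ :=
  LinearMap.mk₂ ℂ (fun f d => (WickAlg.psi hħ).toLinearMap.rangeRestrict (WickAlg.star hħ f d))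
    (fun f f' d => by simp) (fun c f d => by simp) (fun f d d' => by simp) (fun c f d => by simp)

theorem bfRep_apply (hħ : 0 < ħ) (f : WickAlg n ħ) (d : psiRange n hħ) :
    (bfRep hħ f d : WickAlg n ħ) = WickAlg.psi hħ (WickAlg.star hħ f d) := rfl

theorem bfRep_gnsEquiv (hħ : 0 < ħ) (f : WickAlg n ħ) (x : GNSSpace n ħ hħ) :
    bfRep hħ f (WickAlg.gnsEquiv hħ x) = WickAlg.gnsEquiv hħ (gnsRep hħ f x) := by
  obtain ⟨g, rfl⟩ := Submodule.mkQ_surjective _ x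
  exact Subtype.ext (WickAlg.psi_star_psi hħ f g)

theorem continuous_bfRep (hħ : 0 < ħ) :
    Continuous fun p : WickAlg n ħ × psiRange n hħ => bfRep hħ p.1 p.2 :=
  Continuous.subtype_mk ((WickAlg.psi hħ).continuous.comp ((continuous_star hħ).comp
    (continuous_fst.prodMk (continuous_subtype_val.comp continuous_snd)))) _

theorem arrStar_zero_left_of_fibre (a b : MI n → MI n → ℂ) (I S : MI n) :
    arrStar ħ (arrFibre (fun R _ => R) I a) b 0 S = (2 * (ħ : ℂ)) ^ I.deg / (I.fact : ℂ) *
      ∑ J ∈ Finset.Icc 0 S, (S.binom J : ℂ) * (a I J * b 0 (I + (S - J))) := by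
  rw [arrStar_zero_left, tsum_eq_single I]
  · simp [arrFibre]
  · intro N hN
    simp [arrFibre, hN]

theorem arrStar_zero_left_of_anti {a : MI n → MI n → ℂ} (ha : ∀ R S, R ≠ 0 → a R S = 0)
    (b : MI n → MI n → ℂ) (S : MI n) : arrStar ħ a b 0 S =
      ∑ J ∈ Finset.Icc 0 S, (S.binom J : ℂ) * (a 0 J * b 0 (S - J)) := by
  rw [arrStar_zero_left, tsum_eq_single 0]
  · simp [MI.deg_zero, MI.fact_zero]
  · intro N hN
    simp [ha N _ hN]

/-- For the part of f with z-exponent I, only N = I contributes to the coefficients that Ψ keeps.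
What remains is the Leibniz formula for the pointwise product. -/
theorem bfRep_fibre (hħ : 0 < ħ) (f : WickAlg n ħ) (d : psiRange n hħ) (I : MI n) :
    bfRep hħ (f.fibre hħ (fun R _ => R) I) d =
      ((2 * (ħ : ℂ)) ^ I.deg / (I.fact : ℂ)) • outerTerm hħ f d I := by
  refine Subtype.ext (WickAlg.coef_injective ?_)
  funext R S
  change _ = (((2 * (ħ : ℂ)) ^ I.deg / (I.fact : ℂ)) • (outerTerm hħ f d I : WickAlg n ħ)).coef R S
  rw [WickAlg.coef_smul, Pi.smul_apply, Pi.smul_apply, smul_eq_mul, bfRep_apply, WickAlg.coef_psi,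
    antiPart]
  split_ifs with hR
  · subst hR
    have e : (outerTerm hħ f d I : WickAlg n ħ) =
      WickAlg.star hħ (innerSeries hħ f I) ((d : WickAlg n ħ).deriv hħ 0 I) := rfl
    rw [WickAlg.coef_star, WickAlg.coef_fibre, arrStar_zero_left_of_fibre, e, WickAlg.coef_star,
      arrStar_zero_left_of_anti fun R S hR => WickAlg.coef_eq_zero_of_mem hħ (innerSeries hħ f I).2 hR S]
    congr 1
    refine Finset.sum_congr rfl fun J _ => ?_
    rw [coef_innerSeries, if_pos rfl, WickAlg.coef_deriv, add_zero, add_comm I]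
  · rw [WickAlg.coef_eq_zero_of_mem hħ (outerTerm hħ f d I).2 hR, mul_zero]

/-- The continuous additive map g ↦ π(g)d is applied to the decomposition of f by z-exponents, so
convergence is inherited from A_ħ. -/
theorem hasSum_outerTerm (hħ : 0 < ħ) (f : WickAlg n ħ) (d : psiRange n hħ) :
    HasSum (fun I : MI n => ((2 * (ħ : ℂ)) ^ I.deg / (I.fact : ℂ)) • outerTerm hħ f d I)
      (bfRep hħ f d) := by
  have h1 : Continuous fun g : WickAlg n ħ => (g, d) := by fun_prop
  have hc : Continuous fun g : WickAlg n ħ => bfRep hħ g d := by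
    have := (continuous_bfRep hħ).comp h1
    simpa only [Function.comp_def] using this
  have h := (WickAlg.hasSum_fibre hħ (fun R _ : MI n => R) f).map
    (AddMonoidHom.mk' (fun g => bfRep hħ g d) fun g g' => by rw [map_add, LinearMap.add_apply]) hc
  simp only [← bfRep_fibre]
  exact h

/-! ### Holomorphic functions of several variables -/

section Holomorphic

variable {E : Type*} [NormedAddCommGroup E] [NormedSpace ℂ E]

theorem hasDerivAt_comp_line {H : E → ℂ} (hH : Differentiable ℂ H) (x v : E) (t : ℂ) :
    HasDerivAt (fun t : ℂ => H (x + t • v)) (fderiv ℂ H (x + t • v) v) t := by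
  have h1 : HasDerivAt (fun t : ℂ => x + t • v) v t := by
    simpa using ((hasDerivAt_id t).smul_const v).const_add x
  exact (hH (x + t • v)).hasFDerivAt.comp_hasDerivAt t h1

theorem differentiable_comp_line {H : E → ℂ} (hH : Differentiable ℂ H) (x v : E) :
    Differentiable ℂ fun t : ℂ => H (x + t • v) :=
  fun t => (hasDerivAt_comp_line hH x v t).differentiableAt

theorem fderiv_apply_eq_deriv {H : E → ℂ} (hH : Differentiable ℂ H) (x v : E) :
    fderiv ℂ H x v = deriv (fun t : ℂ => H (x + t • v)) 0 := by
  simpa using (hasDerivAt_comp_line hH x v 0).deriv.symm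

theorem norm_fderiv_le_of_norm_le {H : E → ℂ} (hH : Differentiable ℂ H) {y : E} {M : ℝ}
    (hM : ∀ u, ‖u - y‖ ≤ 1 → ‖H u‖ ≤ M) : ‖fderiv ℂ H y‖ ≤ M := by
  have hM0 : 0 ≤ M := (norm_nonneg _).trans (hM y (by simp))
  refine ContinuousLinearMap.opNorm_le_bound _ hM0 fun u => ?_
  rcases eq_or_ne u 0 with rfl | hu
  · simp
  have hu' : 0 < ‖u‖ := norm_pos_iff.2 hu
  rw [fderiv_apply_eq_deriv hH]
  -- On the circle of radius 1/‖u‖ the displacement t • u has norm exactly 1.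
  have h := norm_deriv_le_of_forall_mem_sphere_norm_le (c := (0 : ℂ)) (R := ‖u‖⁻¹) (C := M)
    (inv_pos.2 hu') (differentiable_comp_line hH y u).diffContOnCl fun t ht => hM _ (by
      rw [add_sub_cancel_left, norm_smul, mem_sphere_zero_iff_norm.1 ht, inv_mul_cancel₀ hu'.ne'])
  rwa [div_inv_eq_mul] at h

/-- Cauchy's formula in the direction v writes the derivative as an integral of translates of H over
the unit circle. The integral may be differentiated under its sign because
`norm_fderiv_le_of_norm_le` bounds the derivative of H locally. -/
theorem differentiable_fderiv_apply [FiniteDimensional ℂ E] {H : E → ℂ} (hH : Differentiable ℂ H)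
    (v : E) : Differentiable ℂ fun x => fderiv ℂ H x v := by
  have : ProperSpace E := FiniteDimensional.proper ℂ E
  have : ProperSpace (E →L[ℂ] ℂ) := FiniteDimensional.proper ℂ _
  let _ : MeasurableSpace E := borel E
  have : BorelSpace E := ⟨rfl⟩
  have : SecondCountableTopology E := inferInstance
  set γ : ℝ → ℂ := circleMap 0 1 with hγ
  have hγc : Continuous γ := continuous_circleMap 0 1
  have hγ1 : ∀ θ, ‖γ θ‖ = 1 := fun θ => by simp [hγ, circleMap]
  set w : ℝ → ℂ := fun θ => (2 * Real.pi * I : ℂ)⁻¹ * (deriv γ θ * (γ θ ^ 2)⁻¹) with hw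
  have hwc : Continuous w := by
    have h1 : Continuous (deriv γ) := by
      have e : deriv γ = fun θ => γ θ * I := funext fun θ => deriv_circleMap 0 1 θ
      rw [e]
      exact hγc.mul continuous_const
    refine continuous_const.mul (h1.mul ((hγc.pow 2).inv₀ fun θ => ?_))
    rw [← norm_ne_zero_iff, Pi.pow_apply, norm_pow, hγ1]
    simp
  have hrep : (fun x => fderiv ℂ H x v) = fun x => ∫ θ in (0 : ℝ)..2 * Real.pi, w θ * H (x + γ θ • v) := by
    funext x
    have h1 := (differentiable_comp_line hH x v).diffContOnCl.deriv_eq_smul_circleIntegral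
      (c := (0 : ℂ)) (R := 1) one_pos
    rw [← fderiv_apply_eq_deriv hH, smul_eq_mul] at h1
    rw [eq_comm, ← mul_right_inj' two_pi_I_ne_zero, ← h1, circleIntegral,
      ← intervalIntegral.integral_const_mul]
    refine intervalIntegral.integral_congr fun θ _ => ?_
    simp only [hw, smul_eq_mul, sub_zero, ← hγ]
    rw [← mul_assoc, ← mul_assoc, mul_inv_cancel₀ two_pi_I_ne_zero]
    ring
  rw [hrep]
  intro x₀
  -- The radius leaves room 1 for x near x₀ and room 1 for the Cauchy estimate around x + γ θ • v.
  obtain ⟨M, hM⟩ := (isCompact_closedBall (0 : E) (‖x₀‖ + ‖v‖ + 2)).exists_bound_of_continuousOn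
    hH.continuous.continuousOn
  have hcont : ∀ x, Continuous fun θ => w θ * H (x + γ θ • v) := fun x =>
    hwc.mul (hH.continuous.comp (continuous_const.add (hγc.smul continuous_const)))
  refine (intervalIntegral.hasFDerivAt_integral_of_dominated_of_fderiv_le (𝕜 := ℂ)
    (F' := fun x θ => w θ • fderiv ℂ H (x + γ θ • v)) (bound := fun θ => ‖w θ‖ * M)
    (Metric.ball_mem_nhds x₀ one_pos) (Eventually.of_forall fun x => (hcont x).aestronglyMeasurable)
    ((hcont x₀).intervalIntegrable _ _) ?_ (ae_of_all _ fun θ _ x hx => ?_)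
    ((hwc.norm.mul continuous_const).intervalIntegrable _ _)
    (ae_of_all _ fun θ _ x _ => ?_)).differentiableAt
  · refine hwc.aestronglyMeasurable.smul ?_
    have hm : Measurable (fderiv ℂ H) := measurable_fderiv ℂ H
    exact (hm.comp (continuous_const.add (hγc.smul continuous_const)).measurable).aestronglyMeasurable
  · rw [norm_smul]
    refine mul_le_mul_of_nonneg_left (norm_fderiv_le_of_norm_le hH fun u hu => hM u ?_) (norm_nonneg _)
    rw [mem_closedBall_zero_iff]
    have h1 : ‖x - x₀‖ ≤ 1 := by
      rw [← dist_eq_norm]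
      exact (Metric.mem_ball.1 hx).le
    have h2 : ‖γ θ • v‖ = ‖v‖ := by rw [norm_smul, hγ1, one_mul]
    have e : u = (u - (x + γ θ • v)) + ((x - x₀) + x₀ + γ θ • v) := by abel
    rw [e]
    refine (norm_add_le _ _).trans ?_
    have h3 := norm_add₃_le (a := x - x₀) (b := x₀) (c := γ θ • v)
    linarith
  · have h1 : HasFDerivAt (fun x => H (x + γ θ • v)) (fderiv ℂ H (x + γ θ • v)) x :=
      (hH (x + γ θ • v)).hasFDerivAt.comp x ((hasFDerivAt_id x).add_const (γ θ • v))
    exact h1.const_mul (w θ)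

theorem contDiff_nat_of_differentiable [FiniteDimensional ℂ E] (m : ℕ) {H : E → ℂ}
    (hH : Differentiable ℂ H) : ContDiff ℂ m H := by
  induction m generalizing H with
  | zero => exact contDiff_zero.2 hH.continuous
  | succ m ih =>
    push_cast
    rw [contDiff_succ_iff_fderiv_apply]
    exact ⟨hH, by simp, fun v => ih (differentiable_fderiv_apply hH v)⟩

theorem contDiff_of_differentiable [FiniteDimensional ℂ E] {H : E → ℂ} (hH : Differentiable ℂ H) :
    ContDiff ℂ ∞ H :=
  contDiff_infty.2 fun m => contDiff_nat_of_differentiable m hH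

theorem differentiable_iterate_fderiv [FiniteDimensional ℂ E] {H : E → ℂ} (hH : Differentiable ℂ H)
    (v : E) (m : ℕ) : Differentiable ℂ ((fun (g : E → ℂ) x => fderiv ℂ g x v)^[m] H) := by
  induction m with
  | zero => exact hH
  | succ m ih =>
    rw [Function.iterate_succ_apply']
    exact differentiable_fderiv_apply ih v

theorem iteratedDeriv_comp_line [FiniteDimensional ℂ E] {H : E → ℂ} (hH : Differentiable ℂ H)
    (x v : E) (m : ℕ) : iteratedDeriv m (fun t : ℂ => H (x + t • v)) =
      fun t => ((fun (g : E → ℂ) x => fderiv ℂ g x v)^[m] H) (x + t • v) := by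
  induction m with
  | zero => simp
  | succ m ih =>
    funext t
    rw [iteratedDeriv_succ, ih, Function.iterate_succ_apply']
    exact (hasDerivAt_comp_line (differentiable_iterate_fderiv hH v m) x v t).deriv

theorem norm_iterate_fderiv_le [FiniteDimensional ℂ E] {H : E → ℂ} (hH : Differentiable ℂ H)
    {x v : E} {ρ M : ℝ} (hρ : 0 < ρ) (hM : ∀ t : ℂ, ‖t‖ = ρ → ‖H (x + t • v)‖ ≤ M) (m : ℕ) :
    ‖((fun (g : E → ℂ) x => fderiv ℂ g x v)^[m] H) x‖ ≤ m.factorial * M / ρ ^ m := by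
  have h := norm_iteratedDeriv_le_of_forall_mem_sphere_norm_le (c := (0 : ℂ)) m hρ
    (differentiable_comp_line hH x v).diffContOnCl fun t ht => hM t (mem_sphere_zero_iff_norm.1 ht)
  rw [iteratedDeriv_comp_line hH] at h
  simpa using h

end Holomorphic

theorem dz_eq_fderiv {H : (Fin n → ℂ) → ℂ} (hH : Differentiable ℂ H) (k : Fin n) :
    dz k H = fun x => fderiv ℂ H x (Pi.single k 1) := by
  funext x
  have h1 : fderiv ℝ H x = (fderiv ℂ H x).restrictScalars ℝ :=
    ((hH x).hasFDerivAt.restrictScalars ℝ).fderiv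
  have h2 : (Pi.single k I : Fin n → ℂ) = I • Pi.single k 1 := by
    rw [← Pi.single_smul, smul_eq_mul, mul_one]
  rw [dz, h1, h2, ContinuousLinearMap.coe_restrictScalars', map_smul, smul_eq_mul, ← mul_assoc,
    I_mul_I]
  ring

theorem iterate_dz_eq {H : (Fin n → ℂ) → ℂ} (hH : Differentiable ℂ H) (k : Fin n) (m : ℕ) :
    (dz k)^[m] H = (fun (g : (Fin n → ℂ) → ℂ) x => fderiv ℂ g x (Pi.single k 1))^[m] H := by
  induction m with
  | zero => rfl
  | succ m ih =>
    rw [Function.iterate_succ_apply', Function.iterate_succ_apply', ih,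
      dz_eq_fderiv (differentiable_iterate_fderiv hH _ m)]

/-- Cauchy's estimates for the partial derivatives of a holomorphic function. -/
theorem norm_iterD_dz_le {H : (Fin n → ℂ) → ℂ} (hH : Differentiable ℂ H) {ρ M : ℝ} (hρ : 0 < ρ)
    (hM : ∀ z, ‖z‖ ≤ n * ρ → ‖H z‖ ≤ M) (R : MI n) :
    ‖iterD dz R H 0‖ ≤ R.fact * M / ρ ^ R.deg := by
  -- The derivatives in one coordinate use up ρ of the available radius nρ; a list of j coordinates
  -- leaves the ball of radius (n - j)ρ.
  suffices hl : ∀ l : List (Fin n),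
      Differentiable ℂ (l.foldr (fun k g => (dz k)^[R k] g) H) ∧
      ∀ z, ‖z‖ + l.length * ρ ≤ n * ρ → ‖l.foldr (fun k g => (dz k)^[R k] g) H z‖ ≤
        (l.map fun k => ((R k).factorial : ℝ) / ρ ^ R k).prod * M by
    have h := (hl (List.finRange n)).2 0 (by simp)
    refine h.trans (le_of_eq ?_)
    rw [← List.ofFn_eq_map, List.prod_ofFn, Finset.prod_div_distrib, Finset.prod_pow_eq_pow_sum, MI.fact, MI.deg]
    push_cast
    ring
  intro l
  induction l with
  | nil => exact ⟨hH, fun z hz => by simpa using hM z (by simpa using hz)⟩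
  | cons k l ih =>
    obtain ⟨h1, h2⟩ := ih
    simp only [List.foldr_cons, List.map_cons, List.prod_cons, List.length_cons]
    rw [iterate_dz_eq h1]
    refine ⟨differentiable_iterate_fderiv h1 _ _, fun z hz => ?_⟩
    refine (norm_iterate_fderiv_le h1 hρ (fun t ht => h2 (z + t • Pi.single k 1) ?_) (R k)).trans
      (le_of_eq (by ring))
    have h3 : ‖t • (Pi.single k 1 : Fin n → ℂ)‖ = ρ := by rw [norm_smul, ht, Pi.norm_single]; simp
    have h4 := norm_add_le z (t • (Pi.single k 1 : Fin n → ℂ))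
    push_cast at hz
    linarith

theorem contDiff_real_of_differentiable {H : (Fin n → ℂ) → ℂ} (hH : Differentiable ℂ H) :
    ContDiff ℝ ∞ H := (contDiff_of_differentiable hH).restrict_scalars ℝ

theorem entireArray_of_differentiable {H : (Fin n → ℂ) → ℂ} (hH : Differentiable ℂ H) :
    EntireArray (taylorCoef H 0) := by
  refine .of_summable fun σ => ?_
  -- Cauchy's estimates on this radius turn σ^{|R|} into at most 2^{-|R|}.
  set ρ : ℝ := 2 * (σ + 1) with hρ
  have hρ0 : 0 < ρ := by positivity
  obtain ⟨M, hM⟩ := (isCompact_closedBall (0 : Fin n → ℂ) (n * ρ)).exists_bound_of_continuousOn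
    hH.continuous.continuousOn
  have hM' : ∀ z, ‖z‖ ≤ n * ρ → ‖H z‖ ≤ M := fun z hz => hM z (mem_closedBall_zero_iff.2 hz)
  have hM0 : 0 ≤ M := (norm_nonneg _).trans (hM' 0 (by simp; positivity))
  refine ((MI.summable_half_pow_prod n).mul_left M).of_nonneg_of_le (fun _ => by positivity) ?_
  rintro ⟨R, S⟩
  by_cases hS : S = 0
  · subst hS
    have h := norm_iterD_dz_le hH hρ0 hM' R
    have e : taylorCoef H 0 R 0 = iterD dz R H 0 := by simp [taylorCoef, mixedD, iterD_zero]
    have hf : (0 : ℝ) < R.fact := by exact_mod_cast R.fact_pos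
    rw [mul_comm (R.fact : ℝ), mul_div_right_comm] at h
    simp only [serCoef, e, MI.fact_zero, MI.deg_zero, add_zero, Nat.cast_one, mul_one, norm_div,
      Complex.norm_natCast]
    rw [div_mul_eq_mul_div, div_le_iff₀ hf]
    calc ‖iterD dz R H 0‖ * (σ : ℝ) ^ R.deg ≤ M / ρ ^ R.deg * R.fact * (σ + 1 : ℝ) ^ R.deg := by
          gcongr
          linarith
      _ = M * (1 / 2) ^ R.deg * R.fact := by
          rw [hρ, mul_pow, div_pow, one_pow]
          field_simp
  · have e : taylorCoef H 0 R S = 0 := congrFun (mixedD_eq_zero_of_dzbar_eq_zero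
      (contDiff_real_of_differentiable hH) (dzbar_eq_zero_of_differentiable hH) R hS) 0
    simp only [serCoef, e, zero_div, norm_zero, zero_mul]
    positivity

/-- On every complex line through 0 the function is entire with vanishing Taylor coefficients. -/
theorem eq_zero_of_differentiable {H : (Fin n → ℂ) → ℂ} (hH : Differentiable ℂ H)
    (h : ∀ R S, mixedD R S H 0 = 0) : H = 0 := by
  funext w
  have hit : ∀ m, iteratedDeriv m (fun t : ℂ => H (0 + t • w)) 0 = 0 := by
    intro m
    rw [iteratedDeriv_comp_line hH]
    have e : ∀ m, (fun (g : (Fin n → ℂ) → ℂ) x => fderiv ℂ g x w)^[m] H =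
        (fun (g : (Fin n → ℂ) → ℂ) x => fderiv ℝ g x w)^[m] H := by
      intro m
      induction m with
      | zero => rfl
      | succ m ih =>
        rw [Function.iterate_succ_apply', Function.iterate_succ_apply', ← ih]
        funext x
        rw [((differentiable_iterate_fderiv hH w m x).hasFDerivAt.restrictScalars ℝ).fderiv]
        rfl
    simp only [e, zero_smul, add_zero]
    exact iterate_fderiv_eq_zero_of_mixedD_eq_zero (contDiff_real_of_differentiable hH) h w m
  have h1 := hasSum_taylorSeries_of_entire (differentiable_comp_line hH 0 w) 0 1
  simp only [hit, smul_zero] at h1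
  simpa using h1.unique hasSum_zero

/-- The Taylor series is itself holomorphic, so its difference from H is a holomorphic function with
all mixed derivatives 0 at the origin. -/
theorem eq_taylorSum_of_differentiable {H : (Fin n → ℂ) → ℂ} (hH : Differentiable ℂ H) :
    H = taylorSum (taylorCoef H 0) := by
  set a := taylorCoef H 0 with ha
  have hE : EntireArray a := entireArray_of_differentiable hH
  have hT : ContDiff ℝ ∞ (taylorSum a) := hE.analyticOnNhd.contDiff
  have hzero : ∀ R S : MI n, S ≠ 0 → a R S = 0 := fun R S hS =>
    congrFun (mixedD_eq_zero_of_dzbar_eq_zero (contDiff_real_of_differentiable hH)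
      (dzbar_eq_zero_of_differentiable hH) R hS) 0
  have hD : Differentiable ℂ (taylorSum a) := by
    refine differentiable_of_dzbar_eq_zero (hT.differentiable (by simp)) fun k => ?_
    rw [hE.dzbar_taylorSum]
    have e : (fun R S : MI n => a R (S + Pi.single k 1)) = fun _ _ => 0 := by
      funext R S
      refine hzero R _ fun h => ?_
      have := congrFun h k
      simp at this
    rw [e]
    funext z
    simp [taylorSum, serCoef]
  have h0 : H + (-1 : ℂ) • taylorSum a = 0 := by
    refine eq_zero_of_differentiable (hH.add (hD.const_smul _)) fun R S => ?_
    have hL := smoothLinear_mixedD (n := n) R S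
    have hT' : ContDiff ℝ ∞ ((-1 : ℂ) • taylorSum a) := contDiff_const.smul hT
    rw [hL.2.1 _ _ (contDiff_real_of_differentiable hH) hT', hL.2.2 _ _ hT]
    have h2 := congrFun (congrFun hE.taylorCoef_taylorSum R) S
    simp only [taylorCoef] at h2
    rw [Pi.add_apply, Pi.smul_apply, h2, ha]
    simp [taylorCoef]
  rw [neg_one_smul, ← sub_eq_add_neg] at h0
  exact sub_eq_zero.1 h0

/-- An antiholomorphic function is the sum of an everywhere absolutely convergent power series in
the conjugate coordinates. -/
theorem IsAntiholomorphic.exists_taylorSum {F : (Fin n → ℂ) → ℂ} (hF : IsAntiholomorphic F) :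
    ∃ a : MI n → MI n → ℂ, EntireArray a ∧ (∀ R S, R ≠ 0 → a R S = 0) ∧ F = taylorSum a := by
  refine ⟨arrConj (taylorCoef (conjFun F) 0), (entireArray_of_differentiable hF).conj,
    fun R S hR => ?_, ?_⟩
  · have := congrFun (mixedD_eq_zero_of_dzbar_eq_zero (contDiff_real_of_differentiable hF)
      (dzbar_eq_zero_of_differentiable hF) S hR) 0
    simp [arrConj, taylorCoef, this]
  · rw [← conjFun_taylorSum, ← eq_taylorSum_of_differentiable hF, conjFun_conjFun]

/-! ### Parseval's identity on the torus -/

theorem measure_univ_torus : (volume : Measure (Fin n → UnitAddCircle)) Set.univ = 1 := by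
  rw [volume_pi, Measure.pi_univ]
  simp

instance : IsProbabilityMeasure (volume : Measure (Fin n → UnitAddCircle)) := ⟨measure_univ_torus⟩

theorem integral_fourier (m : ℤ) :
    ∫ t : UnitAddCircle, (fourier m t : ℂ) = if m = 0 then 1 else 0 := by
  split_ifs with h
  · subst h
    simp only [fourier_zero, integral_const]
    simp [Measure.real]
  · exact integral_eq_zero_of_add_right_eq_neg (fourier_add_half_inv_index h one_pos)

/-- The character `θ ↦ exp(-2πi I·θ)` of the torus. -/
noncomputable def torusChar (I : MI n) (θ : Fin n → UnitAddCircle) : ℂ :=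
  ∏ k, fourier (-(I k : ℤ)) (θ k)

theorem continuous_torusChar (I : MI n) : Continuous (torusChar I) :=
  continuous_finsetProd _ fun k _ => (fourier (-(I k : ℤ))).continuous.comp (continuous_apply k)

theorem norm_torusChar (I : MI n) (θ : Fin n → UnitAddCircle) : ‖torusChar I θ‖ = 1 := by
  rw [torusChar, norm_prod]
  exact Finset.prod_eq_one fun k _ => Circle.norm_coe _

theorem torusChar_mul_conj (I J : MI n) (θ : Fin n → UnitAddCircle) :
    torusChar I θ * (starRingEnd ℂ) (torusChar J θ) = ∏ k, fourier ((J k : ℤ) - I k) (θ k) := by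
  rw [torusChar, torusChar, map_prod, ← Finset.prod_mul_distrib]
  refine Finset.prod_congr rfl fun k _ => ?_
  rw [← fourier_neg, neg_neg, ← fourier_add]
  congr 2
  ring

theorem integral_torusChar_mul_conj (I J : MI n) :
    ∫ θ : Fin n → UnitAddCircle, torusChar I θ * (starRingEnd ℂ) (torusChar J θ) =
      if I = J then 1 else 0 := by
  simp only [torusChar_mul_conj]
  rw [integral_fintype_prod_volume_eq_prod (fun k (t : UnitAddCircle) =>
    (fourier ((J k : ℤ) - I k) t : ℂ))]
  simp only [integral_fourier]
  split_ifs with h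
  · subst h
    simp
  · obtain ⟨k, hk⟩ := Function.ne_iff.1 h
    refine Finset.prod_eq_zero (Finset.mem_univ k) (if_neg fun h' => hk ?_)
    omega

theorem continuous_tsum_torusChar {a : MI n → ℂ} (ha : Summable fun I => ‖a I‖) :
    Continuous fun θ => ∑' I, a I * torusChar I θ :=
  continuous_tsum (fun I => continuous_const.mul (continuous_torusChar I)) ha fun I θ => by
    rw [norm_mul, norm_torusChar, mul_one]

/-- The squared modulus is an absolutely convergent double series of characters; integrating
termwise, orthonormality leaves the diagonal. -/
theorem hasSum_integral_torus {a : MI n → ℂ} (ha : Summable fun I => ‖a I‖) :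
    HasSum (fun I => ‖a I‖ ^ 2) (∫ θ, ‖∑' I, a I * torusChar I θ‖ ^ 2) := by
  set G : MI n × MI n → (Fin n → UnitAddCircle) → ℂ := fun p θ =>
    (a p.1 * torusChar p.1 θ) * (starRingEnd ℂ) (a p.2 * torusChar p.2 θ) with hG
  have hGn : ∀ p θ, ‖G p θ‖ = ‖a p.1‖ * ‖a p.2‖ := fun p θ => by
    simp [hG, norm_torusChar]
  have hGc : ∀ p, Continuous (G p) := fun p =>
    (continuous_const.mul (continuous_torusChar _)).mul
      (continuous_conj.comp (continuous_const.mul (continuous_torusChar _)))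
  have hGi : ∀ p, Integrable (G p) := fun p =>
    (hGc p).integrable_of_hasCompactSupport (HasCompactSupport.of_compactSpace _)
  have hs : Summable fun p : MI n × MI n => ‖a p.1‖ * ‖a p.2‖ :=
    ha.mul_of_nonneg ha (fun _ => norm_nonneg _) fun _ => norm_nonneg _
  have h1 := hasSum_integral_of_summable_integral_norm hGi (by simpa [hGn] using hs)
  have h2 : ∀ θ, ∑' p, G p θ = ((‖∑' I, a I * torusChar I θ‖ ^ 2 : ℝ) : ℂ) := by
    intro θ
    have hsθ : Summable fun I => ‖a I * torusChar I θ‖ := by simpa [norm_torusChar] using ha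
    have hsθ' : Summable fun I => ‖(starRingEnd ℂ) (a I * torusChar I θ)‖ := by
      simpa [norm_torusChar] using ha
    push_cast
    rw [← Complex.mul_conj', conj_tsum, tsum_mul_tsum_of_summable_norm hsθ hsθ']
  have h3 : ∀ p : MI n × MI n, ∫ θ, G p θ = if p.1 = p.2 then ((‖a p.1‖ ^ 2 : ℝ) : ℂ) else 0 := by
    intro p
    have e : ∀ θ, G p θ = (a p.1 * (starRingEnd ℂ) (a p.2)) *
        (torusChar p.1 θ * (starRingEnd ℂ) (torusChar p.2 θ)) := fun θ => by
      simp only [hG, map_mul]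
      ring
    simp only [e]
    rw [integral_const_mul, integral_torusChar_mul_conj]
    split_ifs with h
    · rw [← h, mul_one, Complex.mul_conj']
      push_cast
      rfl
    · rw [mul_zero]
  simp only [h2, h3] at h1
  rw [integral_complex_ofReal] at h1
  have hinj : Function.Injective fun I : MI n => (I, I) := fun I J h => (Prod.ext_iff.1 h).1
  rw [← hinj.hasSum_iff] at h1
  · simp only [Function.comp_def, if_true] at h1
    exact Complex.hasSum_ofReal.1 h1
  · rintro ⟨I, J⟩ hIJ
    refine if_neg fun h => hIJ ⟨I, ?_⟩
    simp only at h
    rw [h]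

theorem lintegral_torus {a : MI n → ℂ} (ha : Summable fun I => ‖a I‖) :
    ∫⁻ θ, ‖∑' I, a I * torusChar I θ‖ₑ ^ 2 = ∑' I, ‖a I‖ₑ ^ 2 := by
  have h := hasSum_integral_torus ha
  have hi : Integrable fun θ : Fin n → UnitAddCircle => ‖∑' I, a I * torusChar I θ‖ ^ 2 :=
    ((continuous_tsum_torusChar ha).norm.pow 2).integrable_of_hasCompactSupport
      (HasCompactSupport.of_compactSpace _)
  have e : ∀ x : ℂ, ‖x‖ₑ ^ 2 = ENNReal.ofReal (‖x‖ ^ 2) := fun x => by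
    rw [ENNReal.ofReal_pow (norm_nonneg _), ofReal_norm]
  simp only [e]
  rw [← ofReal_integral_eq_lintegral_ofReal hi (ae_of_all _ fun _ => by positivity), ← h.tsum_eq,
    ENNReal.ofReal_tsum_of_nonneg (fun _ => by positivity) h.summable]

/-! ### Gaussian moments -/

theorem measurable_bfDensity (n : ℕ) (ħ : ℝ) : Measurable fun z : Fin n → ℂ =>
    ENNReal.ofReal (1 / (2 * Real.pi * ħ) ^ n * Real.exp (-(∑ k, ‖z k‖ ^ 2) / (2 * ħ))) := by
  fun_prop

theorem integral_gaussian_moment (hħ : 0 < ħ) (j : ℕ) :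
    ∫ w : ℂ, 1 / (2 * Real.pi * ħ) * (‖w‖ ^ (2 * j) * Real.exp (-‖w‖ ^ 2 / (2 * ħ))) =
      (2 * ħ) ^ j * j.factorial := by
  have h := Complex.integral_rpow_mul_exp_neg_mul_rpow (p := 2) (q := ((2 * j : ℕ) : ℝ))
    (b := (2 * ħ)⁻¹) (by norm_num) (by linarith [(2 * j).cast_nonneg (α := ℝ)]) (by positivity)
  rw [integral_const_mul]
  have e : ∀ w : ℂ, ‖w‖ ^ (2 * j) * Real.exp (-‖w‖ ^ 2 / (2 * ħ)) =
      ‖w‖ ^ (((2 * j : ℕ) : ℝ)) * Real.exp (-(2 * ħ)⁻¹ * ‖w‖ ^ (2 : ℝ)) := fun w => by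
    rw [Real.rpow_natCast, Real.rpow_two]
    congr 2
    ring
  have e1 : (((2 * j : ℕ) : ℝ) + 2) / 2 = j + 1 := by push_cast; ring
  have e2 : -(((2 * j : ℕ) : ℝ) + 2) / 2 = -((j + 1 : ℕ) : ℝ) := by push_cast; ring
  simp only [e]
  rw [h, e1, e2, Real.Gamma_nat_eq_factorial, Real.rpow_neg (by positivity), Real.rpow_natCast, inv_pow,
    inv_inv]
  have := Real.pi_pos
  field_simp
  ring

/-- Integrability follows from the value: a non-integrable function has integral 0 by convention,
but the moment is positive. -/
theorem integrable_gaussian_moment (hħ : 0 < ħ) (j : ℕ) : Integrable fun w : ℂ =>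
    1 / (2 * Real.pi * ħ) * (‖w‖ ^ (2 * j) * Real.exp (-‖w‖ ^ 2 / (2 * ħ))) := by
  by_contra h
  have h1 := integral_gaussian_moment hħ j
  rw [integral_undef h] at h1
  have : (0 : ℝ) < (2 * ħ) ^ j * j.factorial := by positivity
  linarith

theorem norm_zbarPow (I : MI n) (z : Fin n → ℂ) : ‖zbarPow I z‖ = ∏ k, ‖z k‖ ^ I k := by
  simp [zbarPow, norm_prod]

theorem continuous_zbarPow (I : MI n) : Continuous (zbarPow I) :=
  continuous_finsetProd _ fun k _ => (continuous_conj.comp (continuous_apply k)).pow _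

theorem lintegral_zbarPow (hħ : 0 < ħ) (I : MI n) :
    ∫⁻ z, ‖zbarPow I z‖ₑ ^ 2 ∂(bfMeasure n ħ) = ENNReal.ofReal (2 * ħ) ^ I.deg * I.fact := by
  have hm : Measurable fun z : Fin n → ℂ => ‖zbarPow I z‖ₑ ^ 2 :=
    (continuous_zbarPow I).measurable.enorm.pow_const 2
  rw [bfMeasure, lintegral_withDensity_eq_lintegral_mul _ (measurable_bfDensity n ħ) hm]
  set g : Fin n → ℂ → ℝ := fun k w =>
    1 / (2 * Real.pi * ħ) * (‖w‖ ^ (2 * I k) * Real.exp (-‖w‖ ^ 2 / (2 * ħ))) with hg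
  have e : ∀ z : Fin n → ℂ, ((fun z : Fin n → ℂ => ENNReal.ofReal (1 / (2 * Real.pi * ħ) ^ n *
      Real.exp (-(∑ k, ‖z k‖ ^ 2) / (2 * ħ)))) * fun z => ‖zbarPow I z‖ₑ ^ 2) z =
      ENNReal.ofReal (∏ k, g k (z k)) := by
    intro z
    rw [Pi.mul_apply, ← ofReal_norm, ← ENNReal.ofReal_pow (norm_nonneg _),
      ← ENNReal.ofReal_mul (by have := Real.pi_pos; positivity), norm_zbarPow, hg]
    simp only [Finset.prod_mul_distrib, ← Real.exp_sum, Finset.prod_const, Finset.card_univ,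
      Fintype.card_fin, ← Finset.prod_pow, ← pow_mul, div_pow, one_pow, ← Finset.sum_div,
      Finset.sum_neg_distrib, mul_comm _ 2]
    congr 1
    ring
  simp only [e]
  rw [← ofReal_integral_eq_lintegral_ofReal, integral_fintype_prod_volume_eq_prod]
  · simp only [hg, integral_gaussian_moment hħ]
    rw [Finset.prod_mul_distrib, MI.fact, MI.deg, Finset.prod_pow_eq_pow_sum, ← Nat.cast_prod,
      ENNReal.ofReal_mul (by positivity), ENNReal.ofReal_pow (by positivity), ENNReal.ofReal_natCast]
  · exact Integrable.fintype_prod fun k => integrable_gaussian_moment hħ (I k)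
  · exact ae_of_all _ fun z => Finset.prod_nonneg fun k _ => by
      have := Real.pi_pos
      positivity

/-! ### Rotation invariance -/

/-- The action of the torus on `ℂⁿ`. -/
noncomputable def torusRot (θ : Fin n → UnitAddCircle) (z : Fin n → ℂ) : Fin n → ℂ :=
  fun k => (AddCircle.toCircle (θ k) : ℂ) * z k

theorem continuous_torusRot :
    Continuous fun p : (Fin n → UnitAddCircle) × (Fin n → ℂ) => torusRot p.1 p.2 :=
  continuous_pi fun k => (continuous_induced_dom.comp (AddCircle.continuous_toCircle.comp
    ((continuous_apply k).comp continuous_fst))).mul ((continuous_apply k).comp continuous_snd)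

theorem fourier_natCast (i : ℕ) (t : UnitAddCircle) :
    (fourier (i : ℤ) t : ℂ) = (AddCircle.toCircle t : ℂ) ^ i := by
  induction i with
  | zero => simp
  | succ i ih => rw [Nat.cast_succ, fourier_add, ih, fourier_one, pow_succ]

theorem zbarPow_torusRot (I : MI n) (θ : Fin n → UnitAddCircle) (z : Fin n → ℂ) :
    zbarPow I (torusRot θ z) = zbarPow I z * torusChar I θ := by
  rw [zbarPow, zbarPow, torusChar, ← Finset.prod_mul_distrib]
  refine Finset.prod_congr rfl fun k _ => ?_
  rw [fourier_neg, fourier_natCast, torusRot, map_mul, mul_pow, map_pow, mul_comm]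

theorem measurePreserving_torusRot (θ : Fin n → UnitAddCircle) :
    MeasurePreserving (torusRot θ) (volume : Measure (Fin n → ℂ)) volume :=
  volume_preserving_pi fun k => (rotation (AddCircle.toCircle (θ k))).measurePreserving

/-- Rotations preserve Lebesgue measure, and the Gaussian density depends on the moduli |z_k| only.
-/
theorem lintegral_torusRot (θ : Fin n → UnitAddCircle) {G : (Fin n → ℂ) → ℝ≥0∞} (hG : Measurable G) :
    ∫⁻ z, G (torusRot θ z) ∂(bfMeasure n ħ) = ∫⁻ z, G z ∂(bfMeasure n ħ) := by
  have hθ := measurePreserving_torusRot θ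
  have h := lintegral_withDensity_eq_lintegral_mul volume (measurable_bfDensity n ħ)
    (hG.comp hθ.measurable)
  simp only [Function.comp_apply] at h
  rw [bfMeasure, lintegral_withDensity_eq_lintegral_mul _ (measurable_bfDensity n ħ) hG, h,
    ← hθ.lintegral_comp ((measurable_bfDensity n ħ).mul hG)]
  refine lintegral_congr fun z => ?_
  simp [torusRot, Circle.norm_coe]

/-! ### The norm of an antiholomorphic function -/

theorem hasSum_zbarPow {a : MI n → MI n → ℂ} (ha : EntireArray a) (h0 : ∀ R S, R ≠ 0 → a R S = 0)
    (z : Fin n → ℂ) : HasSum (fun I : MI n => a 0 I / (I.fact : ℂ) * zbarPow I z) (taylorSum a z) ∧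
      Summable fun I : MI n => ‖a 0 I / (I.fact : ℂ) * zbarPow I z‖ := by
  have hinj : Function.Injective fun I : MI n => ((0 : MI n), I) := fun I J h => (Prod.ext_iff.1 h).2
  have e : ∀ I : MI n, serCoef a (0, I) * monom (0, I) z = a 0 I / (I.fact : ℂ) * zbarPow I z := by
    intro I
    have hz : zPow (0 : MI n) z = 1 := by simp [zPow]
    simp only [serCoef, monom, hz, one_mul, MI.fact_zero, Nat.cast_one]
  constructor
  · have h := ha.hasSum z
    rw [← hinj.hasSum_iff] at h
    · simpa only [Function.comp_def, e] using h
    · rintro ⟨R, S⟩ hRS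
      have hR : R ≠ 0 := by
        rintro rfl
        exact hRS ⟨S, rfl⟩
      simp [serCoef, h0 R S hR]
  · have h := (ha.summable_norm z).comp_injective hinj
    simpa only [Function.comp_def, e] using h

/-- The integral is averaged over the torus, Tonelli exchanges the integrals, and Parseval on each
orbit reduces everything to Gaussian moments. The identity holds in [0, ∞], so square-integrability
of F is equivalent to finiteness of the sum. -/
theorem lintegral_taylorSum (hħ : 0 < ħ) {a : MI n → MI n → ℂ} (ha : EntireArray a)
    (h0 : ∀ R S, R ≠ 0 → a R S = 0) : ∫⁻ z, ‖taylorSum a z‖ₑ ^ 2 ∂(bfMeasure n ħ) =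
      ∑' I : MI n, ENNReal.ofReal (2 * ħ) ^ I.deg / (I.fact : ℝ≥0∞) * ‖a 0 I‖ₑ ^ 2 := by
  have hc : Continuous (taylorSum a) := ha.analyticOnNhd.contDiff (n := 0) |>.continuous
  have hsf : SFinite (bfMeasure n ħ) := by unfold bfMeasure; infer_instance
  have hrot : ∀ θ z, taylorSum a (torusRot θ z) =
      ∑' I : MI n, (a 0 I / (I.fact : ℂ) * zbarPow I z) * torusChar I θ := by
    intro θ z
    rw [← (hasSum_zbarPow ha h0 _).1.tsum_eq]
    simp only [zbarPow_torusRot, mul_assoc]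
  calc ∫⁻ z, ‖taylorSum a z‖ₑ ^ 2 ∂(bfMeasure n ħ)
      = ∫⁻ _θ : Fin n → UnitAddCircle, ∫⁻ z, ‖taylorSum a z‖ₑ ^ 2 ∂(bfMeasure n ħ) := by
        rw [lintegral_const, measure_univ, mul_one]
    _ = ∫⁻ θ : Fin n → UnitAddCircle, ∫⁻ z, ‖taylorSum a (torusRot θ z)‖ₑ ^ 2 ∂(bfMeasure n ħ) :=
        lintegral_congr fun θ => (lintegral_torusRot θ (hc.measurable.enorm.pow_const 2)).symm
    _ = ∫⁻ z, (∫⁻ θ : Fin n → UnitAddCircle, ‖taylorSum a (torusRot θ z)‖ₑ ^ 2) ∂(bfMeasure n ħ) := by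
        refine lintegral_lintegral_swap (Measurable.aemeasurable ?_)
        exact (hc.comp continuous_torusRot).measurable.enorm.pow_const 2
    _ = ∫⁻ z, ∑' I : MI n, ‖a 0 I / (I.fact : ℂ) * zbarPow I z‖ₑ ^ 2 ∂(bfMeasure n ħ) := by
        refine lintegral_congr fun z => ?_
        simp only [hrot]
        exact lintegral_torus (hasSum_zbarPow ha h0 z).2
    _ = ∑' I : MI n, ∫⁻ z, ‖a 0 I / (I.fact : ℂ) * zbarPow I z‖ₑ ^ 2 ∂(bfMeasure n ħ) :=
        lintegral_tsum fun I =>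
          ((continuous_const.mul (continuous_zbarPow I)).measurable.enorm.pow_const 2).aemeasurable
    _ = _ := by
        refine tsum_congr fun I => ?_
        simp only [enorm_mul, mul_pow]
        rw [lintegral_const_mul _ ((continuous_zbarPow I).measurable.enorm.pow_const 2),
          lintegral_zbarPow hħ, div_eq_mul_inv, enorm_mul, enorm_inv (by exact_mod_cast I.fact_ne_zero),
          ← ofReal_norm (I.fact : ℂ), Complex.norm_natCast, ENNReal.ofReal_natCast]
        have hI : (I.fact : ℝ≥0∞)⁻¹ * I.fact = 1 :=
          ENNReal.inv_mul_cancel (by exact_mod_cast I.fact_ne_zero) (ENNReal.natCast_ne_top _)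
        calc _ = ENNReal.ofReal (2 * ħ) ^ I.deg * (I.fact : ℝ≥0∞)⁻¹ * ‖a 0 I‖ₑ ^ 2 *
              ((I.fact : ℝ≥0∞)⁻¹ * I.fact) := by ring
          _ = _ := by rw [hI, mul_one, div_eq_mul_inv]

/-! ### The embedding into the Bargmann–Fock space -/

theorem EntireArray.mono {a b : MI n → MI n → ℂ} (hb : EntireArray b) (h : ∀ R S, ‖a R S‖ ≤ ‖b R S‖) :
    EntireArray a := by
  intro ρ
  refine ne_top_of_le_ne_top (hb ρ) (ENNReal.tsum_le_tsum fun p => mul_le_mul_left ?_ _)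
  rw [enorm_le_iff_norm_le, serCoef, serCoef, norm_div, norm_div]
  gcongr
  exact h _ _

theorem eLpNorm_two_sq {α : Type*} {mα : MeasurableSpace α} (μ : Measure α) (F : α → ℂ) :
    eLpNorm F 2 μ ^ 2 = ∫⁻ z, ‖F z‖ₑ ^ 2 ∂μ := by
  have h := eLpNorm_nnreal_pow_eq_lintegral (f := F) (μ := μ) (p := 2) (by norm_num)
  simpa using h

theorem eLpNorm_taylorSum_sq (hħ : 0 < ħ) {a : MI n → MI n → ℂ} (ha : EntireArray a)
    (h0 : ∀ R S, R ≠ 0 → a R S = 0) : eLpNorm (taylorSum a) 2 (bfMeasure n ħ) ^ 2 =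
      ∑' I : MI n, ENNReal.ofReal (2 * ħ) ^ I.deg / (I.fact : ℝ≥0∞) * ‖a 0 I‖ₑ ^ 2 := by
  rw [eLpNorm_two_sq, lintegral_taylorSum hħ ha h0]

/-- The index of the seminorm that is the norm of the Bargmann–Fock space. -/
def bfIdx (n : ℕ) : SIdx n := ⟨0, ⟨0, by simp⟩, 0, 0⟩

theorem tsum_coef_zero (f : WickAlg n ħ) :
    ∑' I : MI n, ENNReal.ofReal (2 * ħ) ^ I.deg / (I.fact : ℝ≥0∞) * ‖f.coef 0 I‖ₑ ^ 2 =
      ENNReal.ofReal (wickSeminorm n ħ (bfIdx n) f) ^ 2 := by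
  have h := wickSeminorm_pow (bfIdx n) f
  simp only [bfIdx, wickIter, wickBase, zero_add, pow_one, MI.deg_zero, add_zero] at h
  exact h.symm

theorem eLpNorm_of_mem (hħ : 0 < ħ) {f : WickAlg n ħ} (hf : f ∈ psiRange n hħ) :
    eLpNorm (f : (Fin n → ℂ) → ℂ) 2 (bfMeasure n ħ) =
      ENNReal.ofReal (wickSeminorm n ħ (bfIdx n) f) := by
  have h : eLpNorm (f : (Fin n → ℂ) → ℂ) 2 (bfMeasure n ħ) ^ 2 =
      ENNReal.ofReal (wickSeminorm n ħ (bfIdx n) f) ^ 2 := by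
    rw [← tsum_coef_zero]
    conv_lhs => rw [f.coe_eq_taylorSum hħ]
    exact eLpNorm_taylorSum_sq hħ (f.wickArray_coef.entire hħ) fun R S hR =>
      WickAlg.coef_eq_zero_of_mem hħ hf hR S
  exact le_antisymm (ENNReal_le_of_pow_le two_ne_zero h.le) (ENNReal_le_of_pow_le two_ne_zero h.ge)

theorem memLp_of_mem (hħ : 0 < ħ) {f : WickAlg n ħ} (hf : f ∈ psiRange n hħ) :
    MemLp (f : (Fin n → ℂ) → ℂ) 2 (bfMeasure n ħ) := by
  refine ⟨f.contDiff.continuous.aestronglyMeasurable, ?_⟩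
  rw [eLpNorm_of_mem hħ hf]
  exact ENNReal.ofReal_lt_top

/-- The embedding of `D` into the Bargmann–Fock space. -/
noncomputable def bfEmbed (hħ : 0 < ħ) : psiRange n hħ →ₗ[ℂ] bargmannFock n ħ where
  toFun d := ⟨(memLp_of_mem hħ d.2).toLp _, (d : WickAlg n ħ), WickAlg.isAntiholomorphic_of_mem hħ d.2,
    MemLp.coeFn_toLp _⟩
  map_add' c d := Subtype.ext (MemLp.toLp_add (memLp_of_mem hħ c.2) (memLp_of_mem hħ d.2))
  map_smul' c d := Subtype.ext (MemLp.toLp_const_smul c (memLp_of_mem hħ d.2))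

theorem coeFn_bfEmbed (hħ : 0 < ħ) (d : psiRange n hħ) :
    ((bfEmbed hħ d : Lp ℂ 2 (bfMeasure n ħ)) : (Fin n → ℂ) → ℂ) =ᵐ[bfMeasure n ħ] (d : WickAlg n ħ) :=
  MemLp.coeFn_toLp (memLp_of_mem hħ d.2)

theorem norm_bfEmbed (hħ : 0 < ħ) (d : psiRange n hħ) :
    ‖bfEmbed hħ d‖ = wickSeminorm n ħ (bfIdx n) (d : WickAlg n ħ) := by
  have h : ‖bfEmbed hħ d‖ = ‖(memLp_of_mem hħ d.2).toLp _‖ := rfl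
  rw [h, Lp.norm_toLp, eLpNorm_of_mem hħ d.2, ENNReal.toReal_ofReal (apply_nonneg _ _)]

theorem hasSum_norm_bfEmbed_sq (hħ : 0 < ħ) (d : psiRange n hħ) :
    HasSum (fun N : MI n => (2 * ħ) ^ N.deg / (N.fact : ℝ) * ‖(d : WickAlg n ħ).coef 0 N‖ ^ 2)
      (‖bfEmbed hħ d‖ ^ 2) := by
  have h := tsum_coef_zero (d : WickAlg n ħ)
  have h1 : ∑' I : MI n, ENNReal.ofReal (2 * ħ) ^ I.deg / (I.fact : ℝ≥0∞) *
      ‖(d : WickAlg n ħ).coef 0 I‖ₑ ^ 2 ≠ ⊤ := by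
    rw [h]
    exact ENNReal.pow_ne_top ENNReal.ofReal_ne_top
  have h2 := (ENNReal.summable_toReal h1).hasSum
  rw [← ENNReal.tsum_toReal_eq (ENNReal.ne_top_of_tsum_ne_top h1), h, ENNReal.toReal_pow,
    ENNReal.toReal_ofReal (apply_nonneg _ _), ← norm_bfEmbed] at h2
  convert h2 using 2 with N
  rw [ENNReal.toReal_mul, ENNReal.toReal_div, ENNReal.toReal_pow, ENNReal.toReal_pow, toReal_enorm,
    ENNReal.toReal_natCast, ENNReal.toReal_ofReal (by positivity)]

/-- Both sides are polarized: the norm formula is summed over the four combinations c ± d, c ± i d,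
and polarization in ℂ is applied to each coefficient. -/
theorem inner_bfEmbed (hħ : 0 < ħ) (c d : psiRange n hħ) : inner ℂ (bfEmbed hħ c) (bfEmbed hħ d) =
    wickStar ħ (conjFun (c : WickAlg n ħ)) (d : WickAlg n ħ) 0 := by
  have hs : ∀ x : psiRange n hħ, HasSum (fun N : MI n => (((2 * ħ) ^ N.deg / (N.fact : ℝ) : ℝ) : ℂ) *
      (‖(x : WickAlg n ħ).coef 0 N‖ : ℂ) ^ 2) ((‖bfEmbed hħ x‖ : ℂ) ^ 2) := by
    intro x
    have := Complex.hasSum_ofReal.2 (hasSum_norm_bfEmbed_sq hħ x)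
    push_cast at this ⊢
    exact this
  have h := ((((hs (c + d)).sub (hs (c - d))).add (((hs (c - Complex.I • d)).sub
    (hs (c + Complex.I • d))).mul_right Complex.I)).div_const 4)
  refine (inner_eq_sum_norm_sq_div_four (𝕜 := ℂ) (bfEmbed hħ c) (bfEmbed hħ d)).trans ?_
  have e1 : (RCLike.I : ℂ) • bfEmbed hħ d = bfEmbed hħ (Complex.I • d) := (map_smul _ _ _).symm
  rw [e1, ← map_add, ← map_sub, ← map_add, ← map_sub]
  refine h.tsum_eq.symm.trans (tsum_congr fun N => ?_)
  have hc : ∀ x y : psiRange n hħ, ((x + y : psiRange n hħ) : WickAlg n ħ).coef 0 N =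
      (x : WickAlg n ħ).coef 0 N + (y : WickAlg n ħ).coef 0 N := fun x y => by
    rw [Submodule.coe_add, WickAlg.coef_add]
    rfl
  have hc' : ∀ x y : psiRange n hħ, ((x - y : psiRange n hħ) : WickAlg n ħ).coef 0 N =
      (x : WickAlg n ħ).coef 0 N - (y : WickAlg n ħ).coef 0 N := fun x y => by
    rw [Submodule.coe_sub, WickAlg.coef_sub]
    rfl
  have hc'' : ((Complex.I • d : psiRange n hħ) : WickAlg n ħ).coef 0 N =
      Complex.I • (d : WickAlg n ħ).coef 0 N := by
    rw [Submodule.coe_smul, WickAlg.coef_smul]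
    rfl
  have hp := inner_eq_sum_norm_sq_div_four (𝕜 := ℂ) ((c : WickAlg n ħ).coef 0 N) ((d : WickAlg n ħ).coef 0 N)
  rw [RCLike.inner_apply] at hp
  rw [wickTerm_conj, hc, hc', hc', hc, hc'']
  change _ = (2 * (ħ : ℂ)) ^ N.deg / (N.fact : ℂ) *
      (starRingEnd ℂ) ((c : WickAlg n ħ).coef 0 N) * (d : WickAlg n ħ).coef 0 N
  rw [mul_assoc, mul_comm ((starRingEnd ℂ) _), hp]
  simp only [RCLike.I_to_complex, RCLike.ofReal_eq_complex_ofReal]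
  push_cast
  ring

theorem bfEmbed_injective (hħ : 0 < ħ) : Function.Injective (bfEmbed (n := n) hħ) := by
  rw [← LinearMap.ker_eq_bot, LinearMap.ker_eq_bot']
  intro d hd
  have h := hasSum_norm_bfEmbed_sq hħ d
  rw [hd, norm_zero, zero_pow two_ne_zero, hasSum_zero_iff_of_nonneg fun N => by positivity] at h
  refine Subtype.ext (WickAlg.coef_injective ?_)
  rw [Submodule.coe_zero, WickAlg.coef_zero]
  funext R S
  by_cases hR : R = 0
  · subst hR
    have h1 := congrFun h S
    have h2 : (2 * ħ) ^ S.deg / (S.fact : ℝ) ≠ 0 := by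
      have := S.fact_pos
      positivity
    simpa [h2] using h1
  · exact WickAlg.coef_eq_zero_of_mem hħ d.2 hR S

theorem continuous_bfEmbed (hħ : 0 < ħ) : Continuous (bfEmbed (n := n) hħ) := by
  have hw : WithSeminorms ((wickSeminorm n ħ).comp (psiRange n hħ).subtype) :=
    (isInducing_subtype (psiRange n hħ)).withSeminorms withSeminorms_wickSeminorm
  refine hw.continuous_normedSpace_rng _ (bfEmbed hħ) ⟨{bfIdx n}, 1, fun d => ?_⟩
  rw [Finset.sup_singleton, one_smul]
  exact (norm_bfEmbed hħ d).le

/-- The truncation of an array to finitely many second indices. -/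
def arrTrunc (a : MI n → MI n → ℂ) (s : Finset (MI n)) (R S : MI n) : ℂ :=
  if S ∈ s then a R S else 0

theorem wickArray_arrTrunc {a : MI n → MI n → ℂ} (h0 : ∀ R S, R ≠ 0 → a R S = 0) (s : Finset (MI n)) :
    WickArray ħ (arrTrunc a s) := by
  refine .of_norm_le (C := ∑ S ∈ s, ‖a 0 S‖) fun R S => ?_
  unfold arrTrunc
  split_ifs with hS
  · by_cases hR : R = 0
    · subst hR
      exact Finset.single_le_sum (f := fun S => ‖a 0 S‖) (fun _ _ => norm_nonneg _) hS
    · rw [h0 R S hR, norm_zero]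
      positivity
  · rw [norm_zero]
    positivity

/-- An element of the Bargmann–Fock space is an everywhere convergent Taylor series in z̄ whose
truncations are polynomials, hence in D. The norm formula makes the squared distance the omitted
part of a convergent series. -/
theorem denseRange_bfEmbed (hħ : 0 < ħ) : DenseRange (bfEmbed (n := n) hħ) := by
  rintro ⟨ψ, F, hF, hψ⟩
  obtain ⟨a, ha, h0, rfl⟩ := hF.exists_taylorSum
  have hfin : ∑' I : MI n, ENNReal.ofReal (2 * ħ) ^ I.deg / (I.fact : ℝ≥0∞) * ‖a 0 I‖ₑ ^ 2 ≠ ⊤ := by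
    rw [← eLpNorm_taylorSum_sq hħ ha h0, ← eLpNorm_congr_ae hψ]
    exact ENNReal.pow_ne_top (Lp.eLpNorm_ne_top ψ)
  have hT0 : ∀ s R S, R ≠ 0 → arrTrunc a s R S = 0 := fun s R S hR => by simp [arrTrunc, h0 R S hR]
  have hb : ∀ s, EntireArray (a - arrTrunc a s) := fun s => ha.mono fun R S => by
    simp only [Pi.sub_apply, arrTrunc]
    split_ifs <;> simp
  have hb0 : ∀ s R S, R ≠ 0 → (a - arrTrunc a s) R S = 0 := fun s R S hR => by
    simp [h0 R S hR, hT0 s R S hR]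
  let d : Finset (MI n) → psiRange n hħ := fun s =>
    ⟨.ofArray hħ (arrTrunc a s) (wickArray_arrTrunc h0 s), (WickAlg.mem_range_psi_iff hħ _).2
      ((WickAlg.psi_eq_self_iff hħ _).2 fun R S hR => by rw [WickAlg.coef_ofArray, hT0 s R S hR])⟩
  have hsub : ∀ s, taylorSum a - ((d s : WickAlg n ħ) : (Fin n → ℂ) → ℂ) =
      taylorSum (a - arrTrunc a s) := by
    intro s
    funext z
    have h := (hasSum_zbarPow ha h0 z).1.sub (hasSum_zbarPow ((wickArray_arrTrunc h0 s).entire hħ)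
      (hT0 s) z).1
    simp only [← sub_mul, ← sub_div] at h
    exact h.unique (hasSum_zbarPow (hb s) (hb0 s) z).1
  have hdist : ∀ s, edist (⟨ψ, taylorSum a, hF, hψ⟩ : bargmannFock n ħ) (bfEmbed hħ (d s)) ^ 2 =
      ∑' I : MI n, ENNReal.ofReal (2 * ħ) ^ I.deg / (I.fact : ℝ≥0∞) * ‖(a - arrTrunc a s) 0 I‖ₑ ^ 2 := by
    intro s
    rw [← eLpNorm_taylorSum_sq hħ (hb s) (hb0 s), ← hsub, Subtype.edist_eq, Lp.edist_def]
    rw [eLpNorm_congr_ae (hψ.sub (coeFn_bfEmbed hħ (d s)))]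
  have hlim : Tendsto (fun s => edist (⟨ψ, taylorSum a, hF, hψ⟩ : bargmannFock n ħ)
      (bfEmbed hħ (d s)) ^ 2) atTop (𝓝 0) := by
    simp only [hdist]
    refine ENNReal_tendsto_tsum_zero (fun s I => ?_) hfin fun I => ?_
    · gcongr
      rw [enorm_le_iff_norm_le]
      simp only [Pi.sub_apply, arrTrunc]
      split_ifs <;> simp
    · refine tendsto_const_nhds.congr' ?_
      filter_upwards [eventually_ge_atTop {I}] with s hs
      simp [arrTrunc, Finset.singleton_subset_iff.1 hs]
  rw [EMetric.mem_closure_iff]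
  intro ε hε
  obtain ⟨s, hs⟩ := (hlim.eventually_lt_const (ENNReal.pow_pos hε 2)).exists
  refine ⟨_, ⟨d s, rfl⟩, ?_⟩
  by_contra! hle
  exact absurd hs (not_lt.2 (by gcongr))

theorem exists_embedding_bargmannFock (hħ : 0 < ħ) :
    ∃ ι : psiRange n hħ →ₗ[ℂ] bargmannFock n ħ,
      (∀ d, ((ι d : Lp ℂ 2 (bfMeasure n ħ)) : (Fin n → ℂ) → ℂ) =ᵐ[bfMeasure n ħ] (d : WickAlg n ħ)) ∧
      Function.Injective ι ∧ DenseRange ι ∧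
      (∀ c d, inner ℂ (ι c) (ι d) =
        wickStar ħ (conjFun (c : WickAlg n ħ)) (d : WickAlg n ħ) 0) ∧ Continuous ι :=
  ⟨bfEmbed hħ, coeFn_bfEmbed hħ, bfEmbed_injective hħ, denseRange_bfEmbed hħ, inner_bfEmbed hħ,
    continuous_bfEmbed hħ⟩

end WickGNS

/-! ### The theorem -/

theorem mainTheorem10 (n : ℕ) (ħ : ℝ) (hħ : 0 < ħ) :
    IsFrechet (WickAlg n ħ) ∧
    ∃ (cc : WickAlg n ħ → WickAlg n ħ)
      (star : WickAlg n ħ →ₗ[ℂ] WickAlg n ħ →ₗ[ℂ] WickAlg n ħ)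
      (Ψ : WickAlg n ħ →L[ℂ] WickAlg n ħ),
      -- complex conjugation, the Wick star product and the z̄-Taylor expansion on `A_ħ`
      (∀ (f : WickAlg n ħ) z, cc f z = (starRingEnd ℂ) (f z)) ∧
      (∀ (f g : WickAlg n ħ) z, HasSum (wickTerm ħ f g z) (star f g z)) ∧
      (∀ (f : WickAlg n ħ) z, HasSum (fun I : MI n => mixedD 0 I f 0 / (I.fact : ℂ) * zbarPow I z) (Ψ f z)) ∧
      -- (i) `Ψ` is a continuous projection with kernel `J₀`, seminorm by seminorm contractive
      (∀ f, Ψ (Ψ f) = Ψ f) ∧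
      LinearMap.ker Ψ.toLinearMap = gelfandIdeal n ħ hħ ∧
      (∀ q f, wickSeminorm n ħ q (Ψ f) ≤ wickSeminorm n ħ q f) ∧
      (∀ f : WickAlg n ħ, (∀ q, wickSeminorm n ħ q (Ψ f) = wickSeminorm n ħ q f) ↔ IsAntiholomorphic f) ∧
      -- (ii) `[f] ↦ Ψ f` is an isomorphism of Fréchet spaces from `D₀` onto `D = im Ψ`
      IsFrechet (GNSSpace n ħ hħ) ∧
      IsFrechet (LinearMap.range Ψ.toLinearMap) ∧
      ∃ Φ : GNSSpace n ħ hħ ≃L[ℂ] LinearMap.range Ψ.toLinearMap,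
        (∀ f, (Φ (gnsClass hħ f) : WickAlg n ħ) = Ψ f) ∧
        (∀ q f, gnsSeminorm hħ q (gnsClass hħ f) = wickSeminorm n ħ q (Ψ f)) ∧
        -- (iii) `D` is a dense subspace of the Bargmann–Fock space, with a finer topology,
        -- and `[f] ↦ Ψ f` preserves the inner products
        (∃ ι : LinearMap.range Ψ.toLinearMap →ₗ[ℂ] bargmannFock n ħ,
          (∀ d, ((ι d : Lp ℂ 2 (bfMeasure n ħ)) : (Fin n → ℂ) → ℂ)
            =ᵐ[bfMeasure n ħ] (d : WickAlg n ħ)) ∧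
          Function.Injective ι ∧
          DenseRange ι ∧
          (∀ f g, gnsInner hħ (gnsClass hħ f) (gnsClass hħ g) = star (cc f) g 0) ∧
          (∀ x y, inner ℂ (ι (Φ x)) (ι (Φ y)) = gnsInner hħ x y) ∧
          (inferInstance : TopologicalSpace (LinearMap.range Ψ.toLinearMap)) ≤
            TopologicalSpace.induced ι inferInstance) ∧
        -- (iv) the GNS representation `ρ` and the Bargmann–Fock representation `π`
        ∃ (ρ : WickAlg n ħ →ₗ[ℂ] GNSSpace n ħ hħ →ₗ[ℂ] GNSSpace n ħ hħ)
          (π : WickAlg n ħ →ₗ[ℂ] LinearMap.range Ψ.toLinearMap →ₗ[ℂ]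
            LinearMap.range Ψ.toLinearMap),
          (∀ f g, ρ f (gnsClass hħ g) = gnsClass hħ (star f g)) ∧
          (∀ f x, π f (Φ x) = Φ (ρ f x)) ∧
          (∃ (e : MI n → LinearMap.range Ψ.toLinearMap)
            (c : WickAlg n ħ → MI n → LinearMap.range Ψ.toLinearMap)
            (t : WickAlg n ħ → LinearMap.range Ψ.toLinearMap → MI n →
              LinearMap.range Ψ.toLinearMap),
            (∀ J z, (e J : WickAlg n ħ) z = zbarPow J z) ∧
            (∀ (f : WickAlg n ħ) I, HasSum (fun J : MI n => (mixedD I J f 0 / (J.fact : ℂ)) • e J) (c f I)) ∧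
            (∀ f d I z, (t f d I : WickAlg n ħ) z =
              (c f I : WickAlg n ħ) z * mixedD 0 I (d : WickAlg n ħ) z) ∧
            (∀ f d, HasSum
              (fun I : MI n => ((2 * (ħ : ℂ)) ^ I.deg / (I.fact : ℂ)) • t f d I) (π f d))) ∧
          -- (v) joint continuity
          Continuous (fun p : WickAlg n ħ × LinearMap.range Ψ.toLinearMap => π p.1 p.2) := by

  obtain ⟨ι, hι, hinj, hdense, hinner, hcont⟩ := exists_embedding_bargmannFock (n := n) hħ
  refine ⟨WickAlg.isFrechet hħ, WickAlg.conj hħ, WickAlg.star hħ, WickAlg.psi hħ,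
    WickAlg.conj_apply hħ, WickAlg.hasSum_star hħ, WickAlg.hasSum_psi hħ, WickAlg.psi_psi hħ,
    WickAlg.ker_psi hħ, wickSeminorm_psiAux_le hħ, WickAlg.wickSeminorm_psi_eq_iff hħ, ?_, ?_,
    WickAlg.gnsEquiv hħ, WickAlg.gnsEquiv_apply hħ, gnsSeminorm_gnsClass hħ, ?_, ?_⟩
  · exact ((WickAlg.isFrechet hħ).of_isClosed _ (WickAlg.isClosed_range_psi hħ)).of_continuousLinearEquiv
      (WickAlg.gnsEquiv hħ)
  · exact (WickAlg.isFrechet hħ).of_isClosed _ (WickAlg.isClosed_range_psi hħ)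
  · refine ⟨ι, hι, hinj, hdense, fun f g => ?_, fun x y => ?_, continuous_iff_le_induced.1 hcont⟩
    · have e : conjFun (f : (Fin n → ℂ) → ℂ) = (f.conj hħ : (Fin n → ℂ) → ℂ) :=
        (funext (WickAlg.conj_apply hħ f)).symm
      rw [gnsInner_mk, e]
      exact (WickAlg.hasSum_star hħ _ g 0).tsum_eq
    · obtain ⟨f, rfl⟩ := Submodule.mkQ_surjective _ x
      obtain ⟨g, rfl⟩ := Submodule.mkQ_surjective _ y
      rw [hinner, ← gnsInner_mk hħ]
      congr 1
      -- Ψ_f and f have the same class because Ψ is idempotent, so the inner product may be computed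
      -- with Ψ_f and Ψ_g.
      · exact (WickAlg.psi_eq_psi_iff hħ _ _).1 (WickAlg.psi_psi hħ f)
      · exact (WickAlg.psi_eq_psi_iff hħ _ _).1 (WickAlg.psi_psi hħ g)
  · exact ⟨gnsRep hħ, bfRep hħ, gnsRep_gnsClass hħ, bfRep_gnsEquiv hħ,
      ⟨psiMonom hħ, innerSeries hħ, outerTerm hħ, psiMonom_apply hħ, hasSum_innerSeries hħ,
        outerTerm_apply hħ, hasSum_outerTerm hħ⟩, continuous_bfRep hħ⟩
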